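/- Let $3\le n\le\infty$. An $n$-ordinal ($n<\infty$) is a finite set $T$ with binary relations $<_0,\dots,<_{n-1}$ such that each $<_p$ is nonreflexive; for distinct $a,b$ there is exactly one $p$ with $a<_pb$ or $b<_pa$; and $a<_pb$, $b<_qc$ imply $a<_{\min(p,q)}c$. An $\infty$-ordinal is defined in the same way with relations $<_0,<_{-1},<_{-2},\dots$. A map $\sigma:T\to S$ of $n$-ordinals is a map of sets such that $i<_pj$ implies $\sigma(i)<_r\sigma(j)$ for some $r\ge p$, or $\sigma(i)=\sigma(j)$, or $\sigma(j)<_r\sigma(i)$ for some $r>p$. Let $Ord(n)$ be the skeletal category of $n$-ordinals and $U_n$ its terminal (one-point) object. The fibers $\sigma^{-1}(i)$ are $n$-ordinals. The total order of $T$ is given by $a<b$ iff $a<_pb$ for some $p$; a map is order preserving if it preserves the total orders (weakly), and a quasibijection if it is bijective. Let $Q_n\subset Ord(n)$ be the subcategory of quasibijections, $\Pi Q_n$ its fundamental groupoid (the localization at all morphisms), $\mathcal S$ the groupoid of finite ordinals $[k]$, $k\ge-1$, and all bijections, and $s_n:\Pi Q_n\to\mathcal S$ the functor induced by the total order functor $Q_n\to\mathcal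 S$. Let $V$ be a symmetric monoidal category with unit $I$. * An $n$-operad in $V$ is a family of objects $A_T$, $T\in Ord(n)$, with a unit $e:I\to A_{U_n}$ and, for every map $\sigma:T\to S$ with fibers $T_0,\dots,T_k$, a multiplication $A_S\otimes(A_{T_0}\otimes\dots\otimes A_{T_k})\to A_T$, which is associative for composites $T\to S\to R$ (up to the symmetry of $V$ that reorders the factors) and unital for the maps $\mathrm{id}_T$ and $T\to U_n$. Inserting units, each quasibijection $\sigma:T\to S$ induces $A(\sigma):A_S\to A_T$; the $n$-operad is quasisymmetric if all these $A(\sigma)$ are isomorphisms. Morphisms are families of morphisms $A_T\to B_T$ compatible with units and multiplications. * A $Q_n$-operad in $V$ is a functor $A:(\Pi Q_n)^{op}\to V$ with a unit $e:I\to A_{U_n}$ and multiplications $\mu_\sigma:A_S\otimes(A_{T_0}\otimes\dots\otimes A_{T_k})\to A_T$ for the order preserving maps $\sigma:T\to S$, associative and unital as above, such that: (1) for every commutative square $\sigma\pi=\rho\sigma'$ with $\sigma:T\to S$, $\sigma':T'\to S'$ order preserving and $\pi:T'\to T$, $\rho:S'\to S$ quasibijections, one has $A(\pi)\mu_\sigma=\mu_{\sigma'}\circ(A(\rho)\otimes\theta)$,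 where $\theta:\bigotimes_{i\in S}A_{T_i}\to\bigotimes_{j\in S'}A_{T'_j}$ is the symmetry of $V$ given by $\rho$ followed by the tensor product of the maps $A(\pi_j)$ for the restrictions $\pi_j:T'_j\to T_{\rho(j)}$ of $\pi$; (2) for every commutative square $\eta\sigma=\eta'\sigma'$ with $\sigma:T\to T''$, $\sigma':T\to T'$ quasibijections and $\eta:T''\to S$, $\eta':T'\to S$ order preserving, the two morphisms $A(\sigma)\circ\mu_\eta\circ(1\otimes\bigotimes_iA(\sigma_i)^{-1})$ and $A(\sigma')\circ\mu_{\eta'}\circ(1\otimes\bigotimes_iA(\sigma'_i)^{-1})$ from $A_S\otimes\bigotimes_iA_{T_i}$ to $A_T$ coincide, where $T_i$ are the fibers of $\eta\sigma$ and $\sigma_i,\sigma'_i$ the restrictions of $\sigma,\sigma'$ to fibers. Morphisms are natural transformations compatible with units and multiplications. * A symmetric operad in $V$ is a functor $A:\mathcal S^{op}\to V$ with a unit $e:I\to A_{[0]}$ and multiplications $A_{[k]}\otimes(A_{[n_0]}\otimes\dots\otimes A_{[n_k]})\to A_{[m]}$ for order preserving maps $[m]\to[k]$ with fibers $[n_0],\dots,[n_k]$,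 associative, unital and satisfying May's two equivariance conditions (for permutations of $[k]$ acting by block permutations, and for bijections of the individual fibers). Morphisms are natural transformations compatible with units and multiplications. **Theorem.** For $3\le n\le\infty$ the functor $s_n:\Pi Q_n\to\mathcal S$ is an equivalence of groupoids, and for every symmetric monoidal category $V$ the following three categories are equivalent to each other: the category of $Q_n$-operads in $V$, the category of quasisymmetric $n$-operads in $V$, and the category of symmetric operads in $V$. -/

import Mathlib

open CategoryTheory MonoidalCategory Opposite

universe v u

noncomputable section

namespace HigherOperad

/-! ## Finite tensor products and their coherence isomorphisms -/

section Tensor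

variable {V : Type u} [Category.{v} V] [MonoidalCategory V]

/-- The tensor product `X 0 ⊗ (X 1 ⊗ (... ⊗ 𝟙_ V))` of a finite sequence of objects. -/
def tens : {k : ℕ} → (Fin k → V) → V
  | 0, _ => 𝟙_ V
  | _ + 1, X => X 0 ⊗ tens (fun i => X i.succ)

/-- The tensor product of a finite sequence of morphisms. -/
def tensMap : {k : ℕ} → {X Y : Fin k → V} → (∀ i, X i ⟶ Y i) → (tens X ⟶ tens Y)
  | 0, _, _, _ => 𝟙 (𝟙_ V)
  | _ + 1, _, _, f => f 0 ⊗ₘ tensMap (fun i => f i.succ)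

theorem tensMap_id {k : ℕ} (X : Fin k → V) : tensMap (fun i => 𝟙 (X i)) = 𝟙 (tens X) := by
  induction k with
  | zero => rfl
  | succ k ih =>
    rw [tensMap, ih]
    exact id_tensorHom_id _ _

theorem tensMap_comp {k : ℕ} {X Y Z : Fin k → V} (f : ∀ i, X i ⟶ Y i) (g : ∀ i, Y i ⟶ Z i) :
    tensMap (fun i => f i ≫ g i) = tensMap f ≫ tensMap g := by
  induction k with
  | zero => exact (Category.comp_id (𝟙 (𝟙_ V))).symm
  | succ k ih =>
    rw [tensMap, ih]
    exact (tensorHom_comp_tensorHom _ _ _ _).symm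

/-- The tensor product of a finite sequence of isomorphisms. -/
def tensIso : {k : ℕ} → {X Y : Fin k → V} → (∀ i, X i ≅ Y i) → (tens X ≅ tens Y)
  | 0, _, _, _ => Iso.refl (𝟙_ V)
  | _ + 1, _, _, f => f 0 ⊗ᵢ tensIso (fun i => f i.succ)

/-- The unit isomorphism `I ≅ I ⊗ ... ⊗ I`. -/
def onesIso : (k : ℕ) → (𝟙_ V ≅ tens (fun _ : Fin k => 𝟙_ V))
  | 0 => Iso.refl (𝟙_ V)
  | k + 1 => (λ_ (𝟙_ V)).symm ≪≫ (Iso.refl (𝟙_ V) ⊗ᵢ onesIso k)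

/-- The morphism `X ≅ X ⊗ (I ⊗ ... ⊗ I) ⟶ X ⊗ (Y ⊗ ... ⊗ Y)` induced by `e : I ⟶ Y`. -/
def insertUnits {Y : V} (e : 𝟙_ V ⟶ Y) (X : V) (k : ℕ) :
    X ⟶ X ⊗ tens (fun _ : Fin k => Y) :=
  (ρ_ X).inv ≫ X ◁ ((onesIso k).hom ≫ tensMap (fun _ => e))

/-- The morphism `X ≅ I ⊗ X ⟶ Y ⊗ X` induced by `e : I ⟶ Y`, where the last factor is regarded
as a tensor product of a sequence of length one. -/
def insertUnit {Y : V} (e : 𝟙_ V ⟶ Y) (X : V) : X ⟶ Y ⊗ tens (fun _ : Fin 1 => X) :=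
  (λ_ X).inv ≫ (e ⊗ₘ (ρ_ X).inv)

/-- Formal iterated tensor products of variables labelled by `J`. -/
inductive TExpr (J : Type) : Type
  | var : J → TExpr J
  | pair : TExpr J → TExpr J → TExpr J
  | big : {k : ℕ} → (Fin k → TExpr J) → TExpr J

/-- The object of `V` denoted by a formal tensor product. -/
def TExpr.eval {J : Type} (X : J → V) : TExpr J → V
  | .var j => X j
  | .pair a b => a.eval X ⊗ b.eval X
  | .big f => tens (fun i => (f i).eval X)

/-- Concatenation of a finite sequence of lists. -/
def flat {J : Type} : {k : ℕ} → (Fin k → List J) → List J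
  | 0, _ => []
  | _ + 1, f => f 0 ++ flat (fun i => f i.succ)

/-- The variables of a formal tensor product, from left to right. -/
def TExpr.leaves {J : Type} : TExpr J → List J
  | .var j => [j]
  | .pair a b => a.leaves ++ b.leaves
  | .big f => flat (fun i => (f i).leaves)

/-- The tensor product of the objects labelled by the entries of a list. -/
def listTens {J : Type} (X : J → V) : List J → V
  | [] => 𝟙_ V
  | j :: l => X j ⊗ listTens X l

/-- The associativity isomorphism for a concatenation of two lists. -/
def appendIso {J : Type} (X : J → V) (l' : List J) :
    (l : List J) → (listTens X l ⊗ listTens X l' ≅ listTens X (l ++ l'))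
  | [] => λ_ (listTens X l')
  | j :: l => α_ (X j) (listTens X l) (listTens X l') ≪≫
      whiskerLeftIso (X j) (appendIso X l' l)

/-- The associativity isomorphism for a concatenation of a sequence of lists. -/
def flatIso {J : Type} (X : J → V) :
    {k : ℕ} → (f : Fin k → List J) → (tens (fun i => listTens X (f i)) ≅ listTens X (flat f))
  | 0, _ => Iso.refl (𝟙_ V)
  | _ + 1, f => whiskerLeftIso (listTens X (f 0)) (flatIso X (fun i => f i.succ)) ≪≫
      appendIso X (flat (fun i => f i.succ)) (f 0)

/-- The isomorphism that removes all brackets from a formal tensor product. -/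
def TExpr.normIso {J : Type} (X : J → V) : (a : TExpr J) → (a.eval X ≅ listTens X a.leaves)
  | .var j => (ρ_ (X j)).symm
  | .pair a b => (a.normIso X ⊗ᵢ b.normIso X) ≪≫ appendIso X b.leaves a.leaves
  | .big f => tensIso (fun i => (f i).normIso X) ≪≫ flatIso X (fun i => (f i).leaves)

variable [SymmetricCategory V]

/-- The symmetry that moves the factor labelled `a` to the front. -/
def pullIso {J : Type} [DecidableEq J] (X : J → V) (a : J) :
    (l : List J) → a ∈ l → (listTens X l ≅ X a ⊗ listTens X (l.erase a))
  | [], h => absurd h List.not_mem_nil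
  | b :: l, h =>
    if hb : b = a then
      eqToIso (by subst hb; rw [List.erase_cons_head]; rfl)
    else
      whiskerLeftIso (X b) (pullIso X a l ((List.mem_cons.1 h).resolve_left (Ne.symm hb))) ≪≫
        (α_ _ _ _).symm ≪≫ whiskerRightIso (β_ (X b) (X a)) _ ≪≫ α_ _ _ _ ≪≫
        whiskerLeftIso (X a)
          (eqToIso (by rw [List.erase_cons_tail (by simpa using hb)]; rfl))

/-- The symmetry which permutes the factors labelled by `l` into the order given by `l'`
(determined by the labels when they are pairwise distinct). -/
def permIso {J : Type} [DecidableEq J] (X : J → V) :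
    (l l' : List J) → l.Perm l' → (listTens X l ≅ listTens X l')
  | l, [], h => eqToIso (by rw [h.eq_nil])
  | l, a :: l', h =>
    pullIso X a l (h.mem_iff.2 List.mem_cons_self) ≪≫
      whiskerLeftIso (X a) (permIso X (l.erase a) l' (by simpa using h.erase a))

/-- The coherence isomorphism of the symmetric monoidal category `V` between two iterated tensor
products of the same variables (used only with pairwise distinct labels): associativity and unit
constraints, and the symmetry that matches the labels. -/
def cohIso {J : Type} [DecidableEq J] (X : J → V) (a b : TExpr J) (h : a.leaves.Perm b.leaves) :
    a.eval X ≅ b.eval X :=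
  a.normIso X ≪≫ permIso X _ _ h ≪≫ (b.normIso X).symm

end Tensor

theorem mem_flat {J : Type} {k : ℕ} (f : Fin k → List J) (x : J) :
    x ∈ flat f ↔ ∃ i, x ∈ f i := by
  induction k with
  | zero => simp [flat]
  | succ k ih => simp [flat, ih, Fin.exists_fin_succ]

theorem nodup_flat {J : Type} {k : ℕ} (f : Fin k → List J) (h1 : ∀ i, (f i).Nodup)
    (h2 : ∀ i j x, x ∈ f i → x ∈ f j → i = j) : (flat f).Nodup := by
  induction k with
  | zero => simp [flat]
  | succ k ih =>
    simp only [flat, List.nodup_append]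
    refine ⟨h1 0, ih _ (fun i => h1 _) (fun i j x hi hj => Fin.succ_injective _ (h2 _ _ x hi hj)),
      ?_⟩
    rintro a ha b hb rfl
    obtain ⟨i, hi⟩ := (mem_flat _ _).1 hb
    exact absurd (h2 _ _ _ ha hi) (Fin.succ_ne_zero i).symm

/-! ## Fibres of maps of finite ordinals -/

/-- `FinFibers f m` says that the fibre of `f` over `i` has `m i` elements; `emb i` is the (unique)
order preserving bijection from the ordinal with `m i` elements onto the fibre. -/
structure FinFibers {n k : ℕ} (f : Fin n → Fin k) (m : Fin k → ℕ) where
  emb : ∀ i, Fin (m i) → Fin n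
  strictMono : ∀ i, StrictMono (emb i)
  mem_range : ∀ i t, (∃ a, emb i a = t) ↔ f t = i

namespace FinFibers

theorem map_emb {n k : ℕ} {f : Fin n → Fin k} {m : Fin k → ℕ} (F : FinFibers f m) (i : Fin k)
    (a : Fin (m i)) : f (F.emb i a) = i :=
  (F.mem_range i _).1 ⟨a, rfl⟩

/-- A commutative square `f ∘ p = r ∘ f'` induces maps from the fibres of `f'` to the
fibres of `f`. -/
def res {n' k' n k : ℕ} {f' : Fin n' → Fin k'} {m' : Fin k' → ℕ} (F' : FinFibers f' m')
    {f : Fin n → Fin k} {m : Fin k → ℕ} (F : FinFibers f m) (p : Fin n' → Fin n)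
    (r : Fin k' → Fin k) (h : ∀ t, f (p t) = r (f' t)) (j : Fin k') :
    Fin (m' j) → Fin (m (r j)) :=
  fun a => ((F.mem_range (r j) (p (F'.emb j a))).2 (by rw [h, F'.map_emb])).choose

theorem emb_res {n' k' n k : ℕ} {f' : Fin n' → Fin k'} {m' : Fin k' → ℕ} (F' : FinFibers f' m')
    {f : Fin n → Fin k} {m : Fin k → ℕ} (F : FinFibers f m) (p : Fin n' → Fin n)
    (r : Fin k' → Fin k) (h : ∀ t, f (p t) = r (f' t)) (j : Fin k') (a : Fin (m' j)) :
    F.emb (r j) (F'.res F p r h j a) = p (F'.emb j a) :=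
  ((F.mem_range (r j) (p (F'.emb j a))).2 (by rw [h, F'.map_emb])).choose_spec

theorem res_monotone {n' k' n k : ℕ} {f' : Fin n' → Fin k'} {m' : Fin k' → ℕ}
    (F' : FinFibers f' m') {f : Fin n → Fin k} {m : Fin k → ℕ} (F : FinFibers f m)
    (p : Fin n' → Fin n) (r : Fin k' → Fin k) (h : ∀ t, f (p t) = r (f' t)) (j : Fin k')
    (hp : Monotone p) : Monotone (F'.res F p r h j) := by
  intro a b hab
  rw [← (F.strictMono (r j)).le_iff_le, emb_res, emb_res]
  exact hp ((F'.strictMono j).monotone hab)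

theorem res_bijective {n' k' n k : ℕ} {f' : Fin n' → Fin k'} {m' : Fin k' → ℕ}
    (F' : FinFibers f' m') {f : Fin n → Fin k} {m : Fin k → ℕ} (F : FinFibers f m)
    (p : Fin n' → Fin n) (r : Fin k' → Fin k) (h : ∀ t, f (p t) = r (f' t)) (j : Fin k')
    (hp : Function.Bijective p) (hr : Function.Injective r) :
    Function.Bijective (F'.res F p r h j) := by
  constructor
  · intro a b hab
    have := congrArg (F.emb (r j)) hab
    rw [emb_res, emb_res] at this
    exact (F'.strictMono j).injective (hp.1 this)
  · intro b
    obtain ⟨t, ht⟩ := hp.2 (F.emb (r j) b)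
    have hj : f' t = j := hr (by rw [← h, ht, F.map_emb])
    obtain ⟨a, rfl⟩ := (F'.mem_range j t).2 hj
    exact ⟨a, (F.strictMono (r j)).injective (by rw [emb_res, ht])⟩

/-- For a composite `g ∘ f`, the fibres of the map `(g ∘ f)⁻¹(i) → g⁻¹(i)` induced by `f`
are fibres of `f`. -/
def resFibers {n l k : ℕ} {f : Fin n → Fin l} {g : Fin l → Fin k} {q : Fin l → ℕ}
    {m r : Fin k → ℕ} (F : FinFibers f q) (G : FinFibers g m)
    (H : FinFibers (fun t => g (f t)) r) (i : Fin k) :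
    FinFibers (H.res G f id (fun _ => rfl) i) (fun j => q (G.emb i j)) where
  emb j a := ((H.mem_range i (F.emb (G.emb i j) a)).2 (by rw [F.map_emb, G.map_emb])).choose
  strictMono j a b hab := by
    rw [← (H.strictMono i).lt_iff_lt]
    have h1 := fun a => ((H.mem_range i (F.emb (G.emb i j) a)).2
      (by rw [F.map_emb, G.map_emb])).choose_spec
    rw [h1, h1]
    exact F.strictMono _ hab
  mem_range j t := by
    have h1 := fun a => ((H.mem_range i (F.emb (G.emb i j) a)).2
      (by rw [F.map_emb, G.map_emb])).choose_spec
    have h2 := H.emb_res G f id (fun _ => rfl) i t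
    constructor
    · rintro ⟨a, rfl⟩
      apply (G.strictMono i).injective
      have h3 := H.emb_res G f id (fun _ => rfl) i
      simp only [id] at h3
      rw [h3, h1, F.map_emb]
    · intro h
      simp only [id] at h2
      rw [h] at h2
      obtain ⟨a, ha⟩ := (F.mem_range (G.emb i j) (H.emb i t)).2 h2.symm
      exact ⟨a, (H.strictMono i).injective (by rw [h1, ha])⟩

theorem emb_resFibers {n l k : ℕ} {f : Fin n → Fin l} {g : Fin l → Fin k} {q : Fin l → ℕ}
    {m r : Fin k → ℕ} (F : FinFibers f q) (G : FinFibers g m)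
    (H : FinFibers (fun t => g (f t)) r) (i : Fin k) (j : Fin (m i))
    (a : Fin (q (G.emb i j))) :
    H.emb i ((F.resFibers G H i).emb j a) = F.emb (G.emb i j) a :=
  ((H.mem_range i (F.emb (G.emb i j) a)).2 (by rw [F.map_emb, G.map_emb])).choose_spec

/-- The fibres of a bijection have exactly one element. -/
def ofBijective {n k : ℕ} {f : Fin n → Fin k} (hf : Function.Bijective f) :
    FinFibers f (fun _ => 1) where
  emb i _ := (Equiv.ofBijective f hf).symm i
  strictMono i a b h := absurd h (by simp [Subsingleton.elim a b])
  mem_range i t := by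
    constructor
    · rintro ⟨_, rfl⟩
      exact (Equiv.ofBijective f hf).apply_symm_apply i
    · rintro rfl
      exact ⟨0, (Equiv.ofBijective f hf).symm_apply_apply t⟩

/-- The map to the one-point ordinal has the whole source as its fibre. -/
def toPoint (n : ℕ) : FinFibers (fun _ : Fin n => (0 : Fin 1)) (fun _ => n) where
  emb _ a := a
  strictMono _ _ _ h := h
  mem_range i t := by simp [Subsingleton.elim i 0]

end FinFibers

section Coherence

variable {V : Type u} [Category.{v} V] [MonoidalCategory V] [SymmetricCategory V]

/-- The symmetry `X 0 ⊗ ... ⊗ X k ≅ X (r 0) ⊗ ... ⊗ X (r k)` of `V` given by a permutation. -/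
def permTens {k k' : ℕ} (X : Fin k → V) (r : Fin k' → Fin k) (hr : Function.Bijective r) :
    tens X ≅ tens (fun j => X (r j)) :=
  cohIso X (.big fun i => .var i) (.big fun j => .var (r j)) (by
    rw [List.perm_ext_iff_of_nodup]
    · intro a
      obtain ⟨j, rfl⟩ := hr.2 a
      simp only [TExpr.leaves, mem_flat, List.mem_singleton]
      exact ⟨fun _ => ⟨j, rfl⟩, fun _ => ⟨r j, rfl⟩⟩
    · exact nodup_flat _ (fun i => by simp [TExpr.leaves]) (by simp [TExpr.leaves])
    · refine nodup_flat _ (fun i => by simp [TExpr.leaves]) (fun i j x hi hj => hr.1 ?_)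
      simp only [TExpr.leaves, List.mem_singleton] at hi hj
      rw [← hi, hj])

/-- The isomorphism
`(X 0 ⊗ ... ⊗ X k) ⊗ (Y 0 ⊗ ... ⊗ Y l) ≅ (X 0 ⊗ Y 0•) ⊗ ... ⊗ (X k ⊗ Y k•)`,
where `Y i•` is the tensor product of the `Y s` over `s` in the fibre of `g` over `i`. -/
def shuffle {l k : ℕ} {g : Fin l → Fin k} {m : Fin k → ℕ} (G : FinFibers g m)
    (X : Fin k → V) (Y : Fin l → V) :
    tens X ⊗ tens Y ≅ tens (fun i => X i ⊗ tens (fun j => Y (G.emb i j))) :=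
  cohIso (Sum.elim X Y)
    (.pair (.big fun i => .var (.inl i)) (.big fun s => .var (.inr s)))
    (.big fun i => .pair (.var (.inl i)) (.big fun j => .var (.inr (G.emb i j)))) (by
      rw [List.perm_ext_iff_of_nodup]
      · rintro (i | s)
        · simp [TExpr.leaves, mem_flat]
        · simp only [TExpr.leaves, List.mem_append, mem_flat, List.mem_singleton]
          simp only [reduceCtorEq, exists_false, Sum.inr.injEq, exists_eq', or_true, false_or,
            true_iff]
          obtain ⟨a, ha⟩ := (G.mem_range (g s) s).2 rfl
          exact ⟨g s, a, ha.symm⟩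
      · simp only [TExpr.leaves, List.nodup_append]
        refine ⟨nodup_flat _ (by simp) (by simp), nodup_flat _ (by simp) (by simp), ?_⟩
        rintro a ha b hb rfl
        simp only [mem_flat, List.mem_singleton] at ha hb
        obtain ⟨i, rfl⟩ := ha
        simp at hb
      · refine nodup_flat _ (fun i => ?_) (fun i i' x h h' => ?_)
        · simp only [TExpr.leaves, List.nodup_append]
          refine ⟨by simp, nodup_flat _ (by simp) (fun j j' x h h' => ?_), ?_⟩
          · simp only [List.mem_singleton] at h h'
            rw [h] at h'
            exact (G.strictMono i).injective (Sum.inr_injective h')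
          · rintro a ha b hb rfl
            simp only [mem_flat, List.mem_singleton] at ha hb
            rw [ha] at hb
            simp at hb
        · simp only [TExpr.leaves, List.mem_append, mem_flat, List.mem_singleton] at h h'
          rcases x with x | x
          · simp only [Sum.inl.injEq, reduceCtorEq, exists_false, or_false] at h h'
            rw [← h, h']
          · simp only [Sum.inr.injEq, reduceCtorEq, false_or] at h h'
            obtain ⟨a, ha⟩ := h
            obtain ⟨b, hb⟩ := h'
            rw [← G.map_emb i a, ← ha, hb, G.map_emb])

end Coherence

/-! ## `n`-ordinals and quasibijections -/

/-- The linearly ordered set indexing the relations of an `n`-ordinal: `0 < ... < n - 1` for finite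
`n`, and `0 > -1 > -2 > ...` for `n = ∞` (the natural number `d` stands for `-d`). -/
def Level : ℕ∞ → Type
  | ⊤ => ℕᵒᵈ
  | (n : ℕ) => Fin n

instance : (n : ℕ∞) → LinearOrder (Level n)
  | ⊤ => inferInstanceAs (LinearOrder ℕᵒᵈ)
  | (n : ℕ) => inferInstanceAs (LinearOrder (Fin n))

/-- The objects of the skeletal category of finite ordinals with relations indexed by `P`: the
underlying set is `Fin card`, and its standard order is the total order of the
`n`-ordinal (`a < b` iff `a <_p b` for some `p`). -/
structure NOrd (P : Type) [LinearOrder P] where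
  card : ℕ
  lt : P → Fin card → Fin card → Prop
  irrefl : ∀ p a, ¬ lt p a a
  existsUnique : ∀ a b, a ≠ b → ∃! p, lt p a b ∨ lt p b a
  trans : ∀ p q a b c, lt p a b → lt q b c → lt (min p q) a c
  total : ∀ p a b, lt p a b → a < b

section Ordinals

variable {P : Type} [LinearOrder P]

namespace NOrd

/-- Maps of `n`-ordinals. -/
@[ext]
structure Hom (T S : NOrd P) where
  toFun : Fin T.card → Fin S.card
  isMap : ∀ p i j, T.lt p i j →
    (∃ r, p ≤ r ∧ S.lt r (toFun i) (toFun j)) ∨ toFun i = toFun j ∨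
      (∃ r, p < r ∧ S.lt r (toFun j) (toFun i))

instance : Category (NOrd P) where
  Hom := Hom
  id T := ⟨id, fun p _ _ h => Or.inl ⟨p, le_rfl, h⟩⟩
  comp {T S R} f g := ⟨g.toFun ∘ f.toFun, by
    intro p i j h
    rcases f.isMap p i j h with ⟨r, hr, h1⟩ | h1 | ⟨r, hr, h1⟩
    · rcases g.isMap r _ _ h1 with ⟨s, hs, h2⟩ | h2 | ⟨s, hs, h2⟩
      · exact Or.inl ⟨s, hr.trans hs, h2⟩
      · exact Or.inr (Or.inl h2)
      · exact Or.inr (Or.inr ⟨s, hr.trans_lt hs, h2⟩)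
    · exact Or.inr (Or.inl (congrArg g.toFun h1))
    · rcases g.isMap r _ _ h1 with ⟨s, hs, h2⟩ | h2 | ⟨s, hs, h2⟩
      · exact Or.inr (Or.inr ⟨s, hr.trans_le hs, h2⟩)
      · exact Or.inr (Or.inl h2.symm)
      · exact Or.inl ⟨s, (hr.trans hs).le, h2⟩⟩

/-- The terminal `n`-ordinal `U_n`. -/
def pt (P : Type) [LinearOrder P] : NOrd P where
  card := 1
  lt _ _ _ := False
  irrefl _ _ h := h
  existsUnique a b h := absurd (Subsingleton.elim a b) h
  trans _ _ _ _ _ h := h.elim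
  total _ _ _ h := h.elim

/-- The unique map to the terminal `n`-ordinal. -/
def toPt (T : NOrd P) : T ⟶ pt P := ⟨fun _ => (0 : Fin 1), fun _ _ _ _ => Or.inr (Or.inl rfl)⟩

/-- Order preserving maps: those which preserve the total orders. -/
def orderPreserving (P : Type) [LinearOrder P] : MorphismProperty (NOrd P) :=
  fun _ _ f => Monotone f.toFun

/-- Quasibijections: maps which are bijections of the underlying sets. -/
def quasibijection (P : Type) [LinearOrder P] : MorphismProperty (NOrd P) :=
  fun _ _ f => Function.Bijective f.toFun

instance : (quasibijection P).IsMultiplicative where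
  id_mem _ := Function.bijective_id
  comp_mem _ _ hf hg := hg.comp hf

end NOrd

open NOrd

/-- `Fibers f R` says that the `n`-ordinal `R i` is the fibre of `f` over `i`, with the `n`-ordinal
structure restricted from the source. In the skeletal category `R` is determined by `f`. -/
structure Fibers {T S : NOrd P} (f : T ⟶ S) (R : Fin S.card → NOrd P) extends
    FinFibers f.toFun (fun i => (R i).card) where
  lt_iff : ∀ i p a b, (R i).lt p a b ↔ T.lt p (emb i a) (emb i b)

namespace Fibers

/-- A commutative square `f ∘ p = r ∘ f'` (with `p` a map of `n`-ordinals and `r` a map of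
sets) induces maps of `n`-ordinals from the fibres of `f'` to the fibres of `f`. -/
def res {T' S' T S : NOrd P} {f' : T' ⟶ S'} {R' : Fin S'.card → NOrd P} (F' : Fibers f' R')
    {f : T ⟶ S} {R : Fin S.card → NOrd P} (F : Fibers f R) (p : T' ⟶ T)
    (r : Fin S'.card → Fin S.card) (h : ∀ t, f.toFun (p.toFun t) = r (f'.toFun t))
    (j : Fin S'.card) : R' j ⟶ R (r j) where
  toFun := F'.toFinFibers.res F.toFinFibers p.toFun r h j
  isMap q a b hab := by
    rw [F'.lt_iff] at hab
    have key := p.isMap q _ _ hab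
    simp only [F.lt_iff, FinFibers.emb_res]
    rcases key with h1 | h1 | h1
    · exact Or.inl h1
    · refine Or.inr (Or.inl ((F.strictMono (r j)).injective ?_))
      rw [FinFibers.emb_res, FinFibers.emb_res]
      exact h1
    · exact Or.inr (Or.inr h1)

theorem res_quasibijection {T' S' T S : NOrd P} {f' : T' ⟶ S'} {R' : Fin S'.card → NOrd P}
    (F' : Fibers f' R') {f : T ⟶ S} {R : Fin S.card → NOrd P} (F : Fibers f R) (p : T' ⟶ T)
    (r : Fin S'.card → Fin S.card) (h : ∀ t, f.toFun (p.toFun t) = r (f'.toFun t))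
    (j : Fin S'.card) (hp : quasibijection P p) (hr : Function.Injective r) :
    quasibijection P (F'.res F p r h j) :=
  F'.toFinFibers.res_bijective F.toFinFibers p.toFun r h j hp hr

theorem res_orderPreserving {T' S' T S : NOrd P} {f' : T' ⟶ S'} {R' : Fin S'.card → NOrd P}
    (F' : Fibers f' R') {f : T ⟶ S} {R : Fin S.card → NOrd P} (F : Fibers f R) (p : T' ⟶ T)
    (r : Fin S'.card → Fin S.card) (h : ∀ t, f.toFun (p.toFun t) = r (f'.toFun t))
    (j : Fin S'.card) (hp : orderPreserving P p) : orderPreserving P (F'.res F p r h j) :=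
  F'.toFinFibers.res_monotone F.toFinFibers p.toFun r h j hp

/-- The fibres of the induced maps between fibres of a composite. -/
def resFibers {T S R : NOrd P} {f : T ⟶ S} {g : S ⟶ R} {X : Fin S.card → NOrd P}
    {Y Z : Fin R.card → NOrd P} (F : Fibers f X) (G : Fibers g Y) (H : Fibers (f ≫ g) Z)
    (i : Fin R.card) :
    Fibers (H.res G f id (fun _ => rfl) i) (fun j => X (G.emb i j)) where
  toFinFibers := F.toFinFibers.resFibers G.toFinFibers H.toFinFibers i
  lt_iff j p a b := by
    have h1 := F.toFinFibers.emb_resFibers G.toFinFibers H.toFinFibers i j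
    rw [H.lt_iff, F.lt_iff]
    exact Iff.of_eq (congrArg₂ (T.lt p) (h1 a) (h1 b)).symm

/-- The fibres of a quasibijection are terminal. -/
def ofQuasibijection {T S : NOrd P} (f : T ⟶ S) (hf : quasibijection P f) :
    Fibers f (fun _ => pt P) where
  toFinFibers := FinFibers.ofBijective hf
  lt_iff i p a b := by
    rw [Subsingleton.elim (α := Fin 1) a b]
    exact ⟨fun h => h.elim, fun h => T.irrefl _ _ h⟩

/-- The map to the terminal `n`-ordinal has the whole source as its fibre. -/
def ofToPt (T : NOrd P) : Fibers (toPt T) (fun _ => T) where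
  toFinFibers := FinFibers.toPoint T.card
  lt_iff _ _ _ _ := Iff.rfl

end Fibers

/-- Every map has fibres. -/
theorem Fibers.exists_fibers {T S : NOrd P} (f : T ⟶ S) : ∃ R, Nonempty (Fibers f R) := by
  have hrange : ∀ i t, (∃ a, (Finset.univ.filter (fun t => f.toFun t = i)).orderEmbOfFin rfl a = t)
      ↔ f.toFun t = i := by
    intro i t
    have h := Set.ext_iff.1
      (Finset.range_orderEmbOfFin (Finset.univ.filter (fun t => f.toFun t = i)) rfl) t
    rw [Set.mem_range] at h
    rw [h]
    simp
  let F : FinFibers f.toFun (fun i => (Finset.univ.filter (fun t => f.toFun t = i)).card) :=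
    ⟨fun i => (Finset.univ.filter (fun t => f.toFun t = i)).orderEmbOfFin rfl,
      fun i => OrderEmbedding.strictMono _, hrange⟩
  exact ⟨fun i => ⟨_, fun p a b => T.lt p (F.emb i a) (F.emb i b), fun p a => T.irrefl _ _,
    fun a b hab => T.existsUnique _ _ ((F.strictMono i).injective.ne hab),
    fun p q a b c => T.trans _ _ _ _ _,
    fun p a b h => (F.strictMono i).lt_iff_lt.1 (T.total _ _ _ h)⟩, ⟨⟨F, fun _ _ _ _ => Iff.rfl⟩⟩⟩

/-- The fibres of a map are unique. -/
theorem Fibers.unique {T S : NOrd P} {f : T ⟶ S} {R R' : Fin S.card → NOrd P} (F : Fibers f R)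
    (F' : Fibers f R') : R = R' := by
  have key : ∀ (A B : NOrd P) (g : Fin A.card → Fin T.card) (g' : Fin B.card → Fin T.card),
      StrictMono g → StrictMono g' → Set.range g = Set.range g' →
      (∀ p a b, A.lt p a b ↔ T.lt p (g a) (g b)) →
      (∀ p a b, B.lt p a b ↔ T.lt p (g' a) (g' b)) → A = B := by
    rintro ⟨c, l, _, _, _, _⟩ ⟨c', l', _, _, _, _⟩ g g' hg hg' hr h h'
    have hc : c = c' := by
      have h1 := Nat.card_range_of_injective hg.injective
      have h2 := Nat.card_range_of_injective hg'.injective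
      rw [hr] at h1
      simpa using h1.symm.trans h2
    subst hc
    obtain rfl := (StrictMono.range_inj hg hg').1 hr
    congr
    funext p a b
    exact propext ((h p a b).trans (h' p a b).symm)
  funext i
  refine key _ _ _ _ (F.strictMono i) (F'.strictMono i) ?_ (F.lt_iff i) (F'.lt_iff i)
  ext t
  exact (F.mem_range i t).trans (F'.mem_range i t).symm

/-- The category `Q_n` of quasibijections of `n`-ordinals. -/
abbrev QCat (P : Type) [LinearOrder P] : Type := WideSubcategory (quasibijection P)

/-- The fundamental groupoid of the category of quasibijections. -/
abbrev PiQ (P : Type) [LinearOrder P] : Type := FreeGroupoid (QCat P)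

/-- An `n`-ordinal as an object of the fundamental groupoid. -/
abbrev PiQ.ofObj (T : NOrd P) : PiQ P := FreeGroupoid.mk (⟨T⟩ : QCat P)

/-- A quasibijection as a morphism of the fundamental groupoid. -/
abbrev PiQ.ofHom {T S : NOrd P} (f : T ⟶ S) (hf : quasibijection P f) :
    PiQ.ofObj T ⟶ PiQ.ofObj S :=
  FreeGroupoid.homMk (X := (⟨T⟩ : QCat P)) (Y := ⟨S⟩) ⟨f, hf⟩

end Ordinals

/-- The symmetric groups groupoid: objects are the finite ordinals (represented by their
cardinality), morphisms are all bijections. -/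
structure SymGrpd where
  card : ℕ

instance : Groupoid SymGrpd where
  Hom k l := Fin k.card ≃ Fin l.card
  id k := Equiv.refl (Fin k.card)
  comp f g := f.trans g
  inv f := f.symm
  id_comp _ := Equiv.refl_trans _
  comp_id _ := Equiv.trans_refl _
  assoc _ _ _ := Equiv.trans_assoc _ _ _
  inv_comp f := Equiv.symm_trans_self f
  comp_inv f := Equiv.self_trans_symm f

/-- The total order functor from quasibijections to bijections. -/
def totalOrder (P : Type) [LinearOrder P] : QCat P ⥤ SymGrpd where
  obj T := ⟨T.obj.card⟩
  map f := Equiv.ofBijective f.hom.toFun f.property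
  map_id _ := Equiv.ext fun _ => rfl
  map_comp _ _ := Equiv.ext fun _ => rfl

/-- The functor from the fundamental groupoid of `Q_n` to the symmetric groups groupoid which is
induced by the total order functor. -/
def totalOrderPi (P : Type) [LinearOrder P] : PiQ P ⥤ SymGrpd :=
  FreeGroupoid.lift (totalOrder P)

/-! ## Operads indexed by `n`-ordinals -/

section Operads

open NOrd

variable (P : Type) [LinearOrder P] (V : Type u) [Category.{v} V] [MonoidalCategory V]
  [SymmetricCategory V]

/-- A unit and multiplications for the maps of `n`-ordinals in the class `W`, on a family of objects
indexed by `n`-ordinals, which are associative and unital.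
In `assoc` the conditions `W (f ≫ g)` and `W (H.res ...)` hold automatically for the two
classes that are used (all maps, and order preserving maps). -/
structure MulData (W : MorphismProperty (NOrd P)) (A : NOrd P → V) where
  unit : 𝟙_ V ⟶ A (pt P)
  mul : ∀ {T S : NOrd P} (f : T ⟶ S), W f → ∀ {X : Fin S.card → NOrd P}, Fibers f X →
    (A S ⊗ tens (fun i => A (X i)) ⟶ A T)
  assoc : ∀ {T S R : NOrd P} (f : T ⟶ S) (g : S ⟶ R) (hf : W f) (hg : W g) (hfg : W (f ≫ g))
    {X : Fin S.card → NOrd P} {Y Z : Fin R.card → NOrd P} (F : Fibers f X) (G : Fibers g Y)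
    (H : Fibers (f ≫ g) Z) (hr : ∀ i, W (H.res G f id (fun _ => rfl) i)),
    (α_ (A R) (tens fun i => A (Y i)) (tens fun s => A (X s))).hom ≫
        A R ◁ ((shuffle G.toFinFibers (fun i => A (Y i)) (fun s => A (X s))).hom ≫
          tensMap (fun i => mul _ (hr i) (F.resFibers G H i))) ≫ mul (f ≫ g) hfg H =
      mul g hg G ▷ (tens fun s => A (X s)) ≫ mul f hf F
  mul_id : ∀ (T : NOrd P) (h : W (𝟙 T)),
    insertUnits unit (A T) T.card ≫
      mul (𝟙 T) h (Fibers.ofQuasibijection (𝟙 T) Function.bijective_id) = 𝟙 (A T)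
  mul_toPt : ∀ (T : NOrd P) (h : W (toPt T)),
    insertUnit unit (A T) ≫ mul (toPt T) h (Fibers.ofToPt T) = 𝟙 (A T)

/-- (Pruned) `n`-operads. -/
structure NOperad where
  obj : NOrd P → V
  str : MulData P V ⊤ obj

namespace NOperad

variable {P V}

/-- The multiplication of an `n`-operad. -/
def mul (A : NOperad P V) {T S : NOrd P} (f : T ⟶ S) {X : Fin S.card → NOrd P}
    (F : Fibers f X) : A.obj S ⊗ tens (fun i => A.obj (X i)) ⟶ A.obj T :=
  A.str.mul f trivial F

/-- Morphisms of `n`-operads. -/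
@[ext]
structure Hom (A B : NOperad P V) where
  app : ∀ T, A.obj T ⟶ B.obj T
  unit_app : A.str.unit ≫ app (pt P) = B.str.unit
  mul_app : ∀ {T S : NOrd P} (f : T ⟶ S) {X : Fin S.card → NOrd P} (F : Fibers f X),
    A.mul f F ≫ app T = (app S ⊗ₘ tensMap (fun i => app (X i))) ≫ B.mul f F

end NOperad

instance : Category (NOperad P V) where
  Hom := NOperad.Hom
  id A := ⟨fun T => 𝟙 (A.obj T), by simp, by intros; simp [tensMap_id]⟩
  comp {A B C} f g := ⟨fun T => f.app T ≫ g.app T, by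
      rw [← Category.assoc, f.unit_app, g.unit_app], by
      intro T S h X F
      rw [← Category.assoc, f.mul_app, Category.assoc, g.mul_app, tensMap_comp]
      simp⟩
  id_comp f := NOperad.Hom.ext (funext fun _ => Category.id_comp _)
  comp_id f := NOperad.Hom.ext (funext fun _ => Category.comp_id _)
  assoc f g h := NOperad.Hom.ext (funext fun _ => Category.assoc _ _ _)

variable {P V} in
/-- The morphism `A_S ⟶ A_S ⊗ (A_{U_n} ⊗ ... ⊗ A_{U_n}) ⟶ A_T` given by a quasibijection. -/
def NOperad.act (A : NOperad P V) {T S : NOrd P} (f : T ⟶ S) (hf : quasibijection P f) :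
    A.obj S ⟶ A.obj T :=
  insertUnits A.str.unit (A.obj S) S.card ≫ A.mul f (Fibers.ofQuasibijection f hf)

/-- An `n`-operad is quasisymmetric if quasibijections act by isomorphisms. -/
def isQuasisymmetric : ObjectProperty (NOperad P V) :=
  fun A => ∀ {T S : NOrd P} (f : T ⟶ S) (hf : quasibijection P f), IsIso (A.act f hf)

/-- The category of quasisymmetric `n`-operads. -/
abbrev QuasisymmetricOperad := (isQuasisymmetric P V).FullSubcategory

/-- `Q_n`-operads: contravariant functors on the fundamental groupoid of `Q_n` with associative and
unital multiplications for order preserving maps, and two equivariance conditions.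
In `equivariance₂` the two maps are compared on the tensor product of the
fibres of the common source; the action on fibres by quasibijections is inverted. -/
structure QOperad where
  coll : (PiQ P)ᵒᵖ ⥤ V
  str : MulData P V (orderPreserving P) (fun T => coll.obj (op (PiQ.ofObj T)))
  equivariance₁ : ∀ {T' S' T S : NOrd P} (f' : T' ⟶ S') (f : T ⟶ S)
    (hf' : orderPreserving P f') (hf : orderPreserving P f)
    (p : T' ⟶ T) (r : S' ⟶ S) (hp : quasibijection P p) (hr : quasibijection P r)
    (comm : p ≫ f = f' ≫ r) {X' : Fin S'.card → NOrd P} {X : Fin S.card → NOrd P}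
    (F' : Fibers f' X') (F : Fibers f X),
    str.mul f hf F ≫ coll.map (PiQ.ofHom p hp).op =
      (coll.map (PiQ.ofHom r hr).op ⊗ₘ
        ((permTens (fun i => coll.obj (op (PiQ.ofObj (X i)))) r.toFun hr).hom ≫
          tensMap (fun j => coll.map (PiQ.ofHom
            (F'.res F p r.toFun (fun t => congrFun (congrArg Hom.toFun comm) t) j)
            (F'.res_quasibijection F p r.toFun _ j hp hr.1)).op))) ≫
        str.mul f' hf' F'
  equivariance₂ : ∀ {T T' T'' S : NOrd P} (s' : T ⟶ T') (s : T ⟶ T'') (h' : T' ⟶ S)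
    (h : T'' ⟶ S) (hs' : quasibijection P s') (hs : quasibijection P s)
    (hh' : orderPreserving P h') (hh : orderPreserving P h) (comm : s ≫ h = s' ≫ h')
    {X X' X'' : Fin S.card → NOrd P} (F : Fibers (s ≫ h) X) (F' : Fibers h' X')
    (F'' : Fibers h X''),
    (coll.obj (op (PiQ.ofObj S)) ◁ tensMap (fun i => coll.map
        (Groupoid.inv (PiQ.ofHom
          (F.res F' s' id (fun t => (congrFun (congrArg Hom.toFun comm) t).symm) i)
          (F.res_quasibijection F' s' id _ i hs' Function.injective_id))).op)) ≫
      str.mul h' hh' F' ≫ coll.map (PiQ.ofHom s' hs').op =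
    (coll.obj (op (PiQ.ofObj S)) ◁ tensMap (fun i => coll.map
        (Groupoid.inv (PiQ.ofHom
          (F.res F'' s id (fun _ => rfl) i)
          (F.res_quasibijection F'' s id _ i hs Function.injective_id))).op)) ≫
      str.mul h hh F'' ≫ coll.map (PiQ.ofHom s hs).op

namespace QOperad

variable {P V}

/-- The value of a `Q_n`-operad on an `n`-ordinal. -/
abbrev obj (A : QOperad P V) (T : NOrd P) : V := A.coll.obj (op (PiQ.ofObj T))

/-- Morphisms of `Q_n`-operads. -/
@[ext]
structure Hom (A B : QOperad P V) where
  hom : A.coll ⟶ B.coll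
  unit_hom : A.str.unit ≫ hom.app (op (PiQ.ofObj (pt P))) = B.str.unit
  mul_hom : ∀ {T S : NOrd P} (f : T ⟶ S) (hf : orderPreserving P f) {X : Fin S.card → NOrd P}
    (F : Fibers f X),
    A.str.mul f hf F ≫ hom.app (op (PiQ.ofObj T)) =
      (hom.app (op (PiQ.ofObj S)) ⊗ₘ tensMap (fun i => hom.app (op (PiQ.ofObj (X i))))) ≫
        B.str.mul f hf F

end QOperad

instance : Category (QOperad P V) where
  Hom := QOperad.Hom
  id A := ⟨𝟙 A.coll, by simp, by intros; simp [tensMap_id]⟩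
  comp {A B C} f g := ⟨f.hom ≫ g.hom, by
      rw [NatTrans.comp_app, ← Category.assoc, f.unit_hom, g.unit_hom], by
      intro T S h hh X F
      simp only [NatTrans.comp_app]
      rw [← Category.assoc, f.mul_hom, Category.assoc, g.mul_hom, tensMap_comp]
      simp⟩
  id_comp f := QOperad.Hom.ext (Category.id_comp _)
  comp_id f := QOperad.Hom.ext (Category.comp_id _)
  assoc f g h := QOperad.Hom.ext (Category.assoc _ _ _)

/-- (Right) symmetric operads. In `equivariance₁`, `p` is the permutation of the fibres according to
`r` which is the identity on each fibre; in `equivariance₂`, `p` is the ordinal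
sum of the bijections `r i` of the fibres. -/
structure SymmetricOperad where
  coll : SymGrpdᵒᵖ ⥤ V
  unit : 𝟙_ V ⟶ coll.obj (op ⟨1⟩)
  mul : ∀ {n k : ℕ} (f : Fin n → Fin k), Monotone f → ∀ {m : Fin k → ℕ}, FinFibers f m →
    (coll.obj (op ⟨k⟩) ⊗ tens (fun i => coll.obj (op ⟨m i⟩)) ⟶ coll.obj (op ⟨n⟩))
  assoc : ∀ {n l k : ℕ} (f : Fin n → Fin l) (g : Fin l → Fin k) (hf : Monotone f)
    (hg : Monotone g) {q : Fin l → ℕ} {m r : Fin k → ℕ} (F : FinFibers f q) (G : FinFibers g m)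
    (H : FinFibers (fun t => g (f t)) r),
    (α_ (coll.obj (op ⟨k⟩)) (tens fun i => coll.obj (op ⟨m i⟩))
          (tens fun s => coll.obj (op ⟨q s⟩))).hom ≫
        coll.obj (op ⟨k⟩) ◁
          ((shuffle G (fun i => coll.obj (op ⟨m i⟩)) (fun s => coll.obj (op ⟨q s⟩))).hom ≫
          tensMap (fun i => mul _ (H.res_monotone G f id (fun _ => rfl) i hf)
            (F.resFibers G H i))) ≫
        mul (fun t => g (f t)) (hg.comp hf) H =
      mul g hg G ▷ (tens fun s => coll.obj (op ⟨q s⟩)) ≫ mul f hf F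
  mul_id : ∀ n : ℕ, insertUnits unit (coll.obj (op ⟨n⟩)) n ≫
    mul id monotone_id (FinFibers.ofBijective Function.bijective_id) = 𝟙 (coll.obj (op ⟨n⟩))
  mul_toPoint : ∀ n : ℕ, insertUnit unit (coll.obj (op ⟨n⟩)) ≫
    mul (fun _ => (0 : Fin 1)) monotone_const (FinFibers.toPoint n) = 𝟙 (coll.obj (op ⟨n⟩))
  equivariance₁ : ∀ {n k : ℕ} (f f' : Fin n → Fin k) (hf : Monotone f) (hf' : Monotone f')
    (r : Fin k ≃ Fin k) (p : Fin n ≃ Fin n) {m : Fin k → ℕ} (F : FinFibers f m)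
    (F' : FinFibers f' (fun j => m (r j))),
    (∀ j a, p (F'.emb j a) = F.emb (r j) a) →
    mul f hf F ≫ coll.map (Quiver.Hom.op (X := SymGrpd.mk n) (Y := ⟨n⟩) p) =
      (coll.map (Quiver.Hom.op (X := SymGrpd.mk k) (Y := ⟨k⟩) r) ⊗ₘ
        (permTens (fun i => coll.obj (op ⟨m i⟩)) r r.bijective).hom) ≫ mul f' hf' F'
  equivariance₂ : ∀ {n k : ℕ} (f : Fin n → Fin k) (hf : Monotone f) {m : Fin k → ℕ}
    (F : FinFibers f m) (r : ∀ i, Fin (m i) ≃ Fin (m i)) (p : Fin n ≃ Fin n),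
    (∀ i a, p (F.emb i a) = F.emb i (r i a)) →
    mul f hf F ≫ coll.map (Quiver.Hom.op (X := SymGrpd.mk n) (Y := ⟨n⟩) p) =
      (coll.obj (op ⟨k⟩) ◁ tensMap (fun i => coll.map
        (Quiver.Hom.op (X := SymGrpd.mk (m i)) (Y := ⟨m i⟩) (r i)))) ≫ mul f hf F

namespace SymmetricOperad

variable {V}

/-- Morphisms of symmetric operads. -/
@[ext]
structure Hom (A B : SymmetricOperad V) where
  hom : A.coll ⟶ B.coll
  unit_hom : A.unit ≫ hom.app (op ⟨1⟩) = B.unit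
  mul_hom : ∀ {n k : ℕ} (f : Fin n → Fin k) (hf : Monotone f) {m : Fin k → ℕ}
    (F : FinFibers f m),
    A.mul f hf F ≫ hom.app (op ⟨n⟩) =
      (hom.app (op ⟨k⟩) ⊗ₘ tensMap (fun i => hom.app (op ⟨m i⟩))) ≫ B.mul f hf F

end SymmetricOperad

instance : Category (SymmetricOperad V) where
  Hom := SymmetricOperad.Hom
  id A := ⟨𝟙 A.coll, by simp, by intros; simp [tensMap_id]⟩
  comp {A B C} f g := ⟨f.hom ≫ g.hom, by
      rw [NatTrans.comp_app, ← Category.assoc, f.unit_hom, g.unit_hom], by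
      intro n k h hh m F
      simp only [NatTrans.comp_app]
      rw [← Category.assoc, f.mul_hom, Category.assoc, g.mul_hom, tensMap_comp]
      simp⟩
  id_comp f := SymmetricOperad.Hom.ext (Category.id_comp _)
  comp_id f := SymmetricOperad.Hom.ext (Category.comp_id _)
  assoc f g h := SymmetricOperad.Hom.ext (Category.assoc _ _ _)

end Operads

end HigherOperad

end

attribute [reducible] HigherOperad.tens HigherOperad.listTens HigherOperad.TExpr.eval
  HigherOperad.flat HigherOperad.TExpr.leaves

noncomputable section

namespace HigherOperad

section

section ListCoherence

variable {V : Type u} [Category.{v} V] [MonoidalCategory V] [SymmetricCategory V]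

/-- The symmetry of the first two factors of a threefold tensor product. -/
def swapHom (A B C : V) : A ⊗ (B ⊗ C) ⟶ B ⊗ (A ⊗ C) :=
  (α_ A B C).inv ≫ (β_ A B).hom ▷ C ≫ (α_ B A C).hom

theorem swapHom_swapHom (A B C : V) : swapHom A B C ≫ swapHom B A C = 𝟙 _ := by
  simp [swapHom, ← comp_whiskerRight_assoc]

theorem swapHom_naturality {A A' B B' C C' : V} (f : A ⟶ A') (g : B ⟶ B') (h : C ⟶ C') :
    (f ⊗ₘ (g ⊗ₘ h)) ≫ swapHom A' B' C' = swapHom A B C ≫ (g ⊗ₘ (f ⊗ₘ h)) := by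
  simp only [swapHom, Category.assoc]
  rw [associator_inv_naturality_assoc, ← tensorHom_id, tensorHom_comp_tensorHom_assoc,
    BraidedCategory.braiding_naturality, ← tensorHom_id, ← associator_naturality,
    tensorHom_comp_tensorHom_assoc]
  simp

theorem swapHom_naturality_right {A B C C' : V} (h : C ⟶ C') :
    A ◁ B ◁ h ≫ swapHom A B C' = swapHom A B C ≫ B ◁ A ◁ h := by
  simpa using swapHom_naturality (𝟙 A) (𝟙 B) h

theorem swapHom_yangBaxter (A B C D : V) :
    swapHom A B (C ⊗ D) ≫ B ◁ swapHom A C D ≫ swapHom B C (A ⊗ D) =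
      A ◁ swapHom B C D ≫ swapHom A C (B ⊗ D) ≫ C ◁ swapHom A B D := by
  simp only [swapHom]
  calc _ = 𝟙 _ ⊗≫ ((β_ A B).hom ▷ C ⊗≫ B ◁ (β_ A C).hom ⊗≫ (β_ B C).hom ▷ A) ▷ D ⊗≫ 𝟙 _ := by
        monoidal
    _ = _ := by
        rw [BraidedCategory.yang_baxter']
        monoidal

/-- Moving a factor past two others, one at a time. -/
theorem swapHom_tensor_left (A A' B C : V) :
    A ◁ swapHom A' B C ≫ swapHom A B (A' ⊗ C) ≫ B ◁ (α_ A A' C).inv =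
      (α_ A A' (B ⊗ C)).inv ≫ swapHom (A ⊗ A') B C := by
  simp only [swapHom, BraidedCategory.braiding_tensor_left_hom]
  monoidal

variable {J : Type} (X : J → V)

/-- Equal lists have equal tensor products. -/
def listCast {l l' : List J} (h : l = l') : listTens X l ⟶ listTens X l' :=
  eqToHom (congrArg (listTens X) h)

@[simp]
theorem listCast_rfl (l : List J) : listCast X (rfl : l = l) = 𝟙 _ := rfl

variable [DecidableEq J]

/-- The symmetry `pullIso` with a prescribed target. -/
def pull (a : J) (l m : List J) (ha : a ∈ l) (h : l.erase a = m) :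
    listTens X l ⟶ X a ⊗ listTens X m :=
  (pullIso X a l ha).hom ≫ X a ◁ listCast X h

theorem pull_head (a : J) (l : List J) (ha h) : pull X a (a :: l) l ha h = 𝟙 _ := by
  have key : ∀ (m : List J) (e : listTens X (a :: l) = X a ⊗ listTens X m) (h : m = l),
      eqToHom e ≫ X a ◁ listCast X h = 𝟙 _ := by
    rintro m e rfl
    exact (Category.id_comp _).trans (MonoidalCategory.whiskerLeft_id _ _)
  unfold pull pullIso
  rw [dif_pos rfl]
  exact key _ (by simp) _

theorem pull_tail (a b : J) (hb : b ≠ a) (l m : List J) (ha : a ∈ l) (h : l.erase a = m) (ha' h') :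
    pull X a (b :: l) (b :: m) ha' h' =
      X b ◁ pull X a l m ha h ≫ swapHom (X b) (X a) (listTens X m) := by
  subst h
  have key : ∀ (m : List J) (e : X b ⊗ listTens X (l.erase a) = listTens X m)
      (h : m = b :: l.erase a), X a ◁ eqToHom e ≫ X a ◁ listCast X h = 𝟙 _ := by
    rintro m e rfl
    rw [← MonoidalCategory.whiskerLeft_comp]
    exact (congrArg (X a ◁ ·) (Category.id_comp _)).trans (MonoidalCategory.whiskerLeft_id _ _)
  have e : pull X a l (l.erase a) ha rfl = (pullIso X a l ha).hom := by simp [pull]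
  rw [e]
  unfold pull
  rw [pullIso, dif_neg hb]
  simp only [Iso.trans_hom, whiskerLeftIso_hom, Iso.symm_hom, whiskerRightIso_hom,
    Category.assoc, eqToIso.hom, swapHom]
  rw [key]
  simp

theorem permIso_cons (l l' m : List J) (a : J) (h : l.Perm (a :: l')) (hm : l.erase a = m) :
    (permIso X l (a :: l') h).hom =
      pull X a l m (h.mem_iff.2 List.mem_cons_self) hm ≫
        X a ◁ (permIso X m l' (hm ▸ by simpa using h.erase a)).hom := by
  subst hm
  simp [permIso, pull]

theorem permIso_of_eq {l l' : List J} (h : l = l') (hp) :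
    (permIso X l l' hp).hom = listCast X h := by
  subst h
  induction l with
  | nil => rfl
  | cons a l ih =>
    rw [permIso_cons X _ _ l a _ (by simp), pull_head, ih]
    exact (Category.id_comp _).trans (MonoidalCategory.whiskerLeft_id _ _)

theorem permIso_self (l : List J) (hp) : (permIso X l l hp).hom = 𝟙 _ :=
  permIso_of_eq X rfl hp

theorem permIso_cons_cons (a : J) (l l' : List J) (h : (a :: l).Perm (a :: l')) (h') :
    (permIso X (a :: l) (a :: l') h).hom = X a ◁ (permIso X l l' h').hom := by
  rw [permIso_cons X _ _ l a _ (by simp), pull_head]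
  exact Category.id_comp _

theorem pull_pull (a b : J) (hab : a ≠ b) (l m₁ m₂ n : List J) (hb : b ∈ l) (h₁ : l.erase b = m₁)
    (ha₁ : a ∈ m₁) (h₁' : m₁.erase a = n) (ha : a ∈ l) (h₂ : l.erase a = m₂) (hb₂ : b ∈ m₂)
    (h₂' : m₂.erase b = n) :
    pull X b l m₁ hb h₁ ≫ X b ◁ pull X a m₁ n ha₁ h₁' ≫ swapHom (X b) (X a) (listTens X n) =
      pull X a l m₂ ha h₂ ≫ X a ◁ pull X b m₂ n hb₂ h₂' := by
  induction l generalizing m₁ m₂ n with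
  | nil => simp at ha
  | cons c l ih =>
    by_cases hcb : c = b
    · subst hcb
      have ha' : a ∈ l := by simpa [hab] using ha
      obtain rfl : l = m₁ := by simpa using h₁
      obtain rfl : c :: l.erase a = m₂ := by rw [← h₂, List.erase_cons_tail]; simpa using hab.symm
      obtain rfl : l.erase a = n := h₁'
      rw [pull_head, pull_head, pull_tail X a c hab.symm l _ ha' rfl]
      simp
    · by_cases hca : c = a
      · subst hca
        have hb' : b ∈ l := by simpa [hab.symm] using hb
        obtain rfl : l = m₂ := by simpa using h₂
        obtain rfl : c :: l.erase b = m₁ := by rw [← h₁, List.erase_cons_tail]; simpa using hab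
        obtain rfl : l.erase b = n := h₂'
        rw [pull_head, pull_head, pull_tail X b c hab l _ hb' rfl]
        have e : X b ◁ 𝟙 (listTens X (c :: l.erase b)) = 𝟙 _ := MonoidalCategory.whiskerLeft_id _ _
        rw [e, Category.id_comp, Category.id_comp, Category.assoc, swapHom_swapHom,
          Category.comp_id]
      · have ha' : a ∈ l := by simpa [Ne.symm hca] using ha
        have hb' : b ∈ l := by simpa [Ne.symm hcb] using hb
        obtain rfl : c :: l.erase b = m₁ := by rw [← h₁, List.erase_cons_tail]; simpa using hcb
        obtain rfl : c :: l.erase a = m₂ := by rw [← h₂, List.erase_cons_tail]; simpa using hca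
        obtain rfl : c :: (l.erase b).erase a = n := by
          rw [← h₁', List.erase_cons_tail]; simpa using hca
        have ha₁' : a ∈ l.erase b := by simpa [Ne.symm hca] using ha₁
        have hb₂' : b ∈ l.erase a := by simpa [Ne.symm hcb] using hb₂
        rw [pull_tail X b c hcb l _ hb' rfl, pull_tail X a c hca (l.erase b) _ ha₁' rfl,
          pull_tail X a c hca l _ ha' rfl,
          pull_tail X b c hcb (l.erase a) _ hb₂' (List.erase_comm a b)]
        have := ih (l.erase b) (l.erase a) _ hb' rfl ha₁' rfl ha' rfl hb₂' (List.erase_comm a b)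
        simp only [MonoidalCategory.whiskerLeft_comp, Category.assoc]
        have yb := swapHom_yangBaxter (X c) (X b) (X a) (listTens X ((l.erase b).erase a))
        rw [← reassoc_of% swapHom_naturality_right, ← reassoc_of% swapHom_naturality_right]
        erw [yb]
        simp only [← MonoidalCategory.whiskerLeft_comp_assoc, this]

theorem permIso_pull (a : J) (l l' m m' : List J) (h : l.Perm l') (ha : a ∈ l)
    (ha' : a ∈ l') (hm : l.erase a = m) (hm' : l'.erase a = m') :
    (permIso X l l' h).hom ≫ pull X a l' m' ha' hm' =
      pull X a l m ha hm ≫ X a ◁ (permIso X m m' (hm ▸ hm' ▸ h.erase a)).hom := by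
  induction l' generalizing l m m' with
  | nil => simp at ha'
  | cons b l' ih =>
    have hb : b ∈ l := h.mem_iff.2 List.mem_cons_self
    by_cases hba : b = a
    · subst hba
      obtain rfl : l' = m' := by simpa using hm'
      rw [pull_head, permIso_cons X l l' m b h hm]
      exact Category.comp_id _
    · have ha'' : a ∈ l' := by simpa [Ne.symm hba] using ha'
      obtain rfl : b :: l'.erase a = m' := by rw [← hm', List.erase_cons_tail]; simpa using hba
      subst hm
      have han : a ∈ l.erase b := (List.mem_erase_of_ne (Ne.symm hba)).2 ha
      have hbm : b ∈ l.erase a := (List.mem_erase_of_ne hba).2 hb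
      rw [permIso_cons X l l' _ b h rfl, pull_tail X a b hba l' _ ha'' rfl,
        permIso_cons X (l.erase a) (l'.erase a) ((l.erase b).erase a) b _ (List.erase_comm a b)]
      have e := ih (l.erase b) _ _ (by simpa using h.erase b) han ha'' rfl rfl
      have e2 := pull_pull X a b (Ne.symm hba) l (l.erase b) (l.erase a) _ hb rfl han rfl ha rfl hbm
        (List.erase_comm a b)
      simp only [Category.assoc, ← MonoidalCategory.whiskerLeft_comp_assoc, e]
      simp only [MonoidalCategory.whiskerLeft_comp, Category.assoc, swapHom_naturality_right]
      rw [reassoc_of% e2]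

theorem permIso_trans (l l' l'' : List J) (h : l.Perm l') (h' : l'.Perm l'') (h'') :
    (permIso X l l' h).hom ≫ (permIso X l' l'' h').hom = (permIso X l l'' h'').hom := by
  induction l'' generalizing l l' with
  | nil =>
    obtain rfl := h'.eq_nil
    rw [permIso_self]
    exact Category.comp_id _
  | cons a l'' ih =>
    rw [permIso_cons X l' l'' _ a h' rfl, permIso_cons X l l'' _ a h'' rfl,
      ← Category.assoc, permIso_pull X a l l' _ _ h _ _ rfl rfl, Category.assoc,
      ← MonoidalCategory.whiskerLeft_comp, ih]

theorem appendIso_pull (a : J) (l m l' : List J) (ha : a ∈ l) (h : l.erase a = m) (ha' h') :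
    (appendIso X l' l).hom ≫ pull X a (l ++ l') (m ++ l') ha' h' =
      pull X a l m ha h ▷ listTens X l' ≫ (α_ _ _ _).hom ≫ X a ◁ (appendIso X l' m).hom := by
  induction l generalizing m with
  | nil => simp at ha
  | cons b l ih =>
    by_cases hba : b = a
    · subst hba
      obtain rfl : l = m := by simpa using h
      have e : pull X b (b :: l ++ l') (l ++ l') ha' h' = 𝟙 _ := pull_head X b (l ++ l') ha' h'
      rw [e, pull_head, id_whiskerRight, Category.id_comp]
      exact Category.comp_id _
    · have hal : a ∈ l := by simpa [Ne.symm hba] using ha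
      obtain rfl : b :: l.erase a = m := by rw [← h, List.erase_cons_tail]; simpa using hba
      have h2 : (l ++ l').erase a = l.erase a ++ l' := List.erase_append_left _ hal
      have e : pull X a (b :: l ++ l') (b :: l.erase a ++ l') ha' h' =
          X b ◁ pull X a (l ++ l') (l.erase a ++ l') (by simp [hal]) h2 ≫ swapHom _ _ _ :=
        pull_tail X a b hba _ _ _ h2 ha' h'
      rw [e, pull_tail X a b hba _ _ hal rfl]
      simp only [appendIso, Iso.trans_hom, whiskerLeftIso_hom, Category.assoc]
      rw [← MonoidalCategory.whiskerLeft_comp_assoc, ih _ hal rfl]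
      simp only [MonoidalCategory.whiskerLeft_comp, Category.assoc, swapHom_naturality_right]
      simp only [swapHom]
      monoidal

/-- Permutation isomorphisms are compatible with concatenation. -/
theorem permIso_append (l₁ l₂ m₁ m₂ : List J) (h : l₁.Perm l₂) (h' : m₁.Perm m₂) (h'') :
    (appendIso X m₁ l₁).hom ≫ (permIso X (l₁ ++ m₁) (l₂ ++ m₂) h'').hom =
      ((permIso X l₁ l₂ h).hom ⊗ₘ (permIso X m₁ m₂ h').hom) ≫ (appendIso X m₂ l₂).hom := by
  induction l₂ generalizing l₁ with
  | nil =>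
    obtain rfl := h.eq_nil
    rw [permIso_self]
    simp only [appendIso]
    rw [id_tensorHom]
    exact (leftUnitor_naturality _).symm
  | cons a l₂ ih =>
    have ha : a ∈ l₁ := h.mem_iff.2 List.mem_cons_self
    have e : (permIso X (l₁ ++ m₁) (a :: l₂ ++ m₂) h'').hom = _ :=
      permIso_cons X (l₁ ++ m₁) (l₂ ++ m₂) (l₁.erase a ++ m₁) a h'' (List.erase_append_left _ ha)
    rw [e, permIso_cons X l₁ l₂ _ a h rfl, ← Category.assoc, appendIso_pull X a _ _ _ ha rfl]
    have := ih (l₁.erase a) (by simpa using h.erase a)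
      (by simpa [List.erase_append_left _ ha] using h''.erase a)
    simp only [Category.assoc, ← MonoidalCategory.whiskerLeft_comp, this]
    simp only [appendIso, Iso.trans_hom, whiskerLeftIso_hom]
    simp only [MonoidalCategory.whiskerLeft_comp, MonoidalCategory.tensorHom_def]
    monoidal

theorem appendIso_nil (l : List J) (h) :
    (appendIso X [] l).hom ≫ (permIso X (l ++ []) l h).hom = (ρ_ (listTens X l)).hom := by
  induction l with
  | nil =>
    rw [permIso_of_eq X (l := [] ++ []) (l' := []) rfl]
    exact (Category.comp_id _).trans unitors_equal
  | cons a l ih =>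
    have h' : (a :: (l ++ [])).Perm (a :: l) := by simp
    have e := permIso_cons_cons X a (l ++ []) l h' (by simp)
    refine (Category.assoc _ _ _).trans ((congrArg
      (fun t => (α_ (X a) (listTens X l) (𝟙_ V)).hom ≫ X a ◁ (appendIso X [] l).hom ≫ t) e).trans
        ?_)
    rw [← MonoidalCategory.whiskerLeft_comp, ih]
    exact (rightUnitor_tensor_hom (X a) (listTens X l)).symm

/-- Concatenation of lists is coherently associative. -/
theorem appendIso_assoc (l m n : List J) (h) :
    listTens X l ◁ (appendIso X n m).hom ≫ (appendIso X (m ++ n) l).hom =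
      (α_ _ _ _).inv ≫ (appendIso X m l).hom ▷ listTens X n ≫ (appendIso X n (l ++ m)).hom ≫
        (permIso X ((l ++ m) ++ n) (l ++ (m ++ n)) h).hom := by
  induction l with
  | nil =>
    rw [permIso_of_eq X (l := [] ++ m ++ n) (l' := [] ++ (m ++ n)) rfl]
    simp only [appendIso]
    exact (by
      rw [leftUnitor_naturality]
      simp : (𝟙_ V) ◁ (appendIso X n m).hom ≫ (λ_ (listTens X (m ++ n))).hom =
        (α_ _ _ _).inv ≫ (λ_ (listTens X m)).hom ▷ listTens X n ≫ (appendIso X n m).hom ≫ 𝟙 _)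
  | cons a l ih =>
    have e : (permIso X ((a :: l ++ m) ++ n) (a :: l ++ (m ++ n)) h).hom = _ :=
      permIso_cons_cons X a ((l ++ m) ++ n) (l ++ (m ++ n)) h (by simp)
    have e' : ∀ l' : List J, (appendIso X l' (a :: l)).hom =
      (α_ (X a) (listTens X l) (listTens X l')).hom ≫ X a ◁ (appendIso X l' l).hom := fun _ => rfl
    have e'' : (appendIso X n (a :: l ++ m)).hom =
      (α_ (X a) (listTens X (l ++ m)) (listTens X n)).hom ≫ X a ◁ (appendIso X n (l ++ m)).hom :=
      rfl
    rw [e, e', e', e'']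
    have ih' := congrArg (fun t => (α_ (X a) (listTens X l) _).hom ≫ X a ◁ t) (ih (by simp))
    simp only [MonoidalCategory.whiskerLeft_comp] at ih'
    have e3 : (X a ⊗ listTens X l) ◁ (appendIso X n m).hom ≫
        (α_ (X a) (listTens X l) (listTens X (m ++ n))).hom =
      (α_ (X a) (listTens X l) _).hom ≫ X a ◁ listTens X l ◁ (appendIso X n m).hom := by
      simp
    refine (Category.assoc _ _ _).symm.trans ?_
    refine (congrArg (· ≫ X a ◁ (appendIso X (m ++ n) l).hom) e3).trans ?_
    refine (Category.assoc _ _ _).trans (ih'.trans ?_)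
    simp only [listTens]
    monoidal

theorem appendIso_pull_notMem (a : J) (l m : List J) (ha : a ∉ l) (ha' h') :
    (appendIso X (a :: m) l).hom ≫ pull X a (l ++ a :: m) (l ++ m) ha' h' =
      swapHom (listTens X l) (X a) (listTens X m) ≫ X a ◁ (appendIso X m l).hom := by
  induction l with
  | nil =>
    have e : pull X a ([] ++ a :: m) ([] ++ m) ha' h' = 𝟙 _ := pull_head X a m ha' h'
    rw [e]
    simp only [appendIso, listTens, swapHom, braiding_tensorUnit_left]
    refine (Category.comp_id _).trans ?_
    monoidal
  | cons b l ih =>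
    have hba : b ≠ a := by rintro rfl; simp at ha
    have hal : a ∉ l := fun h => ha (by simp [h])
    have h2 : (l ++ a :: m).erase a = l ++ m := by
      rw [List.erase_append_right _ hal, List.erase_cons_head]
    have e : pull X a (b :: l ++ a :: m) (b :: l ++ m) ha' h' = _ :=
      pull_tail X a b hba (l ++ a :: m) (l ++ m) (by simp) h2 ha' h'
    rw [e]
    simp only [appendIso, Iso.trans_hom, whiskerLeftIso_hom, Category.assoc]
    rw [← MonoidalCategory.whiskerLeft_comp_assoc, ih hal]
    have e2 := swapHom_tensor_left (X b) (listTens X l) (X a) (listTens X m)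
    simp only [listTens] at e2 ⊢
    rw [MonoidalCategory.whiskerLeft_comp, Category.assoc, swapHom_naturality_right,
      ← cancel_epi (α_ _ _ _).inv, ← reassoc_of% e2]
    simp

/-- The symmetry of two concatenated lists without common entries. -/
theorem appendIso_braiding (l m : List J) (hd : ∀ a ∈ l, a ∉ m) (h) :
    (appendIso X m l).hom ≫ (permIso X (l ++ m) (m ++ l) h).hom =
      (β_ _ _).hom ≫ (appendIso X l m).hom := by
  induction m with
  | nil =>
    have e : (permIso X (l ++ []) ([] ++ l) h).hom = (permIso X (l ++ []) l h).hom := rfl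
    rw [e, appendIso_nil]
    simp only [appendIso, listTens, braiding_tensorUnit_right]
    simp
  | cons a m ih =>
    have hal : a ∉ l := fun h => hd a h (by simp)
    have h2 : (l ++ a :: m).erase a = l ++ m := by
      rw [List.erase_append_right _ hal, List.erase_cons_head]
    have e : (permIso X (l ++ a :: m) (a :: m ++ l) h).hom = _ :=
      permIso_cons X (l ++ a :: m) (m ++ l) (l ++ m) a h h2
    rw [e, ← Category.assoc, appendIso_pull_notMem X a l m hal, Category.assoc,
      ← MonoidalCategory.whiskerLeft_comp, ih (fun b hb hb' => hd b hb (by simp [hb']))]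
    simp only [appendIso, listTens, Iso.trans_hom, whiskerLeftIso_hom, swapHom,
      BraidedCategory.braiding_tensor_right_hom]
    monoidal

theorem swapHom_appendIso (l m n : List J) (hd : ∀ a ∈ l, a ∉ m) (h) :
    swapHom (listTens X l) (listTens X m) (listTens X n) ≫
        listTens X m ◁ (appendIso X n l).hom ≫ (appendIso X (l ++ n) m).hom =
      listTens X l ◁ (appendIso X n m).hom ≫ (appendIso X (m ++ n) l).hom ≫
        (permIso X (l ++ (m ++ n)) (m ++ (l ++ n)) h).hom := by
  have hp : (l ++ m).Perm (m ++ l) := List.perm_append_comm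
  rw [appendIso_assoc X m l n (by simp), reassoc_of% (appendIso_assoc X l m n (by simp)),
    permIso_trans X _ _ _ _ _
    ((hp.append_right n).trans (by simp)),
    ← permIso_trans X _ _ _ (hp.append_right n) (by simp),
    reassoc_of% (permIso_append X _ _ _ _ hp (.refl n)),
    permIso_self, tensorHom_id, ← comp_whiskerRight_assoc (appendIso X m l).hom,
    appendIso_braiding X l m hd hp]
  simp [swapHom]

end ListCoherence

end

section

section Substitution

variable {V : Type u} [Category.{v} V] [MonoidalCategory V]
  {J K : Type}

/-- Substitution of lists for the entries of a list, on tensor products. -/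
def listSub {X : J → V} {Y : K → V} {e : J → List K} (θ : ∀ j, X j ⟶ listTens Y (e j)) :
    (l : List J) → (listTens X l ⟶ listTens Y (l.flatMap e))
  | [] => 𝟙 (𝟙_ V)
  | j :: l => (θ j ⊗ₘ listSub θ l) ≫ (appendIso Y (l.flatMap e) (e j)).hom

/-- Substitution of formal tensor products for the variables of a formal tensor product. -/
def TExpr.subst (e : J → TExpr K) : TExpr J → TExpr K
  | .var j => e j
  | .pair a b => .pair (a.subst e) (b.subst e)
  | .big f => .big fun i => (f i).subst e

attribute [reducible] TExpr.subst

/-- The morphism between formal tensor products induced by morphisms of their variables. -/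
def TExpr.subMap {X : J → V} {Y : K → V} {e : J → TExpr K} (θ : ∀ j, X j ⟶ (e j).eval Y) :
    (a : TExpr J) → (a.eval X ⟶ (a.subst e).eval Y)
  | .var j => θ j
  | .pair a b => a.subMap θ ⊗ₘ b.subMap θ
  | .big f => tensMap fun i => (f i).subMap θ

attribute [reducible] TExpr.subMap

theorem flat_flatMap (e : J → List K) {k : ℕ} (f : Fin k → List J) :
    (flat f).flatMap e = flat fun i => (f i).flatMap e := by
  induction k with
  | zero => rfl
  | succ k ih => simp only [flat, List.flatMap_append, ih]

theorem TExpr.leaves_subst (e : J → TExpr K) (a : TExpr J) :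
    (a.subst e).leaves = a.leaves.flatMap fun j => (e j).leaves := by
  induction a with
  | var j => simp
  | pair a b iha ihb =>
    change (a.subst e).leaves ++ (b.subst e).leaves = _
    rw [iha, ihb]
    exact List.flatMap_append.symm
  | big f ih =>
    simp only [TExpr.leaves, flat_flatMap]
    exact congrArg flat (funext ih)

theorem flat_perm {k : ℕ} {f g : Fin k → List J} (h : ∀ i, (f i).Perm (g i)) :
    (flat f).Perm (flat g) := by
  induction k with
  | zero => exact .refl _
  | succ k ih => exact (h 0).append (ih fun i => h i.succ)

theorem TExpr.leaves_subst_perm (e : J → TExpr K) {a b : TExpr J} (h : a.leaves.Perm b.leaves) :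
    (a.subst e).leaves.Perm (b.subst e).leaves := by
  rw [leaves_subst, leaves_subst]
  exact h.flatMap_right _

theorem flat_nil {k : ℕ} : flat (fun _ : Fin k => ([] : List J)) = [] := by
  induction k with
  | zero => rfl
  | succ k ih => exact ih

variable [SymmetricCategory V] [DecidableEq J] [DecidableEq K] {X : J → V} {Y : K → V}

theorem pull_listSub {e : J → List K} (he : ∀ i j, i ≠ j → ∀ x ∈ e i, x ∉ e j)
    (θ : ∀ j, X j ⟶ listTens Y (e j)) (a : J) (l m : List J) (ha : a ∈ l) (h : l.erase a = m)
    (hp) :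
    listSub θ l ≫ (permIso Y (l.flatMap e) (e a ++ m.flatMap e) hp).hom =
      pull X a l m ha h ≫ (θ a ⊗ₘ listSub θ m) ≫ (appendIso Y (m.flatMap e) (e a)).hom := by
  induction l generalizing m with
  | nil => simp at ha
  | cons b l ih =>
    by_cases hba : b = a
    · subst hba
      obtain rfl : l = m := by simpa using h
      rw [permIso_of_eq Y (l := (b :: l).flatMap e) (l' := e b ++ l.flatMap e)
        List.flatMap_cons, pull_head, Category.id_comp]
      exact Category.comp_id _
    · have hal : a ∈ l := by simpa [Ne.symm hba] using ha
      obtain rfl : b :: l.erase a = m := by rw [← h, List.erase_cons_tail]; simpa using hba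
      have hp1 : (l.flatMap e).Perm (e a ++ (l.erase a).flatMap e) :=
        (List.perm_cons_erase hal).flatMap_right e
      have hp2 : (e b ++ (e a ++ (l.erase a).flatMap e)).Perm
          (e a ++ (e b ++ (l.erase a).flatMap e)) := by
        rw [← List.append_assoc, ← List.append_assoc]
        exact List.perm_append_comm.append_right _
      rw [pull_tail X a b hba l _ hal rfl]
      have hsw := swapHom_appendIso Y (e b) (e a) ((l.erase a).flatMap e) (he b a hba) hp2
      have e1 : (permIso Y ((b :: l).flatMap e) (e a ++ (b :: l.erase a).flatMap e) hp).hom =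
          (permIso Y (e b ++ l.flatMap e) (e b ++ (e a ++ (l.erase a).flatMap e))
            (hp1.append_left _)).hom ≫
          (permIso Y (e b ++ (e a ++ (l.erase a).flatMap e))
            (e a ++ (e b ++ (l.erase a).flatMap e)) hp2).hom :=
        (permIso_trans Y _ _ _ _ _ _).symm
      rw [e1]
      have ih' := ih _ hal rfl hp1
      have e2 : listSub θ (b :: l) =
        (θ b ⊗ₘ listSub θ l) ≫ (appendIso Y (l.flatMap e) (e b)).hom := rfl
      have e3 : listSub θ (b :: l.erase a) = (θ b ⊗ₘ listSub θ (l.erase a)) ≫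
        (appendIso Y ((l.erase a).flatMap e) (e b)).hom := rfl
      have e4 : (appendIso Y ((b :: l.erase a).flatMap e) (e a)).hom =
        (appendIso Y (e b ++ (l.erase a).flatMap e) (e a)).hom := rfl
      rw [e2, e3, e4, Category.assoc, reassoc_of% (permIso_append Y _ _ _ _ (.refl _) hp1),
        permIso_self,
        tensorHom_comp_tensorHom_assoc, ih', Category.comp_id]
      have e5 : (θ a ⊗ₘ (θ b ⊗ₘ listSub θ (l.erase a)) ≫
          (appendIso Y ((l.erase a).flatMap e) (e b)).hom) =
          (θ a ⊗ₘ (θ b ⊗ₘ listSub θ (l.erase a))) ≫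
            listTens Y (e a) ◁ (appendIso Y ((l.erase a).flatMap e) (e b)).hom := by
        rw [← id_tensorHom, tensorHom_comp_tensorHom, Category.comp_id]
      rw [e5, Category.assoc, Category.assoc, ← reassoc_of% swapHom_naturality, hsw]
      have e6 : (θ b ⊗ₘ pull X a l (l.erase a) hal rfl ≫ (θ a ⊗ₘ listSub θ (l.erase a)) ≫
          (appendIso Y ((l.erase a).flatMap e) (e a)).hom) =
          X b ◁ pull X a l (l.erase a) hal rfl ≫ (θ b ⊗ₘ (θ a ⊗ₘ listSub θ (l.erase a))) ≫
            listTens Y (e b) ◁ (appendIso Y ((l.erase a).flatMap e) (e a)).hom := by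
        rw [← id_tensorHom, ← id_tensorHom, tensorHom_comp_tensorHom_assoc,
          tensorHom_comp_tensorHom, Category.id_comp, Category.comp_id, Category.assoc]
      rw [e6]
      simp only [Category.assoc]

/-- Permutation isomorphisms are compatible with the substitution of pairwise disjoint lists. -/
theorem permIso_listSub {e : J → List K} (he : ∀ i j, i ≠ j → ∀ x ∈ e i, x ∉ e j)
    (θ : ∀ j, X j ⟶ listTens Y (e j)) (l l' : List J) (h : l.Perm l') (h') :
    listSub θ l ≫ (permIso Y (l.flatMap e) (l'.flatMap e) h').hom =
      (permIso X l l' h).hom ≫ listSub θ l' := by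
  induction l' generalizing l with
  | nil =>
    obtain rfl := h.eq_nil
    rw [permIso_of_eq Y (l := List.flatMap e []) (l' := List.flatMap e []) rfl, permIso_self,
      Category.id_comp]
    exact Category.comp_id _
  | cons a l' ih =>
    have ha : a ∈ l := h.mem_iff.2 List.mem_cons_self
    have hp : (l.erase a).Perm l' := by simpa using h.erase a
    have hp1 : (l.flatMap e).Perm (e a ++ (l.erase a).flatMap e) :=
      (List.perm_cons_erase ha).flatMap_right e
    have hp2 : ((l.erase a).flatMap e).Perm (l'.flatMap e) := hp.flatMap_right e
    have e1 : (permIso Y (l.flatMap e) ((a :: l').flatMap e) h').hom =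
        (permIso Y (l.flatMap e) (e a ++ (l.erase a).flatMap e) hp1).hom ≫
          (permIso Y (e a ++ (l.erase a).flatMap e) (e a ++ l'.flatMap e)
            (hp2.append_left _)).hom := (permIso_trans Y _ _ _ _ _ _).symm
    have e2 : listSub θ (a :: l') =
      (θ a ⊗ₘ listSub θ l') ≫ (appendIso Y (l'.flatMap e) (e a)).hom := rfl
    rw [e1, e2, permIso_cons X l l' _ a h rfl, ← Category.assoc,
      pull_listSub he θ a l _ ha rfl, Category.assoc, Category.assoc,
      permIso_append Y _ _ _ _ (.refl _) hp2, permIso_self, tensorHom_comp_tensorHom_assoc,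
      ih _ hp]
    simp only [Category.assoc, Category.comp_id]
    rw [← id_tensorHom, tensorHom_comp_tensorHom_assoc, Category.id_comp]

theorem listSub_append {e : J → List K} (θ : ∀ j, X j ⟶ listTens Y (e j)) (l m : List J) (h) :
    (listSub θ l ⊗ₘ listSub θ m) ≫ (appendIso Y (m.flatMap e) (l.flatMap e)).hom =
      (appendIso X m l).hom ≫ listSub θ (l ++ m) ≫
        (permIso Y ((l ++ m).flatMap e) (l.flatMap e ++ m.flatMap e) h).hom := by
  induction l with
  | nil =>
    have e1 : (permIso Y (([] ++ m).flatMap e) (List.flatMap e [] ++ m.flatMap e) h).hom = 𝟙 _ :=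
      permIso_of_eq Y rfl h
    rw [e1]
    change (𝟙 (𝟙_ V) ⊗ₘ listSub θ m) ≫ (λ_ _).hom =
      (λ_ (listTens X m)).hom ≫ listSub θ m ≫ 𝟙 _
    rw [Category.comp_id, id_tensorHom, leftUnitor_naturality]
  | cons j l ih =>
    have hp : ((l ++ m).flatMap e).Perm (l.flatMap e ++ m.flatMap e) := by simp
    have hp' : (e j ++ (l.flatMap e ++ m.flatMap e)).Perm
      ((e j ++ l.flatMap e) ++ m.flatMap e) := by simp
    have e1 : (permIso Y ((j :: l ++ m).flatMap e) ((j :: l).flatMap e ++ m.flatMap e) h).hom =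
        (permIso Y (e j ++ (l ++ m).flatMap e) (e j ++ (l.flatMap e ++ m.flatMap e))
          (hp.append_left _)).hom ≫
        (permIso Y (e j ++ (l.flatMap e ++ m.flatMap e))
          ((e j ++ l.flatMap e) ++ m.flatMap e) hp').hom := (permIso_trans Y _ _ _ _ _ _).symm
    have e2 : listSub θ (j :: l ++ m) = (θ j ⊗ₘ listSub θ (l ++ m)) ≫
      (appendIso Y ((l ++ m).flatMap e) (e j)).hom := rfl
    have e3 : listSub θ (j :: l) = (θ j ⊗ₘ listSub θ l) ≫
      (appendIso Y (l.flatMap e) (e j)).hom := rfl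
    have e4 : (appendIso X m (j :: l)).hom = (α_ (X j) (listTens X l) (listTens X m)).hom ≫
      X j ◁ (appendIso X m l).hom := rfl
    have e5 : (appendIso Y (m.flatMap e) ((j :: l).flatMap e)).hom =
      (appendIso Y (m.flatMap e) (e j ++ l.flatMap e)).hom := rfl
    have hp'' := hp'.symm
    have ass := appendIso_assoc Y (e j) (l.flatMap e) (m.flatMap e) hp''
    have ass' : (appendIso Y (l.flatMap e) (e j)).hom ▷ listTens Y (m.flatMap e) ≫
        (appendIso Y (m.flatMap e) (e j ++ l.flatMap e)).hom =
        (α_ _ _ _).hom ≫ listTens Y (e j) ◁ (appendIso Y (m.flatMap e) (l.flatMap e)).hom ≫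
          (appendIso Y (l.flatMap e ++ m.flatMap e) (e j)).hom ≫ (permIso Y _ _ hp').hom := by
      rw [reassoc_of% ass, permIso_trans Y _ _ _ _ _ (.refl _), permIso_self]
      simp
    rw [e1, e2, e3, e4, e5]
    simp only [Category.assoc]
    rw [reassoc_of% (permIso_append Y _ _ _ _ (.refl _) hp), permIso_self]
    have e6 : ((θ j ⊗ₘ listSub θ l) ≫ (appendIso Y (l.flatMap e) (e j)).hom ⊗ₘ listSub θ m) =
        ((θ j ⊗ₘ listSub θ l) ⊗ₘ listSub θ m) ≫
          (appendIso Y (l.flatMap e) (e j)).hom ▷ listTens Y (m.flatMap e) := by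
      rw [← tensorHom_id, tensorHom_comp_tensorHom, Category.comp_id]
    rw [e6, Category.assoc, ass', associator_naturality_assoc, tensorHom_comp_tensorHom_assoc]
    have ih' := ih hp
    rw [← id_tensorHom, tensorHom_comp_tensorHom_assoc, ih', ← id_tensorHom,
      tensorHom_comp_tensorHom_assoc]
    simp

theorem permIso_flat {k : ℕ} {f g : Fin k → List J} (h : ∀ i, (f i).Perm (g i)) (h') :
    tensMap (fun i => (permIso X (f i) (g i) (h i)).hom) ≫ (flatIso X g).hom =
      (flatIso X f).hom ≫ (permIso X (flat f) (flat g) h').hom := by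
  induction k with
  | zero =>
    rw [permIso_of_eq X (l := flat f) (l' := flat g) rfl]
    rfl
  | succ k ih =>
    have e1 : ∀ f : Fin (k + 1) → List J, (flatIso X f).hom =
      listTens X (f 0) ◁ (flatIso X fun i => f i.succ).hom ≫
        (appendIso X (flat fun i => f i.succ) (f 0)).hom := fun _ => rfl
    have e2 : tensMap (fun i => (permIso X (f i) (g i) (h i)).hom) =
      (permIso X (f 0) (g 0) (h 0)).hom ⊗ₘ
        tensMap (fun i => (permIso X (f i.succ) (g i.succ) (h i.succ)).hom) := rfl
    have hp := flat_perm fun i : Fin k => h i.succ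
    have ih' := ih (fun i => h i.succ) hp
    have e3 := permIso_append X _ _ _ _ (h 0) hp h'
    rw [e1, e1, e2, Category.assoc]
    refine Eq.trans ?_ (congrArg (listTens X (f 0) ◁ (flatIso X fun i => f i.succ).hom ≫ ·) e3.symm)
    rw [← id_tensorHom, ← id_tensorHom, tensorHom_comp_tensorHom_assoc,
      tensorHom_comp_tensorHom_assoc, ih', Category.id_comp, Category.comp_id]

theorem listSub_flat {e : J → List K} (θ : ∀ j, X j ⟶ listTens Y (e j)) {k : ℕ}
    (f : Fin k → List J) (h) :
    tensMap (fun i => listSub θ (f i)) ≫ (flatIso Y fun i => (f i).flatMap e).hom =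
      (flatIso X f).hom ≫ listSub θ (flat f) ≫
        (permIso Y ((flat f).flatMap e) (flat fun i => (f i).flatMap e) h).hom := by
  induction k with
  | zero =>
    rw [permIso_of_eq Y (l := (flat f).flatMap e) (l' := flat fun i => (f i).flatMap e) rfl]
    change 𝟙 (𝟙_ V) ≫ 𝟙 _ = 𝟙 _ ≫ 𝟙 _ ≫ 𝟙 _
    simp
  | succ k ih =>
    have hp : ((flat fun i => f i.succ).flatMap e).Perm
        (flat fun i : Fin k => (f i.succ).flatMap e) :=
      .of_eq (flat_flatMap e _)
    have ih' := ih (fun i => f i.succ) hp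
    have e1 : (flatIso X f).hom = listTens X (f 0) ◁ (flatIso X fun i => f i.succ).hom ≫
        (appendIso X (flat fun i => f i.succ) (f 0)).hom := rfl
    have e2 : (flatIso Y fun i => (f i).flatMap e).hom =
      listTens Y ((f 0).flatMap e) ◁ (flatIso Y fun i => (f i.succ).flatMap e).hom ≫
        (appendIso Y (flat fun i => (f i.succ).flatMap e) ((f 0).flatMap e)).hom := rfl
    have hq : ((f 0 ++ flat fun i => f i.succ).flatMap e).Perm
        ((f 0).flatMap e ++ (flat fun i => f i.succ).flatMap e) := by simp
    have e3 : (permIso Y ((flat f).flatMap e) (flat fun i => (f i).flatMap e) h).hom =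
      (permIso Y ((f 0 ++ flat fun i => f i.succ).flatMap e)
        ((f 0).flatMap e ++ (flat fun i => f i.succ).flatMap e) hq).hom ≫
      (permIso Y _ _ (hp.append_left ((f 0).flatMap e))).hom := (permIso_trans Y _ _ _ _ _ _).symm
    have e4 := listSub_append θ (f 0) (flat fun i => f i.succ) hq
    rw [e1, e2, e3, Category.assoc]
    refine Eq.trans ?_ (congrArg (fun t => listTens X (f 0) ◁ (flatIso X fun i => f i.succ).hom ≫
      t ≫ (permIso Y _ _ (hp.append_left ((f 0).flatMap e))).hom) e4 |>.trans
        (by simp only [Category.assoc]))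
    have e5 : (tensMap fun i => listSub θ (f i)) =
      listSub θ (f 0) ⊗ₘ tensMap fun i => listSub θ (f i.succ) := rfl
    rw [Category.assoc, permIso_append Y _ _ _ _ (.refl _) hp, permIso_self,
      ← id_tensorHom, ← id_tensorHom, tensorHom_comp_tensorHom_assoc,
      tensorHom_comp_tensorHom_assoc, e5, tensorHom_comp_tensorHom_assoc]
    rw [Category.id_comp, Category.assoc, ← ih']

theorem tensIso_hom {k : ℕ} {X Y : Fin k → V} (f : ∀ i, X i ≅ Y i) :
    (tensIso f).hom = tensMap fun i => (f i).hom := by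
  induction k with
  | zero => rfl
  | succ k ih =>
    change (f 0).hom ⊗ₘ (tensIso fun i => f i.succ).hom = _
    rw [ih]
    rfl

theorem TExpr.subMap_normIso {e : J → TExpr K} (θ : ∀ j, X j ⟶ (e j).eval Y) (a : TExpr J) (h) :
    a.subMap θ ≫ ((a.subst e).normIso Y).hom =
      (a.normIso X).hom ≫ listSub (fun j => θ j ≫ ((e j).normIso Y).hom) a.leaves ≫
        (permIso Y (a.leaves.flatMap fun j => (e j).leaves) (a.subst e).leaves h).hom := by
  induction a with
  | var j =>
    have hp : ((e j).leaves ++ []).Perm (e j).leaves := by simp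
    have h1 := appendIso_nil Y (e j).leaves hp
    change θ j ≫ ((e j).normIso Y).hom = (ρ_ (X j)).inv ≫
      ((θ j ≫ ((e j).normIso Y).hom ⊗ₘ 𝟙 (𝟙_ V)) ≫ (appendIso Y [] (e j).leaves).hom) ≫
        (permIso Y ((e j).leaves ++ []) (e j).leaves hp).hom
    rw [Category.assoc, h1]
    simp
  | pair a b iha ihb =>
    have ha := List.Perm.of_eq (leaves_subst e a).symm
    have hb := List.Perm.of_eq (leaves_subst e b).symm
    have hq : ((a.leaves ++ b.leaves).flatMap fun j => (e j).leaves).Perm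
      ((a.leaves.flatMap fun j => (e j).leaves) ++
        b.leaves.flatMap fun j => (e j).leaves) := by simp
    have e1 : (permIso Y ((pair a b).leaves.flatMap fun j => (e j).leaves)
        ((pair a b).subst e).leaves h).hom =
      (permIso Y _ _ hq).hom ≫ (permIso Y _ _ (ha.append hb)).hom :=
        (permIso_trans Y _ _ _ _ _ _).symm
    have e2 := listSub_append (fun j => θ j ≫ ((e j).normIso Y).hom) a.leaves b.leaves hq
    have e3 : ((pair a b).normIso X).hom =
      ((a.normIso X).hom ⊗ₘ (b.normIso X).hom) ≫ (appendIso X b.leaves a.leaves).hom := rfl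
    have e4 : (((pair a b).subst e).normIso Y).hom =
      (((a.subst e).normIso Y).hom ⊗ₘ ((b.subst e).normIso Y).hom) ≫
        (appendIso Y (b.subst e).leaves (a.subst e).leaves).hom := rfl
    have e5 : (pair a b).subMap θ = a.subMap θ ⊗ₘ b.subMap θ := rfl
    rw [e1, e3, e4, e5, tensorHom_comp_tensorHom_assoc, iha ha, ihb hb, Category.assoc,
      ← reassoc_of% e2, permIso_append Y _ _ _ _ ha hb, tensorHom_comp_tensorHom_assoc,
      tensorHom_comp_tensorHom_assoc]
    simp only [Category.assoc]
  | big f ih =>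
    have hf := fun i => List.Perm.of_eq (leaves_subst e (f i)).symm
    have hq : ((flat fun i => (f i).leaves).flatMap fun j => (e j).leaves).Perm
      (flat fun i => (f i).leaves.flatMap fun j => (e j).leaves) := .of_eq (flat_flatMap _ _)
    have e1 : (permIso Y ((big f).leaves.flatMap fun j => (e j).leaves)
        ((big f).subst e).leaves h).hom =
      (permIso Y _ _ hq).hom ≫ (permIso Y _ _ (flat_perm hf)).hom :=
        (permIso_trans Y _ _ _ _ _ _).symm
    have e2 := listSub_flat (fun j => θ j ≫ ((e j).normIso Y).hom) (fun i => (f i).leaves) hq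
    have e3 : ((big f).normIso X).hom = tensMap (fun i => ((f i).normIso X).hom) ≫
      (flatIso X fun i => (f i).leaves).hom := congrArg (· ≫ _) (tensIso_hom _)
    have e4 : (((big f).subst e).normIso Y).hom =
      tensMap (fun i => (((f i).subst e).normIso Y).hom) ≫
      (flatIso Y fun i => ((f i).subst e).leaves).hom := congrArg (· ≫ _) (tensIso_hom _)
    have e5 : (big f).subMap θ = tensMap fun i => (f i).subMap θ := rfl
    rw [e1, e3, e4, e5, ← Category.assoc (tensMap _), ← tensMap_comp, Category.assoc,
      ← reassoc_of% e2, ← permIso_flat hf, ← Category.assoc (tensMap _), ← tensMap_comp,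
      ← Category.assoc (tensMap _), ← tensMap_comp]
    congr 2
    funext i
    rw [ih i (hf i), Category.assoc]

end Substitution

end

section

section TensorCoherence

variable {V : Type u} [Category.{v} V] [MonoidalCategory V] [SymmetricCategory V]
  {J K : Type} [DecidableEq J] [DecidableEq K] {X : J → V} {Y : K → V}

theorem tensMap_tensMap {k : ℕ} {X Y Z : Fin k → V} (f : ∀ i, X i ⟶ Y i) (g : ∀ i, Y i ⟶ Z i) :
    tensMap f ≫ tensMap g = tensMap (fun i => f i ≫ g i) :=
  (tensMap_comp f g).symm

/-- The coherence isomorphisms are compatible with substitution. -/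
theorem cohIso_subst {e : J → TExpr K}
    (he : ∀ i j, i ≠ j → ∀ x ∈ (e i).leaves, x ∉ (e j).leaves)
    (θ : ∀ j, X j ⟶ (e j).eval Y) (a b : TExpr J) (h : a.leaves.Perm b.leaves)
    (h' : (a.subst e).leaves.Perm (b.subst e).leaves) :
    a.subMap θ ≫ (cohIso Y (a.subst e) (b.subst e) h').hom =
      (cohIso X a b h).hom ≫ b.subMap θ := by
  have ha := List.Perm.of_eq (TExpr.leaves_subst e a).symm
  have hb := List.Perm.of_eq (TExpr.leaves_subst e b).symm
  have hp : (a.leaves.flatMap fun j => (e j).leaves).Perm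
    (b.leaves.flatMap fun j => (e j).leaves) := h.flatMap_right _
  have ea := a.subMap_normIso θ ha
  have eb := b.subMap_normIso θ hb
  have key := permIso_listSub he (fun j => θ j ≫ ((e j).normIso Y).hom) _ _ h hp
  simp only [cohIso, Iso.trans_hom, Iso.symm_hom, Category.assoc]
  rw [← cancel_mono ((b.subst e).normIso Y).hom]
  simp only [Category.assoc, Iso.inv_hom_id, Category.comp_id]
  rw [eb, reassoc_of% ea, Iso.inv_hom_id_assoc, ← reassoc_of% key,
    permIso_trans Y _ _ _ _ _ (ha.trans h'), permIso_trans Y _ _ _ _ _ (ha.trans h')]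

theorem cohIso_refl (a : TExpr J) (h) : (cohIso X a a h).hom = 𝟙 _ := by
  simp only [cohIso, Iso.trans_hom, Iso.symm_hom]
  rw [permIso_self, Category.id_comp, Iso.hom_inv_id]

theorem cohIso_of_normIso (a b : TExpr J) (h : a.leaves = b.leaves) (h') (f : a.eval X ⟶ b.eval X)
    (hf : f ≫ (b.normIso X).hom = (a.normIso X).hom ≫ (permIso X _ _ (.of_eq h)).hom) :
    (cohIso X a b h').hom = f := by
  simp only [cohIso, Iso.trans_hom, Iso.symm_hom]
  rw [← Category.assoc, Iso.comp_inv_eq, hf]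

theorem cohIso_trans (a b c : TExpr J) (h : a.leaves.Perm b.leaves) (h' : b.leaves.Perm c.leaves)
    (h'') : (cohIso X a b h).hom ≫ (cohIso X b c h').hom = (cohIso X a c h'').hom := by
  simp only [cohIso, Iso.trans_hom, Iso.symm_hom, Category.assoc, Iso.inv_hom_id_assoc]
  rw [reassoc_of% permIso_trans]

theorem cohIso_pair (a a' b b' : TExpr J) (h : a.leaves.Perm a'.leaves)
    (h' : b.leaves.Perm b'.leaves) (h'') :
    (cohIso X (.pair a b) (.pair a' b') h'').hom =
      (cohIso X a a' h).hom ⊗ₘ (cohIso X b b' h').hom := by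
  have e : ∀ a b : TExpr J, ((TExpr.pair a b).normIso X).hom =
      ((a.normIso X).hom ⊗ₘ (b.normIso X).hom) ≫ (appendIso X b.leaves a.leaves).hom :=
    fun _ _ => rfl
  simp only [cohIso, Iso.trans_hom, Iso.symm_hom]
  rw [← Category.assoc, Iso.comp_inv_eq, e, e, Category.assoc, permIso_append X _ _ _ _ h h',
    tensorHom_comp_tensorHom_assoc, tensorHom_comp_tensorHom_assoc]
  simp

theorem cohIso_big {k : ℕ} (a b : Fin k → TExpr J) (h : ∀ i, (a i).leaves.Perm (b i).leaves)
    (h') : (cohIso X (.big a) (.big b) h').hom =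
      tensMap fun i => (cohIso X (a i) (b i) (h i)).hom := by
  have e : ∀ a : Fin k → TExpr J, ((TExpr.big a).normIso X).hom =
      tensMap (fun i => ((a i).normIso X).hom) ≫ (flatIso X fun i => (a i).leaves).hom :=
    fun _ => congrArg (· ≫ _) (tensIso_hom _)
  simp only [cohIso, Iso.trans_hom, Iso.symm_hom]
  rw [← Category.assoc, Iso.comp_inv_eq, e, e, Category.assoc, ← permIso_flat h,
    reassoc_of% tensMap_tensMap,
    reassoc_of% tensMap_tensMap]
  simp

theorem cohIso_leftUnitor (f : Fin 0 → TExpr J) (a : TExpr J) (h) :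
    (cohIso X (.pair (.big f) a) a h).hom = (λ_ (a.eval X)).hom := by
  refine cohIso_of_normIso _ _ (by rfl) _ _ ?_
  rw [permIso_of_eq X (l := (TExpr.pair (.big f) a).leaves) (l' := a.leaves) (by rfl)]
  change _ = ((𝟙 (𝟙_ V) ≫ 𝟙 (𝟙_ V) ⊗ₘ (a.normIso X).hom) ≫ (λ_ _).hom) ≫ 𝟙 _
  simp

theorem cohIso_rightUnitor (f : Fin 0 → TExpr J) (a : TExpr J) (h) :
    (cohIso X (.pair a (.big f)) a h).hom = (ρ_ (a.eval X)).hom := by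
  refine cohIso_of_normIso _ _ (List.append_nil _) _ _ ?_
  have e : ((TExpr.pair a (.big f)).normIso X).hom = ((a.normIso X).hom ⊗ₘ (𝟙 (𝟙_ V) ≫ 𝟙 (𝟙_ V))) ≫
    (appendIso X [] a.leaves).hom := rfl
  rw [e]
  have e2 := appendIso_nil X a.leaves (.of_eq (List.append_nil _))
  refine Eq.trans ?_ (congrArg (((a.normIso X).hom ⊗ₘ (𝟙 (𝟙_ V) ≫ 𝟙 (𝟙_ V))) ≫ ·) e2.symm |>.trans
    (Category.assoc _ _ _).symm)
  simp

theorem cohIso_big_succ {k : ℕ} (f : Fin (k + 1) → TExpr J) (h) :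
    (cohIso X (.big f) (.pair (f 0) (.big fun i => f i.succ)) h).hom = 𝟙 _ := by
  refine cohIso_of_normIso _ _ (by rfl) _ _ ?_
  rw [permIso_of_eq X (l := (TExpr.big f).leaves)
    (l' := (TExpr.pair (f 0) (.big fun i => f i.succ)).leaves) (by rfl)]
  have e : ((TExpr.big f).normIso X).hom = (((f 0).normIso X).hom ⊗ₘ
      (tensIso fun i : Fin k => (f i.succ).normIso X).hom) ≫
      listTens X (f 0).leaves ◁ (flatIso X fun i : Fin k => (f i.succ).leaves).hom ≫
        (appendIso X (flat fun i : Fin k => (f i.succ).leaves) (f 0).leaves).hom := rfl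
  have e2 : ((TExpr.pair (f 0) (.big fun i => f i.succ)).normIso X).hom =
      (((f 0).normIso X).hom ⊗ₘ (tensIso fun i : Fin k => (f i.succ).normIso X).hom ≫
        (flatIso X fun i : Fin k => (f i.succ).leaves).hom) ≫
        (appendIso X (flat fun i : Fin k => (f i.succ).leaves) (f 0).leaves).hom := rfl
  rw [e, e2, ← id_tensorHom, tensorHom_comp_tensorHom_assoc, Category.comp_id]
  exact (Category.id_comp _).trans (Category.comp_id _).symm

theorem cohIso_big_one (a : TExpr J) (h) :
    (cohIso X (.big fun _ : Fin 1 => a) a h).hom = (ρ_ (a.eval X)).hom := by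
  rw [← cohIso_trans (X := X) (.big fun _ : Fin 1 => a) (.pair a (.big fun _ : Fin 0 => a)) a
    (.of_eq rfl) (.of_eq (List.append_nil _)), cohIso_rightUnitor]
  have e := cohIso_big_succ (X := X) (fun _ : Fin 1 => a) (.of_eq rfl)
  exact (congrArg (· ≫ (ρ_ (a.eval X)).hom) e).trans (Category.id_comp _)

theorem cohIso_ones {k : ℕ} (f g : Fin 0 → TExpr J) (h) :
    (cohIso X (.big f) (.big fun _ : Fin k => .big g) h).hom = (onesIso k).hom := by
  induction k with
  | zero => exact cohIso_refl (X := X) (.big f) _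
  | succ k ih =>
    have h1 : (TExpr.big f).leaves.Perm (TExpr.pair (.big g) (.big f)).leaves := .of_eq rfl
    have h2 : (TExpr.big f).leaves.Perm (TExpr.big fun _ : Fin k => .big g).leaves := by
      simp [flat_nil]
    have e1 := cohIso_leftUnitor (X := X) g (.big f) h1.symm
    have e2 : (cohIso X (.big f) (.pair (.big g) (.big f)) h1).hom = (λ_ (𝟙_ V)).inv := by
      rw [← cancel_mono (λ_ (𝟙_ V)).hom, Iso.inv_hom_id]
      exact (congrArg (_ ≫ ·) e1.symm).trans ((cohIso_trans _ _ _ _ _ (.refl _)).trans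
        (cohIso_refl _ _))
    have e3 := cohIso_big_succ (X := X) (fun _ : Fin (k + 1) => TExpr.big g) (.of_eq rfl)
    have e4 := cohIso_trans (X := X) (.big f) (.big fun _ : Fin (k + 1) => .big g)
      (.pair (.big g) (.big fun _ : Fin k => .big g)) h (.of_eq rfl)
      (h1.trans ((List.Perm.refl _).append h2))
    rw [e3, ← cohIso_trans (X := X) (.big f) (.pair (.big g) (.big f))
      (.pair (.big g) (.big fun _ : Fin k => .big g)) h1 ((List.Perm.refl _).append h2), e2,
      cohIso_pair (X := X) (.big g) (.big g) (.big f) _ (.refl _) h2, ih, cohIso_refl] at e4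
    exact (Category.comp_id _).symm.trans e4

end TensorCoherence

end

section

section PermutationsAndShuffles

variable {V : Type u} [Category.{v} V] [MonoidalCategory V] [SymmetricCategory V]

theorem cohIso_inv {J : Type} [DecidableEq J] {X : J → V} (a b : TExpr J)
    (h : a.leaves.Perm b.leaves) (h') : (cohIso X a b h).inv = (cohIso X b a h').hom := by
  rw [← cancel_epi (cohIso X a b h).hom, Iso.hom_inv_id, cohIso_trans (X := X) _ _ _ _ _ (.refl _),
    cohIso_refl]

theorem big_var_perm {K : Type} {k k' : ℕ} (e : Fin k → K) (r : Fin k' → Fin k)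
    (hr : Function.Bijective r) :
    (TExpr.big fun i => .var (e i)).leaves.Perm (TExpr.big fun j => .var (e (r j))).leaves := by
  refine TExpr.leaves_subst_perm (a := .big fun i => .var i) (b := .big fun j => .var (r j))
    (fun i => .var (e i)) ?_
  rw [List.perm_ext_iff_of_nodup]
  · intro a
    obtain ⟨j, rfl⟩ := hr.2 a
    simp only [TExpr.leaves, mem_flat, List.mem_singleton]
    exact ⟨fun _ => ⟨j, rfl⟩, fun _ => ⟨r j, rfl⟩⟩
  · exact nodup_flat _ (fun i => by simp [TExpr.leaves]) (by simp [TExpr.leaves])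
  · refine nodup_flat _ (fun i => by simp [TExpr.leaves]) (fun i j x hi hj => hr.1 ?_)
    simp only [TExpr.leaves, List.mem_singleton] at hi hj
    rw [← hi, hj]

/-- A permutation of factors, in terms of any labelling of the factors. -/
theorem permTens_eq_cohIso {K : Type} [DecidableEq K] (Z : K → V) {k k' : ℕ} (e : Fin k → K)
    (he : Function.Injective e) (r : Fin k' → Fin k) (hr : Function.Bijective r)
    (h : (TExpr.big fun i => .var (e i)).leaves.Perm (TExpr.big fun j => .var (e (r j))).leaves) :
    (permTens (fun i => Z (e i)) r hr).hom =
      (cohIso Z (.big fun i => .var (e i)) (.big fun j => .var (e (r j))) h).hom := by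
  have key := cohIso_subst (X := fun i => Z (e i)) (Y := Z) (e := fun i => .var (e i))
    (fun i j hij x hx hx' => hij (he (by simp at hx hx'; rw [← hx, hx']))) (fun i => 𝟙 _)
    (.big fun i => .var i) (.big fun j => .var (r j)) (big_var_perm id r hr) h
  have e1 : ∀ {n : ℕ} (s : Fin n → Fin k), (TExpr.big fun j => .var (s j)).subMap
      (X := fun i => Z (e i)) (Y := Z) (e := fun i => .var (e i)) (fun i => 𝟙 _) = 𝟙 _ :=
    fun s => tensMap_id _
  have e2 := e1 (fun i => i)
  rw [e1 r] at key
  exact ((Category.comp_id _).symm.trans key.symm).trans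
    ((congrArg (· ≫ _) e2).trans (Category.id_comp _))

theorem permTens_id {k : ℕ} (X : Fin k → V) (h) : (permTens X id h).hom = 𝟙 _ :=
  cohIso_refl _ _

theorem permTens_naturality {k k' : ℕ} {X Y : Fin k → V} (f : ∀ i, X i ⟶ Y i)
    (r : Fin k' → Fin k) (hr : Function.Bijective r) :
    tensMap f ≫ (permTens Y r hr).hom = (permTens X r hr).hom ≫ tensMap fun j => f (r j) :=
  cohIso_subst (e := TExpr.var) (by
      simp only [TExpr.leaves, List.mem_singleton]
      rintro i j h x rfl h'
      exact h h') f
    (.big fun i => .var i) (.big fun j => .var (r j)) _ _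

theorem permTens_comp {k k' k'' : ℕ} (X : Fin k → V) (r : Fin k' → Fin k)
    (hr : Function.Bijective r) (s : Fin k'' → Fin k') (hs : Function.Bijective s) (h) :
    (permTens X r hr).hom ≫ (permTens (fun j => X (r j)) s hs).hom =
      (permTens X (fun i => r (s i)) h).hom := by
  rw [permTens_eq_cohIso X r hr.1 s hs (big_var_perm r s hs)]
  exact cohIso_trans _ _ _ _ _ _

theorem shuffle_naturality {l k : ℕ} {g : Fin l → Fin k} {m : Fin k → ℕ} (G : FinFibers g m)
    {X X' : Fin k → V} {Y Y' : Fin l → V} (f : ∀ i, X i ⟶ X' i) (f' : ∀ s, Y s ⟶ Y' s) :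
    (tensMap f ⊗ₘ tensMap f') ≫ (shuffle G X' Y').hom =
      (shuffle G X Y).hom ≫ tensMap fun i => f i ⊗ₘ tensMap fun j => f' (G.emb i j) :=
  cohIso_subst (X := Sum.elim X Y) (Y := Sum.elim X' Y') (e := TExpr.var)
    (by simp only [TExpr.leaves, List.mem_singleton]; rintro i j h x rfl h'; exact h h')
    (fun j => match j with | .inl i => f i | .inr s => f' s)
    (.pair (.big fun i => .var (Sum.inl i)) (.big fun s => .var (Sum.inr s)))
    (.big fun i => .pair (.var (Sum.inl i)) (.big fun j => .var (Sum.inr (G.emb i j)))) _ _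

theorem shuffle_perm {l k : ℕ} {g : Fin l → Fin k} {m : Fin k → ℕ} (G : FinFibers g m) :
    (TExpr.pair (J := Fin k ⊕ Fin l) (.big fun i => .var (Sum.inl i))
      (.big fun s => .var (Sum.inr s))).leaves.Perm
      (TExpr.big fun i => .pair (.var (Sum.inl i))
        (.big fun j => .var (Sum.inr (G.emb i j)))).leaves := by
  rw [List.perm_ext_iff_of_nodup]
  · rintro (i | s)
    · simp [TExpr.leaves, mem_flat]
    · simp only [TExpr.leaves, List.mem_append, mem_flat, List.mem_singleton]
      simp only [reduceCtorEq, exists_false, Sum.inr.injEq, exists_eq', or_true, false_or,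
        true_iff]
      obtain ⟨a, ha⟩ := (G.mem_range (g s) s).2 rfl
      exact ⟨g s, a, ha.symm⟩
  · simp only [TExpr.leaves, List.nodup_append]
    refine ⟨nodup_flat _ (by simp) (by simp), nodup_flat _ (by simp) (by simp), ?_⟩
    rintro a ha b hb rfl
    simp only [mem_flat, List.mem_singleton] at ha hb
    obtain ⟨i, rfl⟩ := ha
    simp at hb
  · refine nodup_flat _ (fun i => ?_) (fun i i' x h h' => ?_)
    · simp only [TExpr.leaves, List.nodup_append]
      refine ⟨by simp, nodup_flat _ (by simp) (fun j j' x h h' => ?_), ?_⟩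
      · simp only [List.mem_singleton] at h h'
        rw [h] at h'
        exact (G.strictMono i).injective (Sum.inr_injective h')
      · rintro a ha b hb rfl
        simp only [mem_flat, List.mem_singleton] at ha hb
        rw [ha] at hb
        simp at hb
    · simp only [TExpr.leaves, List.mem_append, mem_flat, List.mem_singleton] at h h'
      rcases x with x | x
      · simp only [Sum.inl.injEq, reduceCtorEq, exists_false, or_false] at h h'
        rw [← h, h']
      · simp only [Sum.inr.injEq, reduceCtorEq, false_or] at h h'
        obtain ⟨a, ha⟩ := h
        obtain ⟨b, hb⟩ := h'
        rw [← G.map_emb i a, ← ha, hb, G.map_emb]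

/-- Shuffles are compatible with a reindexing of the second tensor product. -/
theorem shuffle_permTens {l l' k : ℕ} {g : Fin l → Fin k} {g' : Fin l' → Fin k} {m m' : Fin k → ℕ}
    (G : FinFibers g m) (G' : FinFibers g' m') (p : Fin l' → Fin l) (hp : Function.Bijective p)
    (h : ∀ t, g (p t) = g' t) (X : Fin k → V) {Y : Fin l → V} {Y' : Fin l' → V}
    (ψ : ∀ s t, p t = s → (Y s ⟶ Y' t)) :
    tens X ◁ ((permTens Y p hp).hom ≫ tensMap fun t => ψ (p t) t rfl) ≫ (shuffle G' X Y').hom =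
      (shuffle G X Y).hom ≫ tensMap fun i => X i ◁
        ((permTens (fun j => Y (G.emb i j)) (G'.res G p id h i)
          (G'.res_bijective G p id h i hp Function.injective_id)).hom ≫
          tensMap fun a => ψ (G.emb i (G'.res G p id h i a)) (G'.emb i a)
            (G'.emb_res G p id h i a).symm) := by
  let Z : Fin k ⊕ Fin l → V := Sum.elim X Y
  let A : TExpr (Fin k ⊕ Fin l) := .pair (.big fun i => .var (Sum.inl i))
    (.big fun s => .var (Sum.inr s))
  let A' : TExpr (Fin k ⊕ Fin l) :=
    .pair (.big fun i => .var (Sum.inl i)) (.big fun t => .var (Sum.inr (p t)))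
  let B (c : ∀ i, Fin (m' i) → Fin l) : TExpr (Fin k ⊕ Fin l) :=
    .big fun i => .pair (.var (Sum.inl i)) (.big fun a => .var (Sum.inr (c i a)))
  have key : ∀ (c : ∀ i, Fin (m' i) → Fin l) (hc : ∀ i a, p (G'.emb i a) = c i a) (hA)
      (hA' : A.leaves.Perm (B c).leaves),
      (cohIso Z A (B fun i a => p (G'.emb i a)) hA).hom ≫
        (tensMap fun i => X i ◁ tensMap fun a => ψ (p (G'.emb i a)) (G'.emb i a) rfl) =
      (cohIso Z A (B c) hA').hom ≫
        (tensMap fun i => X i ◁ tensMap fun a => ψ (c i a) (G'.emb i a) (hc i a)) := by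
    intro c hc
    obtain rfl : (fun i a => p (G'.emb i a)) = c := funext fun i => funext fun a => hc i a
    exact fun _ _ => rfl
  have h1 : A.leaves.Perm A'.leaves := (List.Perm.refl _).append (big_var_perm Sum.inr p hp)
  have h2 : A'.leaves.Perm (B fun i a => p (G'.emb i a)).leaves :=
    TExpr.leaves_subst_perm (fun x => .var (Sum.map id p x)) (shuffle_perm G')
  have h3 : ∀ i, (TExpr.pair (.var (Sum.inl i))
    (.big fun j => .var (Sum.inr (G.emb i j)))).leaves.Perm
      (TExpr.pair (.var (Sum.inl i)) (.big fun a =>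
        .var (Sum.inr (G.emb i (G'.res G p id h i a))))).leaves :=
    fun i => (List.Perm.refl _).append (big_var_perm (fun j => Sum.inr (G.emb i j)) _
      (G'.res_bijective G p id h i hp Function.injective_id))
  have h4 := (shuffle_perm G).trans (flat_perm h3)
  have e1 : tens X ◁ (permTens Y p hp).hom = (cohIso Z A A' h1).hom := by
    rw [cohIso_pair (X := Z) _ _ _ _ (.refl _) (big_var_perm Sum.inr p hp), cohIso_refl,
      ← permTens_eq_cohIso Z Sum.inr Sum.inr_injective p hp]
    exact (id_tensorHom _ _).symm
  have e2 : (shuffle G' X fun t => Y (p t)).hom =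
      (cohIso Z A' (B fun i a => p (G'.emb i a)) h2).hom := by
    have := cohIso_subst (X := Sum.elim X fun t => Y (p t)) (Y := Z)
      (e := fun x => .var (Sum.map id p x))
      (by
        simp only [TExpr.leaves, List.mem_singleton]
        rintro i j hij x rfl h'
        exact hij ((Function.injective_id.sumMap hp.1) h'))
      (fun j => match j with | .inl i => 𝟙 (X i) | .inr s => 𝟙 (Y (p s)))
      (.pair (.big fun i => .var (Sum.inl i)) (.big fun s => .var (Sum.inr s)))
      (.big fun i => .pair (.var (Sum.inl i)) (.big fun j => .var (Sum.inr (G'.emb i j))))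
      (shuffle_perm G') h2
    have f1 : (tensMap (fun i => 𝟙 (X i)) ⊗ₘ tensMap fun t => 𝟙 (Y (p t))) = 𝟙 _ := by
      rw [tensMap_id, tensMap_id, id_tensorHom_id]
    have f2 : (tensMap fun i => 𝟙 (X i) ⊗ₘ tensMap fun j => 𝟙 (Y (p (G'.emb i j)))) = 𝟙 _ := by
      simp only [tensMap_id, id_tensorHom_id]
    exact ((Category.comp_id _).symm.trans (congrArg (_ ≫ ·) f2.symm)).trans
      (this.symm.trans ((congrArg (· ≫ _) f1).trans (Category.id_comp _)))
  have e3 : tensMap (fun i => X i ◁ (permTens (fun j => Y (G.emb i j)) (G'.res G p id h i)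
      (G'.res_bijective G p id h i hp Function.injective_id)).hom) =
      (cohIso Z (.big fun i => .pair (.var (Sum.inl i)) (.big fun j => .var (Sum.inr (G.emb i j))))
        (B fun i a => G.emb i (G'.res G p id h i a)) (flat_perm h3)).hom := by
    rw [cohIso_big (X := Z) _ _ h3]
    congr 1
    funext i
    rw [cohIso_pair (X := Z) _ _ _ _ (.refl _) (big_var_perm (fun j => Sum.inr (G.emb i j)) _
      (G'.res_bijective G p id h i hp Function.injective_id)), cohIso_refl,
      ← permTens_eq_cohIso Z (fun j => Sum.inr (G.emb i j))
        (Sum.inr_injective.comp (G.strictMono i).injective)]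
    exact (id_tensorHom _ _).symm
  have e4 : (shuffle G X Y).hom = (cohIso Z A
    (.big fun i => .pair (.var (Sum.inl i)) (.big fun j => .var (Sum.inr (G.emb i j))))
      (shuffle_perm G)).hom := rfl
  have nat := shuffle_naturality G' (X := X) (fun i => 𝟙 (X i)) fun t => ψ (p t) t rfl
  rw [tensMap_id, id_tensorHom] at nat
  simp only [MonoidalCategory.whiskerLeft_comp, Category.assoc, id_tensorHom] at nat ⊢
  have e12 : tens X ◁ (permTens Y p hp).hom ≫ (shuffle G' X fun t => Y (p t)).hom =
      (cohIso Z A (B fun i a => p (G'.emb i a)) (h1.trans h2)).hom :=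
    (congrArg₂ (· ≫ ·) e1 e2).trans (cohIso_trans (X := Z) A A' _ h1 h2 (h1.trans h2))
  have e34 : (shuffle G X Y).hom ≫ tensMap (fun i => X i ◁
      (permTens (fun j => Y (G.emb i j)) (G'.res G p id h i)
        (G'.res_bijective G p id h i hp Function.injective_id)).hom) =
      (cohIso Z A (B fun i a => G.emb i (G'.res G p id h i a)) h4).hom :=
    (congrArg₂ (· ≫ ·) e4 e3).trans (cohIso_trans (X := Z) A _
      (B fun i a => G.emb i (G'.res G p id h i a))
      (shuffle_perm G) (flat_perm h3) h4)
  rw [nat, reassoc_of% e12, ← tensMap_tensMap, reassoc_of% e34]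
  exact key _ (fun i a => (G'.emb_res G p id h i a).symm) _ h4

/-- Shuffles with unit objects in the second tensor product. -/
theorem shuffle_ones_right {l k : ℕ} {g : Fin l → Fin k} {m : Fin k → ℕ} (G : FinFibers g m)
    (X : Fin k → V) :
    (ρ_ (tens X)).inv ≫ tens X ◁ (onesIso l).hom ≫ (shuffle G X fun _ => 𝟙_ V).hom =
      tensMap fun i => (ρ_ (X i)).inv ≫ X i ◁ (onesIso (m i)).hom := by
  let one : TExpr (Fin k) := .big (Fin.elim0 : Fin 0 → TExpr (Fin k))
  let A : TExpr (Fin k) := .big fun i => .var i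
  let B : TExpr (Fin k) := .big fun i => .pair (.var i) (.big fun _ : Fin (m i) => one)
  have h0 : A.leaves.Perm (TExpr.pair A one).leaves := .of_eq (List.append_nil _).symm
  have hone : ∀ n, one.leaves.Perm (TExpr.big fun _ : Fin n => one).leaves :=
    fun n => .of_eq flat_nil.symm
  have h1 : (TExpr.pair A one).leaves.Perm (TExpr.pair A (.big fun _ : Fin l => one)).leaves :=
    (List.Perm.refl _).append (hone l)
  have h2 : (TExpr.pair A (.big fun _ : Fin l => one)).leaves.Perm B.leaves :=
    TExpr.leaves_subst_perm (Sum.elim TExpr.var fun _ => one) (shuffle_perm G)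
  have hv : ∀ i, (TExpr.var i).leaves.Perm (TExpr.pair (.var i) one).leaves :=
    fun i => .of_eq (List.append_nil _).symm
  have hw : ∀ i, (TExpr.pair (.var i) one).leaves.Perm
    (TExpr.pair (.var i) (.big fun _ : Fin (m i) => one)).leaves :=
    fun i => (List.Perm.refl _).append (hone _)
  have e1 : (shuffle G X fun _ => 𝟙_ V).hom = (cohIso X _ B h2).hom := by
    have := cohIso_subst (X := Sum.elim X fun _ => 𝟙_ V) (Y := X)
      (e := Sum.elim TExpr.var fun _ => one)
      (by
        rintro (i | s) (j | t) hij x hx hx' <;> simp_all [one, TExpr.leaves, flat])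
      (fun j => match j with | .inl i => 𝟙 (X i) | .inr s => 𝟙 (𝟙_ V))
      (.pair (.big fun i => .var (Sum.inl i)) (.big fun s => .var (Sum.inr s)))
      (.big fun i => .pair (.var (Sum.inl i)) (.big fun j => .var (Sum.inr (G.emb i j))))
      (shuffle_perm G) h2
    have f1 : (tensMap (fun i => 𝟙 (X i)) ⊗ₘ tensMap fun _ : Fin l => 𝟙 (𝟙_ V)) = 𝟙 _ := by
      rw [tensMap_id, tensMap_id, id_tensorHom_id]
    have f2 : (tensMap fun i => 𝟙 (X i) ⊗ₘ tensMap fun _ : Fin (m i) => 𝟙 (𝟙_ V)) = 𝟙 _ := by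
      simp only [tensMap_id, id_tensorHom_id]
    exact ((Category.comp_id _).symm.trans (congrArg (_ ≫ ·) f2.symm)).trans
      (this.symm.trans ((congrArg (· ≫ _) f1).trans (Category.id_comp _)))
  have e2 : (ρ_ (tens X)).inv = (cohIso X A (.pair A one) h0).hom := by
    rw [← cohIso_inv _ _ h0.symm]
    exact congrArg Iso.inv (Iso.ext (cohIso_rightUnitor (X := X) Fin.elim0 A h0.symm).symm)
  have e3 : tens X ◁ (onesIso l).hom = (cohIso X (.pair A one) _ h1).hom := by
    rw [cohIso_pair (X := X) _ _ _ _ (.refl _) (hone l), cohIso_refl, cohIso_ones]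
    exact (id_tensorHom _ _).symm
  have e4 : (tensMap fun i => (ρ_ (X i)).inv ≫ X i ◁ (onesIso (m i)).hom) =
      (cohIso X A B
        (flat_perm fun i => (hv i).trans (hw i))).hom := by
    rw [cohIso_big (X := X) _ _ fun i => (hv i).trans (hw i)]
    congr 1
    funext i
    rw [← cohIso_trans (X := X) _ _ _ (hv i) (hw i), ← cohIso_inv _ _ (hv i).symm,
      cohIso_pair (X := X) _ _ _ _ (.refl _) (hone _), cohIso_refl, cohIso_ones, id_tensorHom]
    exact congrArg (· ≫ X i ◁ (onesIso (m i)).hom) (congrArg Iso.inv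
      (Iso.ext (cohIso_rightUnitor (X := X) Fin.elim0 (.var i) (hv i).symm).symm))
  rw [e1, e2, e3, e4, cohIso_trans (X := X) _ _ _ _ _ (h1.trans h2),
    cohIso_trans (X := X) _ _ _ _ _ (h0.trans (h1.trans h2))]

/-- Shuffles with unit objects in the first tensor product. -/
theorem shuffle_ones_left {l k : ℕ} {g : Fin l → Fin k} (G : FinFibers g fun _ => 1)
    (Y : Fin l → V) (hG : Function.Bijective fun i => G.emb i 0) :
    (λ_ (tens Y)).inv ≫ (onesIso k).hom ▷ tens Y ≫ (shuffle G (fun _ => 𝟙_ V) Y).hom =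
      (permTens Y (fun i => G.emb i 0) hG).hom ≫
        tensMap fun i => (λ_ (Y (G.emb i 0))).inv ≫ 𝟙_ V ◁ (ρ_ (Y (G.emb i 0))).inv := by
  let one : TExpr (Fin l) := .big (Fin.elim0 : Fin 0 → TExpr (Fin l))
  let A : TExpr (Fin l) := .big fun i => .var i
  let B : TExpr (Fin l) := .big fun i => .pair one (.big fun a : Fin 1 => .var (G.emb i a))
  have h0 : A.leaves.Perm (TExpr.pair one A).leaves := .refl _
  have hone : ∀ n, one.leaves.Perm (TExpr.big fun _ : Fin n => one).leaves :=
    fun n => .of_eq flat_nil.symm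
  have h1 : (TExpr.pair one A).leaves.Perm (TExpr.pair (.big fun _ : Fin k => one) A).leaves :=
    (hone k).append (.refl _)
  have h2 : (TExpr.pair (.big fun _ : Fin k => one) A).leaves.Perm B.leaves :=
    TExpr.leaves_subst_perm (Sum.elim (fun _ => one) TExpr.var) (shuffle_perm G)
  have hp : A.leaves.Perm (TExpr.big fun i => .var (G.emb i 0)).leaves := big_var_perm id _ hG
  have hv : ∀ i, (TExpr.var (G.emb i 0)).leaves.Perm (TExpr.pair one (.var (G.emb i 0))).leaves :=
    fun i => .refl _
  have hw' : ∀ i, (TExpr.var (G.emb i 0)).leaves.Perm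
    (TExpr.big fun a : Fin 1 => .var (G.emb i a)).leaves := fun i => .of_eq (List.append_nil _).symm
  have hw : ∀ i, (TExpr.pair one (.var (G.emb i 0))).leaves.Perm
    (TExpr.pair one (.big fun a : Fin 1 => .var (G.emb i a))).leaves :=
    fun i => (List.Perm.refl _).append (hw' i)
  have e1 : (shuffle G (fun _ => 𝟙_ V) Y).hom = (cohIso Y _ B h2).hom := by
    have := cohIso_subst (X := Sum.elim (fun _ => 𝟙_ V) Y) (Y := Y)
      (e := Sum.elim (fun _ => one) TExpr.var)
      (by
        rintro (i | s) (j | t) hij x hx hx' <;> simp_all [one, TExpr.leaves, flat])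
      (fun j => match j with | .inl i => 𝟙 (𝟙_ V) | .inr s => 𝟙 (Y s))
      (.pair (.big fun i => .var (Sum.inl i)) (.big fun s => .var (Sum.inr s)))
      (.big fun i => .pair (.var (Sum.inl i)) (.big fun j => .var (Sum.inr (G.emb i j))))
      (shuffle_perm G) h2
    have f1 : (tensMap (fun _ : Fin k => 𝟙 (𝟙_ V)) ⊗ₘ tensMap fun s => 𝟙 (Y s)) = 𝟙 _ := by
      rw [tensMap_id, tensMap_id, id_tensorHom_id]
    have f2 : (tensMap fun i : Fin k => 𝟙 (𝟙_ V) ⊗ₘ tensMap fun j => 𝟙 (Y (G.emb i j))) = 𝟙 _ := by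
      simp only [tensMap_id, id_tensorHom_id]
    exact ((Category.comp_id _).symm.trans (congrArg (_ ≫ ·) f2.symm)).trans
      (this.symm.trans ((congrArg (· ≫ _) f1).trans (Category.id_comp _)))
  have e2 : (λ_ (tens Y)).inv = (cohIso Y A (.pair one A) h0).hom := by
    rw [← cohIso_inv _ _ h0.symm]
    exact congrArg Iso.inv (Iso.ext (cohIso_leftUnitor (X := Y) Fin.elim0 A h0.symm).symm)
  have e3 : (onesIso k).hom ▷ tens Y = (cohIso Y (.pair one A) _ h1).hom := by
    rw [cohIso_pair (X := Y) _ _ _ _ (hone k) (.refl _), cohIso_refl, cohIso_ones]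
    exact (tensorHom_id _ _).symm
  have e4 : (tensMap fun i => (λ_ (Y (G.emb i 0))).inv ≫ 𝟙_ V ◁ (ρ_ (Y (G.emb i 0))).inv) =
      (cohIso Y (.big fun i => .var (G.emb i 0)) B
        (flat_perm fun i => (hv i).trans (hw i))).hom := by
    rw [cohIso_big (X := Y) _ _ fun i => (hv i).trans (hw i)]
    congr 1
    funext i
    have f1 : (cohIso Y _ _ (hv i)).hom = (λ_ (Y (G.emb i 0))).inv := by
      rw [← cohIso_inv _ _ (hv i).symm]
      exact congrArg Iso.inv
        (Iso.ext (cohIso_leftUnitor (X := Y) Fin.elim0 (.var (G.emb i 0)) (hv i).symm))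
    have f2 : (cohIso Y _ _ (hw' i)).hom = (ρ_ (Y (G.emb i 0))).inv := by
      have hc : (fun a : Fin 1 => TExpr.var (G.emb i a)) = fun _ => .var (G.emb i 0) := by
        funext a
        rw [Subsingleton.elim a 0]
      have : ∀ (c : Fin 1 → TExpr (Fin l)) (hc : c = fun _ => .var (G.emb i 0)) (h),
        (cohIso Y (.var (G.emb i 0)) (.big c) h).hom ≫ eqToHom (by rw [hc]) =
          (ρ_ (Y (G.emb i 0))).inv := by
        rintro _ rfl h
        rw [eqToHom_refl, Category.comp_id, ← cohIso_inv _ _ h.symm]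
        exact congrArg Iso.inv (Iso.ext (cohIso_big_one (X := Y) (.var (G.emb i 0)) h.symm))
      exact (Category.comp_id _).symm.trans (this _ hc (hw' i))
    rw [← cohIso_trans (X := Y) _ _ _ (hv i) (hw i),
      cohIso_pair (X := Y) _ _ _ _ (.refl _) (hw' i), cohIso_refl, f1, f2]
    exact congrArg (_ ≫ ·) (id_tensorHom _ _).symm
  have e5 : (permTens Y (fun i => G.emb i 0) hG).hom = (cohIso Y A _ hp).hom := rfl
  rw [e1, e2, e3, e4, e5, cohIso_trans (X := Y) _ _ _ _ _ (h1.trans h2),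
    cohIso_trans (X := Y) _ _ _ _ _ (h0.trans (h1.trans h2)),
    cohIso_trans (X := Y) _ _ _ _ _ (h0.trans (h1.trans h2))]

end PermutationsAndShuffles

end

section

section ThreeLevels

/-- A linear order with a greatest element which is at least the third element. -/
class ThreeLevels (P : Type) [LinearOrder P] where
  low : P
  mid : P
  top : P
  low_lt_mid : low < mid
  mid_lt_top : mid < top
  le_top : ∀ p : P, p ≤ top

namespace ThreeLevels

theorem low_lt_top (P : Type) [LinearOrder P] [ThreeLevels P] : (low : P) < top :=
  low_lt_mid.trans mid_lt_top

end ThreeLevels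

open NOrd ThreeLevels

variable {P : Type} [LinearOrder P]

namespace NOrd

/-- The ordinal with `k` elements all of whose relations are of level `t`. -/
abbrev single (t : P) (k : ℕ) : NOrd P where
  card := k
  lt p a b := p = t ∧ a < b
  irrefl _ _ h := lt_irrefl _ h.2
  existsUnique a b hab := ⟨t, by simpa using lt_or_gt_of_ne hab, by rintro p (h | h) <;> exact h.1⟩
  trans := by
    rintro p q a b c ⟨rfl, h⟩ ⟨rfl, h'⟩
    exact ⟨min_self _, h.trans h'⟩
  total _ _ _ h := h.2

/-- Every map of sets is a map between ordinals of single levels `p < q`. -/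
abbrev singleHom {p q : P} (hpq : p < q) {n k : ℕ} (f : Fin n → Fin k) :
    single p n ⟶ single q k :=
  ⟨f, by
    rintro r i j ⟨rfl, -⟩
    rcases lt_trichotomy (f i) (f j) with h | h | h
    · exact Or.inl ⟨q, hpq.le, rfl, h⟩
    · exact Or.inr (Or.inl h)
    · exact Or.inr (Or.inr ⟨q, hpq, rfl, h⟩)⟩

/-- Monotone maps are maps between ordinals of the same single level. -/
abbrev singleMono (p : P) {n k : ℕ} (f : Fin n → Fin k) (hf : Monotone f) :
    single p n ⟶ single p k :=
  ⟨f, by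
    rintro r i j ⟨rfl, h⟩
    rcases (hf h.le).lt_or_eq with h | h
    · exact Or.inl ⟨_, le_rfl, rfl, h⟩
    · exact Or.inr (Or.inl h)⟩

/-- The identity of the underlying set, as a map to the ordinal of the greatest level. -/
abbrev toTop [ThreeLevels P] (T : NOrd P) : T ⟶ single top T.card :=
  ⟨id, fun p i j h => Or.inl ⟨top, le_top p, rfl, T.total p i j h⟩⟩

/-- The identity of the underlying set, as a map from an ordinal of a single level. -/
abbrev ofSingle (T : NOrd P) (p : P) (hp : ∀ r a b, T.lt r a b → p ≤ r) : single p T.card ⟶ T :=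
  ⟨id, by
    rintro q i j ⟨rfl, hij⟩
    obtain ⟨r, hr | hr, -⟩ := T.existsUnique i j hij.ne
    · exact Or.inl ⟨r, hp r i j hr, hr⟩
    · exact absurd (T.total _ _ _ hr) hij.asymm⟩

theorem exists_lowerBound [ThreeLevels P] (T : NOrd P) :
    ∃ p, p < top ∧ ∀ r a b, T.lt r a b → p ≤ r := by
  have hfin : Set.Finite {r | ∃ a b, T.lt r a b} := by
    have hc : ∀ x : Fin T.card × Fin T.card, ∃ p, ∀ r, T.lt r x.1 x.2 → r = p := by
      rintro ⟨a, b⟩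
      by_cases hab : a = b
      · exact ⟨low, fun r hr => absurd hr (hab ▸ T.irrefl r a)⟩
      · obtain ⟨p, -, hp⟩ := T.existsUnique a b hab
        exact ⟨p, fun r hr => hp r (Or.inl hr)⟩
    choose g hg using hc
    refine (Set.finite_range g).subset ?_
    rintro r ⟨a, b, h⟩
    exact ⟨(a, b), (hg (a, b) r h).symm⟩
  have : Nonempty P := ⟨low⟩
  obtain ⟨p, hp⟩ := (hfin.insert low).bddBelow
  exact ⟨p, (hp (Set.mem_insert _ _)).trans_lt (low_lt_top P),
    fun r a b h => hp (Set.mem_insert_of_mem _ ⟨a, b, h⟩)⟩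

theorem quasibijection_toTop [ThreeLevels P] (T : NOrd P) : quasibijection P (toTop T) :=
  Function.bijective_id

end NOrd

theorem PiQ.ofHom_comp {T S R : NOrd P} (f : T ⟶ S) (g : S ⟶ R) (hf : quasibijection P f)
    (hg : quasibijection P g) (hfg : quasibijection P (f ≫ g)) :
    PiQ.ofHom f hf ≫ PiQ.ofHom g hg = PiQ.ofHom (f ≫ g) hfg :=
  ((FreeGroupoid.of (QCat P)).map_comp (X := ⟨T⟩) (Y := ⟨S⟩) (Z := ⟨R⟩) ⟨f, hf⟩ ⟨g, hg⟩).symm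

theorem PiQ.ofHom_id (T : NOrd P) (h : quasibijection P (𝟙 T)) : PiQ.ofHom (𝟙 T) h = 𝟙 _ :=
  (FreeGroupoid.of (QCat P)).map_id ⟨T⟩

theorem totalOrderPi_map_ofHom {T S : NOrd P} (f : T ⟶ S) (hf : quasibijection P f) :
    (totalOrderPi P).map (PiQ.ofHom f hf) = Equiv.ofBijective f.toFun hf :=
  FreeGroupoid.lift_map_homMk _ _

theorem totalOrderPi_map_inv_ofHom {T S : NOrd P} (f : T ⟶ S) (hf : quasibijection P f) :
    (totalOrderPi P).map (Groupoid.inv (PiQ.ofHom f hf)) =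
      (Equiv.ofBijective f.toFun hf).symm := by
  have h : (totalOrderPi P).map (Groupoid.inv (PiQ.ofHom f hf)) =
      Groupoid.inv ((totalOrderPi P).map (PiQ.ofHom f hf)) := by
    rw [Groupoid.inv_eq_inv, Functor.map_inv, Groupoid.inv_eq_inv]
  rw [h, totalOrderPi_map_ofHom]
  rfl

/-- The class of a bijection between ordinals of single levels `p < q`. -/
abbrev PiQ.ofEquiv {p q : P} (h : p < q) {n k : ℕ} (r : Fin n ≃ Fin k) :
    PiQ.ofObj (single p n) ⟶ PiQ.ofObj (single q k) :=
  PiQ.ofHom (singleHom h r) r.bijective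

theorem PiQ.ofEquiv_comp {p q t : P} (h : p < q) (h' : q < t) {n k l : ℕ} (r : Fin n ≃ Fin k)
    (s : Fin k ≃ Fin l) :
    PiQ.ofEquiv h r ≫ PiQ.ofEquiv h' s = PiQ.ofEquiv (h.trans h') (r.trans s) :=
  PiQ.ofHom_comp _ _ _ _ _

theorem PiQ.inv_comp_ofEquiv {p p' q : P} (h : p < q) (h' : p' < q) {n k : ℕ}
    (r : Fin n ≃ Fin k) :
    Groupoid.inv (PiQ.ofEquiv h (.refl _)) ≫ PiQ.ofEquiv h r =
      Groupoid.inv (PiQ.ofEquiv h' (.refl _)) ≫ PiQ.ofEquiv h' r := by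
  have key : ∀ (p p' : P) (h : p < q) (h' : p' < q), p < p' →
      Groupoid.inv (PiQ.ofEquiv h (.refl _)) ≫ PiQ.ofEquiv h r =
        Groupoid.inv (PiQ.ofEquiv h' (.refl _)) ≫ PiQ.ofEquiv h' r := by
    intro p p' h h' hp
    have e1 := PiQ.ofEquiv_comp hp h' (.refl _) r
    have e2 := PiQ.ofEquiv_comp hp h' (.refl (Fin n)) (.refl _)
    rw [Groupoid.inv_eq_inv, Groupoid.inv_eq_inv, IsIso.inv_comp_eq]
    rw [Equiv.refl_trans] at e1 e2
    rw [← e1, ← e2]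
    simp
  rcases lt_trichotomy p p' with hp | rfl | hp
  · exact key p p' h h' hp
  · rfl
  · exact (key p' p h' h hp).symm

variable (P) [ThreeLevels P]

/-- The inverse of the total order functor on the fundamental groupoid. -/
def ofSymGrpd : SymGrpd ⥤ PiQ P where
  obj k := PiQ.ofObj (single top k.card)
  map {k l} r := Groupoid.inv (PiQ.ofEquiv (low_lt_top P) (.refl (Fin k.card))) ≫
    PiQ.ofEquiv (low_lt_top P) (show Fin k.card ≃ Fin l.card from r)
  map_id k := Groupoid.inv_comp _
  map_comp {k l m} r s := by
    rw [PiQ.inv_comp_ofEquiv (low_lt_top P) mid_lt_top (show Fin l.card ≃ Fin m.card from s)]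
    have e1 := PiQ.ofEquiv_comp (low_lt_mid (P := P)) mid_lt_top
      (show Fin k.card ≃ Fin l.card from r) (.refl _)
    have e2 := PiQ.ofEquiv_comp (low_lt_mid (P := P)) mid_lt_top
      (show Fin k.card ≃ Fin l.card from r) (show Fin l.card ≃ Fin m.card from s)
    rw [Equiv.trans_refl] at e1
    rw [← e1]
    refine (congrArg (_ ≫ ·) e2.symm).trans ?_
    simp [Groupoid.inv_eq_inv]

variable {P}

theorem ofSymGrpd_map_eq {p : P} (h : p < top) {n k : ℕ} (r : Fin n ≃ Fin k) :
    (ofSymGrpd P).map (show SymGrpd.mk n ⟶ SymGrpd.mk k from r) =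
      Groupoid.inv (PiQ.ofEquiv h (.refl _)) ≫ PiQ.ofEquiv h r :=
  PiQ.inv_comp_ofEquiv _ _ _

theorem ofHom_comp_toTop {T S : NOrd P} (f : T ⟶ S) (hf : quasibijection P f) :
    PiQ.ofHom f hf ≫ PiQ.ofHom (toTop S) (quasibijection_toTop S) =
      PiQ.ofHom (toTop T) (quasibijection_toTop T) ≫
        (ofSymGrpd P).map ((totalOrderPi P).map (PiQ.ofHom f hf)) := by
  obtain ⟨p, hp, h⟩ := T.exists_lowerBound
  rw [totalOrderPi_map_ofHom]
  refine Eq.trans ?_ (congrArg (_ ≫ ·) (ofSymGrpd_map_eq hp (Equiv.ofBijective f.toFun hf)).symm)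
  have hq : quasibijection P (ofSingle T p h) := Function.bijective_id
  rw [← cancel_epi (PiQ.ofHom (ofSingle T p h) hq)]
  have e1 : PiQ.ofHom (ofSingle T p h) hq ≫ PiQ.ofHom (toTop T) (quasibijection_toTop T) =
    PiQ.ofEquiv hp (.refl _) := PiQ.ofHom_comp _ _ _ _ _
  have e2 : PiQ.ofHom f hf ≫ PiQ.ofHom (toTop S) (quasibijection_toTop S) =
    PiQ.ofHom (f ≫ toTop S) hf := PiQ.ofHom_comp _ _ _ _ _
  have e3 : PiQ.ofHom (ofSingle T p h) hq ≫ PiQ.ofHom (f ≫ toTop S) hf =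
    PiQ.ofEquiv hp (Equiv.ofBijective f.toFun hf) := PiQ.ofHom_comp _ _ _ _ _
  rw [reassoc_of% e1, e2, e3, Groupoid.inv_eq_inv, IsIso.hom_inv_id_assoc]

variable (P)

/-- Every ordinal is isomorphic in the fundamental groupoid to one of the greatest level. -/
def toTopNatIso : 𝟭 (PiQ P) ≅ totalOrderPi P ⋙ ofSymGrpd P :=
  FreeGroupoid.liftNatIso _ _ (NatIso.ofComponents
    (fun T => ⟨PiQ.ofHom (toTop T.obj) (quasibijection_toTop T.obj),
      Groupoid.inv (PiQ.ofHom (toTop T.obj) (quasibijection_toTop T.obj)),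
      Groupoid.comp_inv _, Groupoid.inv_comp _⟩)
    (fun {T S} f => ofHom_comp_toTop f.hom f.property))

theorem toTopNatIso_hom_app (T : NOrd P) :
    (toTopNatIso P).hom.app (PiQ.ofObj T) = PiQ.ofHom (toTop T) (quasibijection_toTop T) :=
  FreeGroupoid.liftNatIso_hom_app (C := QCat P) _ _ _ ⟨T⟩

theorem totalOrderPi_map_ofSymGrpd {n k : SymGrpd} (r : n ⟶ k) :
    (totalOrderPi P).map ((ofSymGrpd P).map r) = r := by
  refine ((totalOrderPi P).map_comp _ _).trans ?_
  exact (congrArg₂ (· ≫ ·) (totalOrderPi_map_inv_ofHom _ _) (totalOrderPi_map_ofHom _ _)).trans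
    (Equiv.ext fun _ => congrArg (show Fin n.card ≃ Fin k.card from r)
      ((Equiv.symm_apply_eq (Equiv.ofBijective _ _)).2 rfl))

/-- The total order functor is an equivalence from the fundamental groupoid of quasibijections
to the symmetric groups groupoid. -/
def totalOrderEquivalence : PiQ P ≌ SymGrpd :=
  .mk (totalOrderPi P) (ofSymGrpd P) (toTopNatIso P)
    (NatIso.ofComponents (fun k => Iso.refl k) (fun {k l} r => by
      refine (Category.comp_id _).trans (Eq.trans ?_ (Category.id_comp _).symm)
      exact totalOrderPi_map_ofSymGrpd P r))

theorem totalOrderPi_isEquivalence : (totalOrderPi P).IsEquivalence :=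
  (totalOrderEquivalence P).isEquivalence_functor

end ThreeLevels

end

section

namespace FinFibers

theorem ext_emb {n k : ℕ} {f : Fin n → Fin k} {m : Fin k → ℕ} (F F' : FinFibers f m) :
    F = F' := by
  have h : F.emb = F'.emb := by
    funext i
    refine (StrictMono.range_inj (F.strictMono i) (F'.strictMono i)).1 ?_
    ext t
    exact (F.mem_range i t).trans (F'.mem_range i t).symm
  cases F
  cases F'
  cases h
  rfl

instance {n k : ℕ} {f : Fin n → Fin k} {m : Fin k → ℕ} : Subsingleton (FinFibers f m) :=
  ⟨ext_emb⟩

/-- The decomposition of the source of a map into its fibres. -/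
def sigmaEquiv {n k : ℕ} {f : Fin n → Fin k} {m : Fin k → ℕ} (F : FinFibers f m) :
    (Σ i, Fin (m i)) ≃ Fin n :=
  Equiv.ofBijective (fun x => F.emb x.1 x.2) ⟨by
    rintro ⟨i, a⟩ ⟨j, b⟩ h
    obtain rfl : i = j := by rw [← F.map_emb i a, ← F.map_emb j b]; exact congrArg f h
    obtain rfl : a = b := (F.strictMono i).injective h
    rfl, fun t => by
    obtain ⟨a, ha⟩ := (F.mem_range (f t) t).2 rfl
    exact ⟨⟨f t, a⟩, ha⟩⟩

/-- Bijections of the bases and of the fibres induce a bijection of the total sets. -/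
def glue {n' k' n k : ℕ} {f' : Fin n' → Fin k'} {m' : Fin k' → ℕ} (F' : FinFibers f' m')
    {f : Fin n → Fin k} {m : Fin k → ℕ} (F : FinFibers f m) (r : Fin k' ≃ Fin k)
    (s : ∀ j, Fin (m' j) ≃ Fin (m (r j))) : Fin n' ≃ Fin n :=
  F'.sigmaEquiv.symm.trans ((Equiv.sigmaCongr r s).trans F.sigmaEquiv)

theorem glue_emb {n' k' n k : ℕ} {f' : Fin n' → Fin k'} {m' : Fin k' → ℕ}
    (F' : FinFibers f' m') {f : Fin n → Fin k} {m : Fin k → ℕ} (F : FinFibers f m)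
    (r : Fin k' ≃ Fin k) (s : ∀ j, Fin (m' j) ≃ Fin (m (r j))) (j : Fin k') (a : Fin (m' j)) :
    F'.glue F r s (F'.emb j a) = F.emb (r j) (s j a) := by
  have h : F'.sigmaEquiv.symm (F'.emb j a) = ⟨j, a⟩ := by
    rw [Equiv.symm_apply_eq]
    rfl
  simp only [glue, Equiv.trans_apply, h]
  rfl

theorem map_glue {n' k' n k : ℕ} {f' : Fin n' → Fin k'} {m' : Fin k' → ℕ}
    (F' : FinFibers f' m') {f : Fin n → Fin k} {m : Fin k → ℕ} (F : FinFibers f m)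
    (r : Fin k' ≃ Fin k) (s : ∀ j, Fin (m' j) ≃ Fin (m (r j))) (t : Fin n') :
    f (F'.glue F r s t) = r (f' t) := by
  obtain ⟨a, ha⟩ := (F'.mem_range (f' t) t).2 rfl
  rw [← ha, glue_emb, F.map_emb, F'.map_emb]

/-- The bijections of the fibres given by bijections of the sources and targets. -/
def resEquiv {n' k' n k : ℕ} {f' : Fin n' → Fin k'} {m' : Fin k' → ℕ} (F' : FinFibers f' m')
    {f : Fin n → Fin k} {m : Fin k → ℕ} (F : FinFibers f m) (p : Fin n' ≃ Fin n)
    (r : Fin k' ≃ Fin k) (h : ∀ t, f (p t) = r (f' t)) (j : Fin k') :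
    Fin (m' j) ≃ Fin (m (r j)) :=
  Equiv.ofBijective (F'.res F p r h j) (F'.res_bijective F p r h j p.bijective r.injective)

theorem emb_resEquiv {n' k' n k : ℕ} {f' : Fin n' → Fin k'} {m' : Fin k' → ℕ}
    (F' : FinFibers f' m') {f : Fin n → Fin k} {m : Fin k → ℕ} (F : FinFibers f m)
    (p : Fin n' ≃ Fin n) (r : Fin k' ≃ Fin k) (h : ∀ t, f (p t) = r (f' t)) (j : Fin k')
    (a : Fin (m' j)) : F.emb (r j) (F'.resEquiv F p r h j a) = p (F'.emb j a) :=
  F'.emb_res F p r h j a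

theorem eq_resEquiv {n' k' n k : ℕ} {f' : Fin n' → Fin k'} {m' : Fin k' → ℕ}
    (F' : FinFibers f' m') {f : Fin n → Fin k} {m : Fin k → ℕ} (F : FinFibers f m)
    (p : Fin n' ≃ Fin n) (r : Fin k' ≃ Fin k) (h : ∀ t, f (p t) = r (f' t)) (j : Fin k')
    (e : Fin (m' j) ≃ Fin (m (r j))) (he : ∀ a, F.emb (r j) (e a) = p (F'.emb j a)) :
    e = F'.resEquiv F p r h j :=
  Equiv.ext fun a => (F.strictMono (r j)).injective (by rw [he, emb_resEquiv])

theorem exists_of_card {n k : ℕ} (f : Fin n → Fin k) (m : Fin k → ℕ)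
    (h : ∀ i, (Finset.univ.filter fun t => f t = i).card = m i) : Nonempty (FinFibers f m) :=
  ⟨⟨fun i => (Finset.univ.filter fun t => f t = i).orderEmbOfFin (h i),
    fun i => OrderEmbedding.strictMono _, fun i t => by
      have := Set.ext_iff.1
        (Finset.range_orderEmbOfFin (Finset.univ.filter (fun t => f t = i)) (h i)) t
      rw [Set.mem_range] at this
      rw [this]
      simp⟩⟩

theorem card_eq {n k : ℕ} {f : Fin n → Fin k} {m : Fin k → ℕ} (F : FinFibers f m) (i : Fin k) :
    (Finset.univ.filter fun t => f t = i).card = m i := by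
  have h : (Finset.univ.filter fun t => f t = i) =
      Finset.univ.map ⟨F.emb i, (F.strictMono i).injective⟩ := by
    ext t
    simp [← F.mem_range i t]
  rw [h]
  simp

/-- Every map can be made monotone by a permutation of the source, with the same fibres. -/
theorem exists_monotone {n k : ℕ} {f : Fin n → Fin k} {m : Fin k → ℕ} (F : FinFibers f m) :
    ∃ f' : Fin n → Fin k, Monotone f' ∧ Nonempty (FinFibers f' m) := by
  refine ⟨f ∘ Tuple.sort f, Tuple.monotone_sort f, exists_of_card _ _ fun i => ?_⟩
  rw [← F.card_eq i]
  refine Finset.card_bij (fun t _ => Tuple.sort f t) (by simp) (by simp) fun t ht => ?_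
  exact ⟨(Tuple.sort f).symm t, by simpa using ht, by simp⟩

/-- Fibres after a bijection of the target. -/
def compEquiv {n k k' : ℕ} {f : Fin n → Fin k} {m : Fin k → ℕ} (F : FinFibers f m)
    (r : Fin k' ≃ Fin k) : FinFibers (fun t => r.symm (f t)) fun j => m (r j) where
  emb j := F.emb (r j)
  strictMono j := F.strictMono (r j)
  mem_range j t := by rw [F.mem_range, Equiv.symm_apply_eq]

end FinFibers

namespace SymmetricOperad

variable {V : Type u} [Category.{v} V] [MonoidalCategory V] [SymmetricCategory V]
  (B : SymmetricOperad V)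

/-- The value of a symmetric operad on a finite ordinal. -/
abbrev obj (n : ℕ) : V := B.coll.obj (op ⟨n⟩)

/-- The action of a bijection on a symmetric operad. -/
def act {n k : ℕ} (e : Fin n ≃ Fin k) : B.obj k ⟶ B.obj n :=
  B.coll.map (Quiver.Hom.op (X := SymGrpd.mk n) (Y := ⟨k⟩) e)

theorem act_trans {n k l : ℕ} (e : Fin n ≃ Fin k) (e' : Fin k ≃ Fin l) :
    B.act (e.trans e') = B.act e' ≫ B.act e :=
  B.coll.map_comp (Quiver.Hom.op (X := SymGrpd.mk k) (Y := ⟨l⟩) e')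
    (Quiver.Hom.op (X := SymGrpd.mk n) (Y := ⟨k⟩) e)

@[simp]
theorem act_refl (n : ℕ) : B.act (.refl (Fin n)) = 𝟙 _ := B.coll.map_id _

instance {n k : ℕ} (e : Fin n ≃ Fin k) : IsIso (B.act e) :=
  ⟨B.act e.symm, by rw [← act_trans]; simp, by rw [← act_trans]; simp⟩

/-- May's equivariance conditions, combined. -/
theorem equivariance {n k n' k' : ℕ} {f : Fin n → Fin k} {f' : Fin n' → Fin k'}
    (hf : Monotone f) (hf' : Monotone f') (p : Fin n' ≃ Fin n) (r : Fin k' ≃ Fin k)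
    (h : ∀ t, f (p t) = r (f' t)) {m : Fin k → ℕ} {m' : Fin k' → ℕ} (F : FinFibers f m)
    (F' : FinFibers f' m') :
    B.mul f hf F ≫ B.act p = (B.act r ⊗ₘ
      ((permTens (fun i => B.obj (m i)) r r.bijective).hom ≫
        tensMap fun j => B.act (F'.resEquiv F p r h j))) ≫ B.mul f' hf' F' := by
  obtain rfl : n' = n := by simpa using Fintype.card_congr p
  obtain rfl : k' = k := by simpa using Fintype.card_congr r
  obtain rfl : m' = fun j => m (r j) :=
    funext fun j => by simpa using Fintype.card_congr (F'.resEquiv F p r h j)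
  let p₀ := F'.glue F r fun j => .refl _
  have hp : B.act p = B.act p₀ ≫ B.act (p.trans p₀.symm) := by
    rw [← act_trans, Equiv.trans_assoc, Equiv.symm_trans_self, Equiv.trans_refl]
  have e1 := B.equivariance₁ f f' hf hf' r p₀ F F' fun j a => F'.glue_emb F r _ j a
  have e2 := B.equivariance₂ f' hf' F' (fun j => F'.resEquiv F p r h j) (p.trans p₀.symm)
    fun j a => by
      rw [Equiv.trans_apply, Equiv.symm_apply_eq]
      exact (F'.emb_resEquiv F p r h j a).symm.trans
        (F'.glue_emb F r (fun j => .refl _) j (F'.resEquiv F p r h j a)).symm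
  change _ ≫ B.act _ = (B.act _ ⊗ₘ _) ≫ _ at e1
  change _ ≫ B.act _ = (_ ◁ tensMap fun j => B.act _) ≫ _ at e2
  rw [hp, reassoc_of% e1, e2, ← id_tensorHom, tensorHom_comp_tensorHom_assoc,
    Category.comp_id]

/-- The monotone map with the same fibres as a given map. -/
def sorted {n k : ℕ} {f : Fin n → Fin k} {m : Fin k → ℕ} (F : FinFibers f m) : Fin n → Fin k :=
  F.exists_monotone.choose

theorem sorted_monotone {n k : ℕ} {f : Fin n → Fin k} {m : Fin k → ℕ} (F : FinFibers f m) :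
    Monotone (sorted F) :=
  F.exists_monotone.choose_spec.1

/-- The fibres of the monotone map with the same fibres as a given map. -/
def sortedFibers {n k : ℕ} {f : Fin n → Fin k} {m : Fin k → ℕ} (F : FinFibers f m) :
    FinFibers (sorted F) m :=
  F.exists_monotone.choose_spec.2.some

/-- The permutation which makes a map monotone and is monotone on the fibres. -/
def sorting {n k : ℕ} {f : Fin n → Fin k} {m : Fin k → ℕ} (F : FinFibers f m) : Fin n ≃ Fin n :=
  F.glue (sortedFibers F) (.refl _) fun _ => .refl _

theorem sorting_emb {n k : ℕ} {f : Fin n → Fin k} {m : Fin k → ℕ} (F : FinFibers f m) (i : Fin k)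
    (a : Fin (m i)) : sorting F (F.emb i a) = (sortedFibers F).emb i a :=
  F.glue_emb _ _ _ i a

theorem sorted_sorting {n k : ℕ} {f : Fin n → Fin k} {m : Fin k → ℕ} (F : FinFibers f m)
    (t : Fin n) : sorted F (sorting F t) = f t :=
  F.map_glue _ _ _ t

/-- The multiplication of a symmetric operad for an arbitrary map of finite ordinals. -/
def mulAll {n k : ℕ} {f : Fin n → Fin k} {m : Fin k → ℕ} (F : FinFibers f m) :
    B.obj k ⊗ tens (fun i => B.obj (m i)) ⟶ B.obj n :=
  B.mul (sorted F) (sorted_monotone F) (sortedFibers F) ≫ B.act (sorting F)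

theorem mulAll_equivariance {n k n' k' : ℕ} {f : Fin n → Fin k} {f' : Fin n' → Fin k'}
    (p : Fin n' ≃ Fin n) (r : Fin k' ≃ Fin k)
    (h : ∀ t, f (p t) = r (f' t)) {m : Fin k → ℕ} {m' : Fin k' → ℕ} (F : FinFibers f m)
    (F' : FinFibers f' m') :
    B.mulAll F ≫ B.act p = (B.act r ⊗ₘ
      ((permTens (fun i => B.obj (m i)) r r.bijective).hom ≫
        tensMap fun j => B.act (F'.resEquiv F p r h j))) ≫ B.mulAll F' := by
  have hq : ∀ t, sorted F (((sorting F').symm.trans (p.trans (sorting F))) t) =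
      r (sorted F' t) := by
    intro t
    obtain ⟨t, rfl⟩ := (sorting F').surjective t
    simp [sorted_sorting, h]
  have hr : ∀ j, F'.resEquiv F p r h j = (sortedFibers F').resEquiv (sortedFibers F)
      ((sorting F').symm.trans (p.trans (sorting F))) r hq j := by
    refine fun j => FinFibers.eq_resEquiv _ _ _ _ _ _ _ fun a => ?_
    rw [← sorting_emb, FinFibers.emb_resEquiv, ← sorting_emb]
    simp
  have e := B.equivariance (sorted_monotone F) (sorted_monotone F') _ r hq (sortedFibers F)
    (sortedFibers F')
  simp only [mulAll, hr, Category.assoc]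
  rw [← reassoc_of% e, ← act_trans, ← act_trans, ← Equiv.trans_assoc, Equiv.self_trans_symm,
    Equiv.refl_trans]

theorem mulAll_eq_mul {n k : ℕ} {f : Fin n → Fin k} (hf : Monotone f) {m : Fin k → ℕ}
    (F : FinFibers f m) : B.mulAll F = B.mul f hf F := by
  have e := B.equivariance (sorted_monotone F) hf (sorting F) (.refl _) (sorted_sorting F)
    (sortedFibers F) F
  have hr : ∀ j, F.resEquiv (sortedFibers F) (sorting F) (.refl _) (sorted_sorting F) j =
      .refl _ :=
    fun j => (FinFibers.eq_resEquiv _ _ _ _ _ _ _ fun a => (sorting_emb F j a).symm).symm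
  have hp : (permTens (fun i => B.obj (m i)) (Equiv.refl (Fin k)) (Equiv.bijective _)).hom =
    𝟙 _ := permTens_id _ _
  have ht : (tensMap fun j => B.act (F.resEquiv (sortedFibers F) (sorting F) (.refl _)
      (sorted_sorting F) j)) = 𝟙 _ :=
    (congrArg tensMap (funext fun j => (congrArg B.act (hr j)).trans (B.act_refl _))).trans
      (tensMap_id _)
  rw [mulAll, e, ht, hp]
  rw [B.act_refl]
  exact (congrArg (· ≫ B.mul f hf F) ((congrArg (_ ⊗ₘ ·) (Category.id_comp _)).trans
    (id_tensorHom_id _ _))).trans (Category.id_comp _)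

theorem insertUnits_mulAll {n k : ℕ} (e : Fin n ≃ Fin k) (F : FinFibers e fun _ => 1) :
    insertUnits B.unit (B.obj k) k ≫ B.mulAll F = B.act e := by
  have h1 := B.mulAll_equivariance e (.refl _) (f := id) (f' := e) (fun _ => rfl)
    (FinFibers.ofBijective Function.bijective_id) F
  have hr : ∀ j, F.resEquiv (FinFibers.ofBijective Function.bijective_id) e (.refl _)
      (fun _ => rfl) j = .refl _ :=
    fun j => Equiv.ext fun a => Subsingleton.elim (α := Fin 1) _ _
  have hp : (permTens (fun _ => B.obj 1) (Equiv.refl (Fin k)) (Equiv.bijective _)).hom =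
    𝟙 _ := permTens_id _ _
  have ht : (tensMap fun j => B.act (F.resEquiv (FinFibers.ofBijective Function.bijective_id) e
      (.refl _) (fun _ => rfl) j)) = 𝟙 _ :=
    (congrArg tensMap (funext fun j => (congrArg B.act (hr j)).trans (B.act_refl _))).trans
      (tensMap_id _)
  rw [ht, hp, B.act_refl] at h1
  have h2 := h1.trans ((congrArg (· ≫ B.mulAll F) ((congrArg (_ ⊗ₘ ·) (Category.id_comp _)).trans
    (id_tensorHom_id _ _))).trans (Category.id_comp _))
  rw [← h2, mulAll_eq_mul B monotone_id, reassoc_of% B.mul_id k]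

end SymmetricOperad

end

section

theorem FinFibers.exists_comp_equiv {n n' k : ℕ} {f : Fin n → Fin k} {m : Fin k → ℕ}
    (F : FinFibers f m) (e : Fin n' ≃ Fin n) (f' : Fin n' → Fin k) (h : ∀ t, f (e t) = f' t) :
    Nonempty (FinFibers f' m) := by
  refine FinFibers.exists_of_card _ _ fun i => ?_
  rw [← F.card_eq i]
  refine Finset.card_bij (fun t _ => e t) (by simp [h]) (by simp) fun t ht => ?_
  exact ⟨e.symm t, by simpa [← h] using ht, by simp⟩

/-- The bijections of the fibres given by a bijection of the sources. -/
def FinFibers.fibEquiv {n' n k : ℕ} {f' : Fin n' → Fin k} {m' : Fin k → ℕ} (F' : FinFibers f' m')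
    {f : Fin n → Fin k} {m : Fin k → ℕ} (F : FinFibers f m) (p : Fin n' ≃ Fin n)
    (h : ∀ t, f (p t) = f' t) (j : Fin k) : Fin (m' j) ≃ Fin (m j) :=
  F'.resEquiv F p (.refl _) h j

theorem FinFibers.emb_fibEquiv {n' n k : ℕ} {f' : Fin n' → Fin k} {m' : Fin k → ℕ}
    (F' : FinFibers f' m') {f : Fin n → Fin k} {m : Fin k → ℕ} (F : FinFibers f m)
    (p : Fin n' ≃ Fin n) (h : ∀ t, f (p t) = f' t) (j : Fin k) (a : Fin (m' j)) :
    F.emb j (F'.fibEquiv F p h j a) = p (F'.emb j a) :=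
  F'.emb_res F p id h j a

theorem associator_hom_whiskerLeft_tensorHom {V : Type u} [Category.{v} V] [MonoidalCategory V]
    (A : V) {X X' Y Y' : V} (x : X ⟶ X') (y : Y ⟶ Y') :
    (α_ A X Y).hom ≫ A ◁ (x ⊗ₘ y) = (A ◁ x) ▷ Y ≫ (A ⊗ X') ◁ y ≫ (α_ A X' Y').hom := by
  simp [MonoidalCategory.tensorHom_def]

namespace SymmetricOperad

variable {V : Type u} [Category.{v} V] [MonoidalCategory V] [SymmetricCategory V]
  (B : SymmetricOperad V)

theorem mulAll_equivariance_left {n k n' : ℕ} {f : Fin n → Fin k} {f' : Fin n' → Fin k}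
    (p : Fin n' ≃ Fin n) (h : ∀ t, f (p t) = f' t) {m m' : Fin k → ℕ}
    (F : FinFibers f m) (F' : FinFibers f' m') :
    B.mulAll F ≫ B.act p = (B.obj k ◁ tensMap fun j => B.act (F'.fibEquiv F p h j)) ≫
      B.mulAll F' := by
  have hp : (permTens (fun i => B.obj (m i)) (Equiv.refl (Fin k)) (Equiv.bijective _)).hom =
    𝟙 _ := permTens_id _ _
  rw [B.mulAll_equivariance p (.refl _) h F F', hp, B.act_refl]
  refine congrArg (· ≫ _) ?_
  refine (congrArg (_ ⊗ₘ ·) (Category.id_comp _)).trans ?_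
  exact id_tensorHom _ _

section Squares

variable {n l k n' l' : ℕ} {f : Fin n → Fin l} {g : Fin l → Fin k} {f' : Fin n' → Fin l'}
  {g' : Fin l' → Fin k} {q : Fin l → ℕ} {m r : Fin k → ℕ} {q' : Fin l' → ℕ} {m' r' : Fin k → ℕ}
  (F : FinFibers f q) (G : FinFibers g m) (H : FinFibers (fun t => g (f t)) r)
  (F' : FinFibers f' q') (G' : FinFibers g' m') (H' : FinFibers (fun t => g' (f' t)) r')
  (p : Fin n' ≃ Fin n) (s : Fin l' ≃ Fin l) (hf : ∀ t, f (p t) = s (f' t))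
  (hg : ∀ t, g (s t) = g' t)

theorem res_square (i : Fin k) (t : Fin (r' i)) :
    H.res G f id (fun _ => rfl) i
        (H'.fibEquiv H p (fun t => (congrArg g (hf t)).trans (hg _)) i t) =
      G'.fibEquiv G s hg i (H'.res G' f' id (fun _ => rfl) i t) := by
  apply (G.strictMono i).injective
  refine (H.emb_res G f id (fun _ => rfl) i _).trans ?_
  refine Eq.trans ?_ (G'.emb_fibEquiv G s hg i _).symm
  refine (congrArg f (H'.emb_fibEquiv H p _ i t)).trans ?_
  exact (hf _).trans (congrArg s (H'.emb_res G' f' id (fun _ => rfl) i t).symm)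

theorem shuffle_act (X : Fin k → V) :
    tens X ◁ ((permTens (fun i => B.obj (q i)) s s.bijective).hom ≫
        tensMap fun t => B.act (F'.resEquiv F p s hf t)) ≫
        (shuffle G' X fun t => B.obj (q' t)).hom =
      (shuffle G X fun i => B.obj (q i)).hom ≫ tensMap fun i => X i ◁
        ((permTens (fun j => B.obj (q (G.emb i j))) (G'.fibEquiv G s hg i)
          (Equiv.bijective _)).hom ≫
          tensMap fun j => B.act ((F'.resFibers G' H' i).resEquiv (F.resFibers G H i)
            (H'.fibEquiv H p (fun t => (congrArg g (hf t)).trans (hg _)) i)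
            (G'.fibEquiv G s hg i) (res_square G H G' H' p s hf hg i) j)) := by
  let ψ : ∀ i t, s t = i → (B.obj (q i) ⟶ B.obj (q' t)) :=
    fun i t h => B.act ((F'.resEquiv F p s hf t).trans (finCongr (congrArg q h)))
  have hψ : ∀ t, ψ (s t) t rfl = B.act (F'.resEquiv F p s hf t) := fun t => rfl
  have hψ' : ∀ i t (h : s t = i) (e : Fin (q' t) ≃ Fin (q i)),
      (∀ a, F.emb i (e a) = p (F'.emb t a)) → ψ i t h = B.act e := by
    rintro i t rfl e he
    exact (hψ t).trans (congrArg B.act (FinFibers.eq_resEquiv F' F p s hf t e he).symm)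
  refine (shuffle_permTens G G' s s.bijective hg X ψ).trans ?_
  have e : ∀ i j, ψ (G.emb i (G'.res G s id hg i j)) (G'.emb i j)
      (G'.emb_res G s id hg i j).symm = B.act ((F'.resFibers G' H' i).resEquiv
        (F.resFibers G H i)
        (H'.fibEquiv H p (fun t => (congrArg g (hf t)).trans (hg _)) i)
        (G'.fibEquiv G s hg i) (res_square G H G' H' p s hf hg i) j) := by
    intro i j
    refine hψ' _ _ (G'.emb_res G s id hg i j).symm _ fun a => ?_
    refine (F.emb_resFibers G H i _ _).symm.trans ?_
    refine (congrArg (H.emb i) ((F'.resFibers G' H' i).emb_resEquiv (F.resFibers G H i) _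
      (G'.fibEquiv G s hg i) (res_square G H G' H' p s hf hg i) j a)).trans ?_
    refine (H'.emb_fibEquiv H p _ i _).trans ?_
    exact congrArg p (F'.emb_resFibers G' H' i j a)
  refine congrArg (fun x => (shuffle G X fun i => B.obj (q i)).hom ≫ tensMap x)
    (funext fun i => ?_)
  exact congrArg (fun x => X i ◁ ((permTens (fun j => B.obj (q (G.emb i j)))
    (G'.res G s id hg i) (G'.res_bijective G s id hg i s.bijective Function.injective_id)).hom ≫
      tensMap x)) (funext (e i))

end Squares

/-- Associativity of the multiplications for arbitrary maps of finite ordinals. -/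
theorem mulAll_assoc {n l k : ℕ} {f : Fin n → Fin l} {g : Fin l → Fin k} {q : Fin l → ℕ}
    {m r : Fin k → ℕ} (F : FinFibers f q) (G : FinFibers g m)
    (H : FinFibers (fun t => g (f t)) r) :
    (α_ (B.obj k) (tens fun i => B.obj (m i)) (tens fun s => B.obj (q s))).hom ≫
        B.obj k ◁ ((shuffle G (fun i => B.obj (m i)) (fun s => B.obj (q s))).hom ≫
          tensMap (fun i => B.mulAll (F.resFibers G H i))) ≫ B.mulAll H =
      B.mulAll G ▷ (tens fun s => B.obj (q s)) ≫ B.mulAll F := by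
  obtain ⟨g', hg', ⟨G'⟩⟩ := G.exists_monotone
  let s : Fin l ≃ Fin l := G'.glue G (.refl _) fun _ => .refl _
  have hg : ∀ t, g (s t) = g' t := G'.map_glue G _ _
  obtain ⟨f', hf', ⟨F'⟩⟩ := (F.compEquiv s).exists_monotone
  let p : Fin n ≃ Fin n := F'.glue (F.compEquiv s) (.refl _) fun _ => .refl _
  have hf : ∀ t, f (p t) = s (f' t) := fun t =>
    (s.symm_apply_eq.1 (F'.map_glue (F.compEquiv s) _ _ t))
  have hgf : ∀ t, g (f (p t)) = g' (f' t) := fun t => (congrArg g (hf t)).trans (hg _)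
  obtain ⟨H'⟩ := H.exists_comp_equiv p _ hgf
  rw [← cancel_mono (B.act p)]
  have eA := B.assoc f' g' hf' hg' F' G' H'
  have eF := B.mulAll_equivariance p s hf F F'
  have eG := B.mulAll_equivariance_left s hg G G'
  have eH := B.mulAll_equivariance_left p hgf H H'
  have eS := B.shuffle_act F G H F' G' H' p s hf hg (fun i => B.obj (m i))
  have eR := fun i => B.mulAll_equivariance (H'.fibEquiv H p hgf i)
    (G'.fibEquiv G s hg i) (res_square G H G' H' p s hf hg i) (F.resFibers G H i)
    (F'.resFibers G' H' i)
  rw [mulAll_eq_mul B hg'] at eG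
  rw [mulAll_eq_mul B hf'] at eF
  rw [mulAll_eq_mul B (hg'.comp hf')] at eH
  have eR' : ∀ i, B.mulAll (F.resFibers G H i) ≫ B.act (H'.fibEquiv H p hgf i) =
      (B.obj (m i) ◁ ((permTens (fun j => B.obj (q (G.emb i j))) (G'.fibEquiv G s hg i)
          (Equiv.bijective _)).hom ≫
          tensMap fun j => B.act ((F'.resFibers G' H' i).resEquiv (F.resFibers G H i)
            (H'.fibEquiv H p hgf i)
            (G'.fibEquiv G s hg i) (res_square G H G' H' p s hf hg i) j))) ≫
        B.act (G'.fibEquiv G s hg i) ▷ (tens fun j => B.obj (q (s (G'.emb i j)))) ≫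
        B.mul _ (H'.res_monotone G' f' id (fun _ => rfl) i hf') (F'.resFibers G' H' i) := by
    intro i
    refine (eR i).trans ?_
    rw [mulAll_eq_mul B (H'.res_monotone G' f' id (fun _ => rfl) i hf'), ← Category.assoc]
    exact congrArg (· ≫ _) (MonoidalCategory.tensorHom_def' _ _)
  clear_value s p
  have eX : (shuffle G (fun i => B.obj (m i)) (fun s => B.obj (q s))).hom ≫
      tensMap (fun i => B.mulAll (F.resFibers G H i) ≫
        B.act (H'.fibEquiv H p hgf i)) =
      ((tensMap fun i => B.act (G'.fibEquiv G s hg i)) ⊗ₘ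
        ((permTens (fun i => B.obj (q i)) s s.bijective).hom ≫
        tensMap fun t => B.act (F'.resEquiv F p s hf t))) ≫
      (shuffle G' (fun i => B.obj (m i)) (fun t => B.obj (q (s t)))).hom ≫
      tensMap fun i =>
        B.mul _ (H'.res_monotone G' f' id (fun _ => rfl) i hf') (F'.resFibers G' H' i) := by
    have h1 := shuffle_naturality G' (fun i => B.act (G'.fibEquiv G s hg i))
      (fun t => 𝟙 (B.obj (q (s t))))
    rw [tensMap_id, tensorHom_id] at h1
    rw [congrArg tensMap (funext eR'), ← tensMap_tensMap, ← tensMap_tensMap]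
    rw [← reassoc_of% eS, MonoidalCategory.tensorHom_def', Category.assoc]
    refine congrArg (_ ≫ ·) ?_
    rw [reassoc_of% h1]
    refine congrArg (_ ≫ ·) (congrArg (· ≫ _) (congrArg tensMap (funext fun i => ?_)))
    rw [tensMap_id, tensorHom_id]
  simp only [Category.assoc]
  rw [eF, eH, MonoidalCategory.tensorHom_def', Category.assoc,
    ← whisker_exchange_assoc, ← comp_whiskerRight_assoc, eG, comp_whiskerRight_assoc, ← eA,
    whisker_exchange_assoc]
  rw [← whiskerLeft_comp_assoc, Category.assoc, tensMap_tensMap, eX]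
  rw [whiskerLeft_comp_assoc, reassoc_of% associator_hom_whiskerLeft_tensorHom]
  rfl

end SymmetricOperad

end

section

open NOrd

namespace SymmetricOperad

variable {V : Type u} [Category.{v} V] [MonoidalCategory V] [SymmetricCategory V]
  (P : Type) [LinearOrder P] (B : SymmetricOperad V)

theorem tensMap_act_symm_mul {n n' k : ℕ} {f : Fin n → Fin k} {f' : Fin n' → Fin k}
    (hf : Monotone f) (p : Fin n' ≃ Fin n) (h : ∀ t, f (p t) = f' t) {m m' : Fin k → ℕ}
    (F : FinFibers f m) (F' : FinFibers f' m') :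
    (B.obj k ◁ tensMap fun j => B.act (F'.fibEquiv F p h j).symm) ≫ B.mul f hf F ≫ B.act p =
      B.mulAll F' := by
  rw [← mulAll_eq_mul, mulAll_equivariance_left B p h F F', ← whiskerLeft_comp_assoc,
    tensMap_tensMap]
  have e : ∀ j, B.act (F'.fibEquiv F p h j).symm ≫ B.act (F'.fibEquiv F p h j) = 𝟙 _ :=
    fun j => by rw [← act_trans, Equiv.self_trans_symm, act_refl]
  rw [congrArg tensMap (funext e), tensMap_id, whiskerLeft_id, Category.id_comp]

variable {P}

theorem map_totalOrderPi_ofHom {T S : NOrd P} (f : T ⟶ S) (hf : quasibijection P f) :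
    ((totalOrderPi P).op ⋙ B.coll).map (PiQ.ofHom f hf).op =
      B.act (Equiv.ofBijective f.toFun hf) :=
  congrArg (fun e => B.coll.map (Quiver.Hom.op e)) (totalOrderPi_map_ofHom f hf)

theorem map_totalOrderPi_inv_ofHom {T S : NOrd P} (f : T ⟶ S) (hf : quasibijection P f) :
    ((totalOrderPi P).op ⋙ B.coll).map (Groupoid.inv (PiQ.ofHom f hf)).op =
      B.act (Equiv.ofBijective f.toFun hf).symm :=
  congrArg (fun e => B.coll.map (Quiver.Hom.op e)) (totalOrderPi_map_inv_ofHom f hf)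

variable (P)

/-- A symmetric operad regarded as a `Q_n`-operad. -/
def toQOperad : QOperad P V where
  coll := (totalOrderPi P).op ⋙ B.coll
  str :=
    { unit := B.unit
      mul := fun {_ _} f hf {_} F => B.mul f.toFun hf F.toFinFibers
      assoc := fun {_ _ _} f g hf hg _ {_ _ _} F G H _ =>
        B.assoc f.toFun g.toFun hf hg F.toFinFibers G.toFinFibers H.toFinFibers
      mul_id := fun T _ => B.mul_id T.card
      mul_toPt := fun T _ => B.mul_toPoint T.card }
  equivariance₁ := by
    intro T' S' T S f' f hf' hf p r hp hr comm X' X F' F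
    refine (congrArg (_ ≫ ·) (B.map_totalOrderPi_ofHom p hp)).trans ?_
    refine (B.equivariance hf hf' (Equiv.ofBijective _ hp) (Equiv.ofBijective _ hr)
      (fun t => congrFun (congrArg Hom.toFun comm) t) F.toFinFibers F'.toFinFibers).trans ?_
    refine congrArg (· ≫ _) (congrArg₂ (· ⊗ₘ ·) (B.map_totalOrderPi_ofHom r hr).symm ?_)
    exact congrArg (_ ≫ ·) (congrArg tensMap
      (funext fun j => (B.map_totalOrderPi_ofHom
        (F'.res F p r.toFun (fun t => congrFun (congrArg Hom.toFun comm) t) j)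
        (F'.res_quasibijection F p r.toFun _ j hp hr.1)).symm))
  equivariance₂ := by
    intro T T' T'' S s' s h' h hs' hs hh' hh comm X X' X'' F F' F''
    have key : ∀ {U : NOrd P} (t : T ⟶ U) (ht : quasibijection P t) (g : U ⟶ S)
        (hg : orderPreserving P g) {Y : Fin S.card → NOrd P} (G : Fibers g Y)
        (c : ∀ x, g.toFun (t.toFun x) = id ((s ≫ h).toFun x)),
        (B.obj S.card ◁ tensMap (fun i => ((totalOrderPi P).op ⋙ B.coll).map
          (Groupoid.inv (PiQ.ofHom (F.res G t id c i)
            (F.res_quasibijection G t id c i ht Function.injective_id))).op)) ≫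
          B.mul g.toFun hg G.toFinFibers ≫ ((totalOrderPi P).op ⋙ B.coll).map (PiQ.ofHom t ht).op =
        B.mulAll F.toFinFibers := by
      intro U t ht g hg Y G c
      refine Eq.trans ?_ (B.tensMap_act_symm_mul hg (Equiv.ofBijective _ ht) c G.toFinFibers
        F.toFinFibers)
      exact congrArg₂ (· ≫ ·) (congrArg (_ ◁ ·) (congrArg tensMap
        (funext fun j => B.map_totalOrderPi_inv_ofHom _ _)))
        (congrArg (_ ≫ ·) (B.map_totalOrderPi_ofHom _ _))
    exact (key s' hs' h' hh' F' _).trans (key s hs h hh F'' _).symm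

end SymmetricOperad

variable (P : Type) [LinearOrder P] (V : Type u) [Category.{v} V] [MonoidalCategory V]
  [SymmetricCategory V]

/-- Symmetric operads regarded as `Q_n`-operads. -/
def symmetricToQOperad : SymmetricOperad V ⥤ QOperad P V where
  obj B := B.toQOperad P
  map φ :=
    { hom := Functor.whiskerLeft (totalOrderPi P).op φ.hom
      unit_hom := φ.unit_hom
      mul_hom := fun {_ _} f hf {_} F => φ.mul_hom f.toFun hf F.toFinFibers }

variable {P V}

/-- The fibres of a monotone map, as ordinals with a single level. -/
def FinFibers.single (p : P) {n k : ℕ} {f : Fin n → Fin k} (hf : Monotone f) {m : Fin k → ℕ}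
    (F : FinFibers f m) : Fibers (singleMono p f hf) (fun i => NOrd.single p (m i)) where
  toFinFibers := F
  lt_iff i _ _ _ := and_congr_right fun _ => ((F.strictMono i).lt_iff_lt).symm

instance [ThreeLevels P] : (symmetricToQOperad P V).Faithful where
  map_injective {B B'} φ ψ h := by
    refine SymmetricOperad.Hom.ext (NatTrans.ext (funext fun k => ?_))
    exact congrArg (fun η : QOperad.Hom (B.toQOperad P) (B'.toQOperad P) =>
      η.hom.app (op (PiQ.ofObj (NOrd.single ThreeLevels.top k.unop.card)))) h

instance [ThreeLevels P] : (symmetricToQOperad P V).Full where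
  map_surjective {B B'} η := by
    have : (totalOrderPi P).IsEquivalence := totalOrderPi_isEquivalence P
    change QOperad.Hom (B.toQOperad P) (B'.toQOperad P) at η
    obtain ⟨φ, hφ⟩ := ((Functor.whiskeringLeft _ _ V).obj (totalOrderPi P).op).map_surjective
      (X := B.coll) (Y := B'.coll) η.hom
    have h : ∀ T : NOrd P, φ.app (op ⟨T.card⟩) = η.hom.app (op (PiQ.ofObj T)) :=
      fun T => congrArg (fun η => η.app (op (PiQ.ofObj T))) hφ
    refine ⟨⟨φ, ?_, ?_⟩, QOperad.Hom.ext hφ⟩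
    · exact (congrArg (_ ≫ ·) (h (pt P))).trans η.unit_hom
    · intro n k f hf m F
      have e := η.mul_hom (singleMono ThreeLevels.top f hf) hf (F.single ThreeLevels.top hf)
      refine (congrArg (_ ≫ ·) (h (NOrd.single ThreeLevels.top n))).trans (e.trans ?_)
      exact congrArg (· ≫ _) (congrArg₂ (· ⊗ₘ ·) (h (NOrd.single ThreeLevels.top k)).symm
        (congrArg tensMap (funext fun i => (h (NOrd.single ThreeLevels.top (m i))).symm)))

theorem insertUnits_comp {Y Z : V} (e : 𝟙_ V ⟶ Y) (g : Y ⟶ Z) (X : V) (k : ℕ) :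
    insertUnits (e ≫ g) X k = insertUnits e X k ≫ X ◁ tensMap fun _ => g := by
  rw [insertUnits, insertUnits, tensMap_comp, Category.assoc, ← whiskerLeft_comp, Category.assoc]

theorem insertUnit_comp {Y Z : V} (e : 𝟙_ V ⟶ Y) (g : Y ⟶ Z) (X : V) :
    insertUnit (e ≫ g) X = insertUnit e X ≫ g ▷ _ := by
  simp [insertUnit, MonoidalCategory.tensorHom_def']

namespace QOperad

variable (A : QOperad P V)

/-- The action of quasibijections on a `Q_n`-operad. -/
abbrev act {T S : NOrd P} (f : T ⟶ S) (hf : quasibijection P f) : A.obj S ⟶ A.obj T :=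
  A.coll.map (PiQ.ofHom f hf).op

theorem act_id (T : NOrd P) (h : quasibijection P (𝟙 T)) : A.act (𝟙 T) h = 𝟙 _ :=
  (congrArg (fun x => A.coll.map (Quiver.Hom.op x)) (PiQ.ofHom_id T h)).trans (A.coll.map_id _)

variable [ThreeLevels P]

open ThreeLevels

theorem mul_toTop {T S : NOrd P} (f : T ⟶ S) (hf : orderPreserving P f)
    {X : Fin S.card → NOrd P} (F : Fibers f X) :
    A.str.mul (singleMono top f.toFun hf) hf (F.toFinFibers.single top hf) ≫
        A.act (toTop T) (quasibijection_toTop T) =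
      (A.act (toTop S) (quasibijection_toTop S) ⊗ₘ
        tensMap fun i => A.act (toTop (X i)) (quasibijection_toTop (X i))) ≫
        A.str.mul f hf F := by
  refine (A.equivariance₁ f (singleMono top f.toFun hf) hf hf (toTop T) (toTop S)
    (quasibijection_toTop T) (quasibijection_toTop S) rfl F
    (F.toFinFibers.single top hf)).trans ?_
  refine congrArg (fun x => (_ ⊗ₘ x) ≫ _) ?_
  refine (congrArg (· ≫ _) (permTens_id _ _)).trans ((Category.id_comp _).trans ?_)
  have e : ∀ i, F.res (F.toFinFibers.single top hf) (toTop T) id (fun _ => rfl) i =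
      toTop (X i) := fun i => NOrd.Hom.ext (funext fun a =>
    (F.strictMono i).injective (F.toFinFibers.emb_res
      (F.toFinFibers.single top hf).toFinFibers (toTop T).toFun id (fun _ => rfl) i a))
  refine congrArg tensMap (funext fun i => ?_)
  have key : ∀ (g : X i ⟶ NOrd.single top (X i).card) (hg : quasibijection P g),
      g = toTop (X i) → A.act g hg = A.act (toTop (X i)) (quasibijection_toTop (X i)) := by
    rintro g hg rfl
    rfl
  exact key _ _ (e i)

theorem map_ofSymGrpd_toTop {n k : ℕ} (r : Fin n ≃ Fin k) :
    ((ofSymGrpd P).op ⋙ A.coll).map (Quiver.Hom.op (X := SymGrpd.mk n) (Y := ⟨k⟩) r) ≫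
      A.act (toTop (NOrd.single low n)) (quasibijection_toTop _) =
      A.act (singleHom (low_lt_top P) r) r.bijective := by
  refine (A.coll.map_comp _ _).symm.trans (congrArg (fun x => A.coll.map (Quiver.Hom.op x)) ?_)
  exact (Category.assoc _ _ _).symm.trans
    ((congrArg (· ≫ _) (Groupoid.comp_inv _)).trans (Category.id_comp _))

theorem mul_single_equivariance {n k n' k' : ℕ} {f : Fin n → Fin k} {f' : Fin n' → Fin k'}
    (hf : Monotone f) (hf' : Monotone f') (p : Fin n' ≃ Fin n) (r : Fin k' ≃ Fin k)
    (h : ∀ t, f (p t) = r (f' t)) {m : Fin k → ℕ} {m' : Fin k' → ℕ} (F : FinFibers f m)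
    (F' : FinFibers f' m') :
    A.str.mul (singleMono top f hf) hf (F.single top hf) ≫
        ((ofSymGrpd P).op ⋙ A.coll).map (Quiver.Hom.op (X := SymGrpd.mk n') (Y := ⟨n⟩) p) =
      (((ofSymGrpd P).op ⋙ A.coll).map (Quiver.Hom.op (X := SymGrpd.mk k') (Y := ⟨k⟩) r) ⊗ₘ
        ((permTens (fun i => A.obj (NOrd.single top (m i))) r r.bijective).hom ≫
          tensMap fun j => ((ofSymGrpd P).op ⋙ A.coll).map
            (Quiver.Hom.op (X := SymGrpd.mk (m' j)) (Y := ⟨m (r j)⟩) (F'.resEquiv F p r h j)))) ≫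
        A.str.mul (singleMono top f' hf') hf' (F'.single top hf') := by
  refine (cancel_mono (A.act (toTop (NOrd.single low n')) (quasibijection_toTop _))).1 ?_
  have e1 := A.equivariance₁ (singleMono low f' hf') (singleMono top f hf) hf' hf
    (singleHom (low_lt_top P) p) (singleHom (low_lt_top P) r) p.bijective r.bijective
    (NOrd.Hom.ext (funext h)) (F'.single low hf') (F.single top hf)
  have e2 := A.mul_toTop (singleMono low f' hf') hf' (F'.single low hf')
  refine (Category.assoc _ _ _).trans ((congrArg (_ ≫ ·) (A.map_ofSymGrpd_toTop p)).trans
    (e1.trans ?_))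
  refine Eq.trans ?_ (Category.assoc _ _ _).symm
  refine Eq.trans ?_ (congrArg (CategoryStruct.comp _) e2.symm)
  refine Eq.trans ?_ (Category.assoc _ _ _)
  refine congrArg (· ≫ _) (Eq.trans ?_ (tensorHom_comp_tensorHom _ _ _ _).symm)
  refine congrArg₂ (· ⊗ₘ ·) (A.map_ofSymGrpd_toTop r).symm
    (Eq.trans ?_ (Category.assoc _ _ _).symm)
  refine congrArg (_ ≫ ·) (Eq.trans ?_ (tensMap_tensMap _ _).symm)
  exact congrArg tensMap (funext fun j => (A.map_ofSymGrpd_toTop (F'.resEquiv F p r h j)).symm)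

theorem act_toTop_single (n : ℕ) :
    A.act (toTop (NOrd.single top n)) (quasibijection_toTop _) = 𝟙 _ :=
  A.act_id _ _

theorem quasibijection_toPt (P : Type) [LinearOrder P] [ThreeLevels P] :
    quasibijection P (toPt (NOrd.single (top : P) 1)) :=
  ⟨fun _ _ _ => Subsingleton.elim (α := Fin 1) _ _, fun _ => ⟨(0 : Fin 1),
    Subsingleton.elim (α := Fin 1) _ _⟩⟩

theorem act_toPt_toTop : A.act (toPt (NOrd.single top 1)) (quasibijection_toPt P) ≫
    A.act (toTop (pt P)) (quasibijection_toTop _) = 𝟙 _ := by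
  refine (A.coll.map_comp _ _).symm.trans ?_
  refine (congrArg (fun x => A.coll.map (Quiver.Hom.op x)) (PiQ.ofHom_comp (toTop (pt P))
    (toPt (NOrd.single top 1)) (quasibijection_toTop _) (quasibijection_toPt P)
    ((quasibijection P).comp_mem _ _ (quasibijection_toTop _) (quasibijection_toPt P)))).trans ?_
  have e : toTop (pt P) ≫ toPt (NOrd.single top 1) = 𝟙 (pt P) :=
    NOrd.Hom.ext (funext fun _ => Subsingleton.elim (α := Fin 1) _ _)
  have key : ∀ (g : pt P ⟶ pt P) (hg : quasibijection P g), g = 𝟙 _ → A.act g hg = 𝟙 _ := by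
    rintro g hg rfl
    exact A.act_id _ _
  exact key _ _ e

/-- The symmetric operad given by the ordinals of the top level. -/
def toSymmetricOperad : SymmetricOperad V where
  coll := (ofSymGrpd P).op ⋙ A.coll
  unit := A.str.unit ≫ A.act (toPt (NOrd.single top 1)) (quasibijection_toPt P)
  mul {_ _} f hf {_} F := A.str.mul (singleMono top f hf) hf (F.single top hf)
  assoc {_ _ _} f g hf hg {_ _ _} F G H :=
    A.str.assoc (singleMono top f hf) (singleMono top g hg) hf hg (hg.comp hf)
      (F.single top hf) (G.single top hg) (H.single top (hg.comp hf))
      fun i => H.res_monotone G f id (fun _ => rfl) i hf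
  mul_id n := by
    have e := A.mul_toTop (𝟙 (NOrd.single top n)) monotone_id
      (Fibers.ofQuasibijection _ Function.bijective_id)
    have e' : A.str.mul (singleMono top id monotone_id) monotone_id
        ((FinFibers.ofBijective Function.bijective_id).single top monotone_id) =
        (_ ◁ tensMap fun _ => A.act (toTop (pt P)) (quasibijection_toTop _)) ≫
          A.str.mul (𝟙 (NOrd.single top n)) monotone_id
            (Fibers.ofQuasibijection _ Function.bijective_id) := by
      refine ((congrArg (CategoryStruct.comp _) (A.act_toTop_single n)).trans
        (Category.comp_id _)).symm.trans (e.trans ?_)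
      exact congrArg (· ≫ _) ((congrArg (· ⊗ₘ _) (A.act_toTop_single n)).trans (id_tensorHom _ _))
    refine (congrArg (CategoryStruct.comp _) e').trans ((Category.assoc _ _ _).symm.trans ?_)
    refine (congrArg (· ≫ _) (insertUnits_comp _ _ _ _).symm).trans ?_
    refine Eq.trans ?_ (A.str.mul_id (NOrd.single top n) monotone_id)
    refine congrArg (fun x => insertUnits x _ _ ≫ _) ((Category.assoc _ _ _).trans ?_)
    exact (congrArg (CategoryStruct.comp _) A.act_toPt_toTop).trans (Category.comp_id _)
  mul_toPoint n := by
    have e := A.mul_toTop (toPt (NOrd.single top n)) monotone_const (Fibers.ofToPt _)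
    have e' : A.str.mul (singleMono top (fun _ => (0 : Fin 1)) monotone_const) monotone_const
        ((FinFibers.toPoint n).single top monotone_const) =
        A.act (toTop (pt P)) (quasibijection_toTop _) ▷ _ ≫
          A.str.mul (toPt (NOrd.single top n)) monotone_const (Fibers.ofToPt _) := by
      refine ((congrArg (CategoryStruct.comp _) (A.act_toTop_single n)).trans
        (Category.comp_id _)).symm.trans (e.trans ?_)
      refine congrArg (· ≫ _) ((congrArg (_ ⊗ₘ ·) ?_).trans (tensorHom_id _ _))
      exact (congrArg tensMap (funext fun _ => A.act_toTop_single n)).trans (tensMap_id _)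
    refine (congrArg (CategoryStruct.comp _) e').trans ((Category.assoc _ _ _).symm.trans ?_)
    refine (congrArg (· ≫ _) (insertUnit_comp _ _ _).symm).trans ?_
    refine Eq.trans ?_ (A.str.mul_toPt (NOrd.single top n) monotone_const)
    refine congrArg (fun x => insertUnit x _ ≫ _) ((Category.assoc _ _ _).trans ?_)
    exact (congrArg (CategoryStruct.comp _) A.act_toPt_toTop).trans (Category.comp_id _)
  equivariance₁ := by
    intro n k f f' hf hf' r p m F F' h
    have hfp : ∀ t, f (p t) = r (f' t) := fun t => by
      obtain ⟨a, ha⟩ := (F'.mem_range (f' t) t).2 rfl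
      rw [← ha, h, F.map_emb, F'.map_emb]
    refine (A.mul_single_equivariance hf hf' p r hfp F F').trans ?_
    refine congrArg (fun x => (_ ⊗ₘ x) ≫ _) ?_
    refine (congrArg (CategoryStruct.comp _) ?_).trans (Category.comp_id _)
    refine (congrArg tensMap (funext fun j => ?_)).trans (tensMap_id _)
    refine (congrArg (fun e => ((ofSymGrpd P).op ⋙ A.coll).map (Quiver.Hom.op
      (X := SymGrpd.mk (m (r j))) (Y := ⟨m (r j)⟩) e))
      (F'.eq_resEquiv F p r hfp j (.refl _) fun a => (h j a).symm).symm).trans ?_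
    exact ((ofSymGrpd P).op ⋙ A.coll).map_id _
  equivariance₂ := by
    intro n k f hf m F r p h
    have hfp : ∀ t, f (p t) = f t := fun t => by
      obtain ⟨a, ha⟩ := (F.mem_range (f t) t).2 rfl
      rw [← ha, h, F.map_emb, F.map_emb]
    refine (A.mul_single_equivariance hf hf p (.refl _) hfp F F).trans ?_
    refine congrArg (· ≫ _) (Eq.trans ?_ (id_tensorHom _ _))
    refine congrArg₂ (· ⊗ₘ ·) (((ofSymGrpd P).op ⋙ A.coll).map_id _) ?_
    refine (congrArg (· ≫ _) (permTens_id _ _)).trans ((Category.id_comp _).trans ?_)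
    refine congrArg tensMap (funext fun j => ?_)
    exact congrArg (fun e => ((ofSymGrpd P).op ⋙ A.coll).map (Quiver.Hom.op
      (X := SymGrpd.mk (m j)) (Y := ⟨m j⟩) e))
      (F.eq_resEquiv F p (.refl _) hfp j (r j) fun a => (h j a).symm).symm

/-- A morphism of `Q_n`-operads which is an isomorphism of collections is an isomorphism. -/
def isoOfNatIso {A B : QOperad P V} (φ : QOperad.Hom A B) (e : B.coll ⟶ A.coll)
    (h : φ.hom ≫ e = 𝟙 _) (h' : e ≫ φ.hom = 𝟙 _) : A ≅ B where
  hom := φ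
  inv :=
    { hom := e
      unit_hom := by
        rw [← φ.unit_hom, Category.assoc, ← NatTrans.comp_app, h]
        exact Category.comp_id _
      mul_hom := by
        intro T S f hf X F
        have hT : ∀ T, φ.hom.app T ≫ e.app T = 𝟙 _ := fun T =>
          congrArg (fun x => NatTrans.app x T) h
        have hT' : ∀ T, e.app T ≫ φ.hom.app T = 𝟙 _ := fun T =>
          congrArg (fun x => NatTrans.app x T) h'
        have ht : (e.app (op (PiQ.ofObj S)) ⊗ₘ tensMap fun i => e.app (op (PiQ.ofObj (X i)))) ≫
            (φ.hom.app (op (PiQ.ofObj S)) ⊗ₘ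
              tensMap fun i => φ.hom.app (op (PiQ.ofObj (X i)))) = 𝟙 _ := by
          rw [tensorHom_comp_tensorHom, tensMap_tensMap, hT',
            congrArg tensMap (funext fun i => hT' (op (PiQ.ofObj (X i)))), tensMap_id,
            id_tensorHom_id]
        have e1 := congrArg (fun x => (e.app (op (PiQ.ofObj S)) ⊗ₘ
          tensMap fun i => e.app (op (PiQ.ofObj (X i)))) ≫ x ≫ e.app (op (PiQ.ofObj T)))
          (φ.mul_hom f hf F)
        rw [Category.assoc, hT, Category.comp_id, ← Category.assoc, ← Category.assoc, ht,
          Category.id_comp] at e1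
        exact e1.symm }
  hom_inv_id := QOperad.Hom.ext h
  inv_hom_id := QOperad.Hom.ext h'

/-- A `Q_n`-operad is determined by its values on ordinals of the top level. -/
def toSymmetricOperadIso : (symmetricToQOperad P V).obj A.toSymmetricOperad ≅ A :=
  isoOfNatIso
    { hom := Functor.whiskerRight (NatTrans.op (toTopNatIso P).hom) A.coll
      unit_hom := by
        refine (Category.assoc _ _ _).trans ?_
        refine (congrArg (fun x => _ ≫ _ ≫ A.coll.map (Quiver.Hom.op x))
          (toTopNatIso_hom_app P (pt P))).trans ?_
        exact (congrArg (CategoryStruct.comp _) A.act_toPt_toTop).trans (Category.comp_id _)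
      mul_hom := by
        intro T S f hf X F
        have h : ∀ T : NOrd P, (Functor.whiskerRight (NatTrans.op (toTopNatIso P).hom)
            A.coll).app (op (PiQ.ofObj T)) = A.act (toTop T) (quasibijection_toTop T) :=
          fun T => congrArg (fun x => A.coll.map (Quiver.Hom.op x)) (toTopNatIso_hom_app P T)
        refine (congrArg (CategoryStruct.comp _) (h T)).trans ((A.mul_toTop f hf F).trans ?_)
        exact congrArg (· ≫ _) (congrArg₂ (· ⊗ₘ ·) (h S).symm
          (congrArg tensMap (funext fun i => (h (X i)).symm))) }
    (Functor.whiskerRight (NatTrans.op (toTopNatIso P).inv) A.coll)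
    (NatTrans.ext (funext fun T => (A.coll.map_comp _ _).symm.trans
      ((congrArg (fun x => A.coll.map (Quiver.Hom.op x))
        ((toTopNatIso P).inv_hom_id_app T.unop)).trans (A.coll.map_id _))))
    (NatTrans.ext (funext fun T => (A.coll.map_comp _ _).symm.trans
      ((congrArg (fun x => A.coll.map (Quiver.Hom.op x))
        ((toTopNatIso P).hom_inv_id_app T.unop)).trans (A.coll.map_id _))))

end QOperad

instance [ThreeLevels P] : (symmetricToQOperad P V).EssSurj where
  mem_essImage A := ⟨A.toSymmetricOperad, ⟨A.toSymmetricOperadIso⟩⟩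

theorem symmetricToQOperad_isEquivalence [ThreeLevels P] :
    (symmetricToQOperad P V).IsEquivalence where

end

section

open NOrd

namespace SymmetricOperad

variable {V : Type u} [Category.{v} V] [MonoidalCategory V] [SymmetricCategory V]
  (P : Type) [LinearOrder P] (B : SymmetricOperad V)

/-- A symmetric operad regarded as an `n`-operad. -/
def toNOperad : NOperad P V where
  obj T := B.obj T.card
  str :=
    { unit := B.unit
      mul := fun {_ _} _ _ {_} F => B.mulAll F.toFinFibers
      assoc := fun {_ _ _} _ _ _ _ _ {_ _ _} F G H _ =>
        B.mulAll_assoc F.toFinFibers G.toFinFibers H.toFinFibers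
      mul_id := fun T _ => (congrArg (CategoryStruct.comp _)
        (B.mulAll_eq_mul monotone_id (FinFibers.ofBijective Function.bijective_id))).trans
        (B.mul_id T.card)
      mul_toPt := fun T _ => (congrArg (CategoryStruct.comp _)
        (B.mulAll_eq_mul monotone_const (FinFibers.toPoint T.card))).trans
        (B.mul_toPoint T.card) }

theorem toNOperad_act {T S : NOrd P} (f : T ⟶ S) (hf : quasibijection P f) :
    (B.toNOperad P).act f hf = B.act (Equiv.ofBijective f.toFun hf) :=
  B.insertUnits_mulAll (Equiv.ofBijective f.toFun hf) (FinFibers.ofBijective hf)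

theorem isQuasisymmetric_toNOperad : isQuasisymmetric P V (B.toNOperad P) := by
  intro T S f hf
  rw [toNOperad_act]
  exact inferInstanceAs (IsIso (B.act (Equiv.ofBijective f.toFun hf)))

end SymmetricOperad

variable (P : Type) [LinearOrder P] (V : Type u) [Category.{v} V] [MonoidalCategory V]
  [SymmetricCategory V]

variable {V} in
theorem SymmetricOperad.Hom.mulAll_hom {B B' : SymmetricOperad V} (φ : Hom B B') {n k : ℕ}
    {f : Fin n → Fin k} {m : Fin k → ℕ} (F : FinFibers f m) :
    B.mulAll F ≫ φ.hom.app (op ⟨n⟩) =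
      (φ.hom.app (op ⟨k⟩) ⊗ₘ tensMap (fun i => φ.hom.app (op ⟨m i⟩))) ≫ B'.mulAll F := by
  rw [mulAll, mulAll, ← Category.assoc, ← φ.mul_hom, Category.assoc, Category.assoc]
  exact congrArg (CategoryStruct.comp _) (φ.hom.naturality _)

/-- Symmetric operads regarded as quasisymmetric `n`-operads. -/
def symmetricToQuasisymmetric : SymmetricOperad V ⥤ QuasisymmetricOperad P V where
  obj B := ⟨B.toNOperad P, B.isQuasisymmetric_toNOperad P⟩
  map φ := ObjectProperty.homMk
    { app := fun T => φ.hom.app (op ⟨T.card⟩)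
      unit_app := φ.unit_hom
      mul_app := fun {_ _} _ {_} F => φ.mulAll_hom F.toFinFibers }

variable {P V}

theorem insertUnits_naturality {Y Z X X' : V} (e : 𝟙_ V ⟶ Y) (g : Y ⟶ Z) (h : X ⟶ X') (k : ℕ) :
    insertUnits e X k ≫ (h ⊗ₘ tensMap fun _ => g) = h ≫ insertUnits (e ≫ g) X' k := by
  rw [insertUnits_comp, insertUnits, insertUnits, MonoidalCategory.tensorHom_def]
  simp only [Category.assoc, whiskerLeft_comp]
  rw [whisker_exchange_assoc, whisker_exchange_assoc, rightUnitor_inv_naturality_assoc]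

namespace NOperad

/-- Morphisms of `n`-operads are compatible with the action of quasibijections. -/
theorem Hom.act_app {A B : NOperad P V} (φ : Hom A B) {T S : NOrd P} (f : T ⟶ S)
    (hf : quasibijection P f) : A.act f hf ≫ φ.app T = φ.app S ≫ B.act f hf := by
  rw [act, act, Category.assoc, φ.mul_app, reassoc_of% insertUnits_naturality, φ.unit_app]

end NOperad

open ThreeLevels

instance [ThreeLevels P] : (symmetricToQuasisymmetric P V).Faithful where
  map_injective {B B'} φ ψ h := by
    refine SymmetricOperad.Hom.ext (NatTrans.ext (funext fun k => ?_))
    exact congrArg (fun η : (symmetricToQuasisymmetric P V).obj B ⟶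
      (symmetricToQuasisymmetric P V).obj B' =>
        NOperad.Hom.app η.hom (NOrd.single ThreeLevels.top k.unop.card)) h

instance [ThreeLevels P] : (symmetricToQuasisymmetric P V).Full where
  map_surjective {B B'} η := by
    let φ : NOperad.Hom (B.toNOperad P) (B'.toNOperad P) := η.hom
    have hact : ∀ {T S : NOrd P} (f : T ⟶ S) (hf : quasibijection P f),
        B.act (Equiv.ofBijective f.toFun hf) ≫ φ.app T =
          φ.app S ≫ B'.act (Equiv.ofBijective f.toFun hf) := by
      intro T S f hf
      rw [← B.toNOperad_act P f hf, ← B'.toNOperad_act P f hf]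
      exact φ.act_app f hf
    have h : ∀ T : NOrd P, φ.app T = φ.app (NOrd.single top T.card) := fun T => by
      have e : Equiv.ofBijective (toTop T).toFun (quasibijection_toTop T) = .refl _ :=
        Equiv.ext fun _ => rfl
      have e' := hact (toTop T) (quasibijection_toTop T)
      rw [e] at e'
      exact ((congrArg (· ≫ _) (B.act_refl T.card)).trans (Category.id_comp _)).symm.trans
        (e'.trans ((congrArg (CategoryStruct.comp _) (B'.act_refl T.card)).trans
          (Category.comp_id _)))
    refine ⟨⟨⟨fun k => φ.app (NOrd.single top k.unop.card), ?_⟩, ?_, ?_⟩,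
      ObjectProperty.hom_ext _ (NOperad.Hom.ext (funext fun T => (h T).symm))⟩
    · intro k l r
      let r' : Fin l.unop.card ≃ Fin k.unop.card := r.unop
      have e := hact (singleHom (low_lt_top P) r') r'.bijective
      rw [show Equiv.ofBijective (singleHom (low_lt_top P) r').toFun r'.bijective = r' from
        Equiv.ext fun _ => rfl] at e
      exact (congrArg (CategoryStruct.comp _) (h (NOrd.single low l.unop.card)).symm).trans e
    · exact (congrArg (CategoryStruct.comp _) (h (pt P)).symm).trans φ.unit_app
    · intro n k f hf m F
      have e := φ.mul_app (singleMono top f hf) (F.single top hf)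
      rw [← SymmetricOperad.mulAll_eq_mul, ← SymmetricOperad.mulAll_eq_mul]
      exact e

theorem insertUnits_shuffle {l k : ℕ} {g : Fin l → Fin k} {m : Fin k → ℕ} (G : FinFibers g m)
    (X : Fin k → V) {Y : V} (e : 𝟙_ V ⟶ Y) :
    insertUnits e (tens X) l ≫ (shuffle G X fun _ => Y).hom =
      tensMap fun i => insertUnits e (X i) (m i) := by
  have h := shuffle_naturality G (fun i => 𝟙 (X i)) (fun _ => e)
  rw [tensMap_id, id_tensorHom] at h
  rw [insertUnits, whiskerLeft_comp, Category.assoc, Category.assoc, h,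
    reassoc_of% shuffle_ones_right G X, tensMap_tensMap]
  refine congrArg tensMap (funext fun i => ?_)
  rw [id_tensorHom, insertUnits, whiskerLeft_comp, Category.assoc]

theorem insertUnit_shuffle {l k : ℕ} {g : Fin l → Fin k} (G : FinFibers g fun _ => 1)
    (Y : Fin l → V) (hG : Function.Bijective fun i => G.emb i 0) {X : V} (e : 𝟙_ V ⟶ X) :
    (λ_ (tens Y)).inv ≫ ((onesIso k).hom ≫ tensMap fun _ => e) ▷ tens Y ≫
        (shuffle G (fun _ => X) Y).hom =
      (permTens Y (fun i => G.emb i 0) hG).hom ≫ tensMap fun i => insertUnit e (Y (G.emb i 0)) := by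
  have h := shuffle_naturality G (fun _ => e) (fun s => 𝟙 (Y s))
  rw [tensMap_id, tensorHom_id] at h
  rw [comp_whiskerRight, Category.assoc, h, reassoc_of% shuffle_ones_left G Y hG, tensMap_tensMap]
  refine congrArg (CategoryStruct.comp _) (congrArg tensMap (funext fun i => ?_))
  have e' : (e ⊗ₘ tensMap fun j => 𝟙 (Y (G.emb i j))) = e ▷ _ := by
    rw [tensMap_id, tensorHom_id]
  refine ((congrArg (CategoryStruct.comp _) e').trans (Category.assoc _ _ _)).trans ?_
  exact congrArg (CategoryStruct.comp _)
    (MonoidalCategory.tensorHom_def' e (ρ_ (Y (G.emb i 0))).inv).symm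

/-- Fibres after a quasibijection of the target. -/
def Fibers.compQuasibijection {T S R : NOrd P} {f : T ⟶ S}
    {X : Fin S.card → NOrd P} (F : Fibers f X) (r : S ⟶ R) (hr : quasibijection P r) :
    Fibers (f ≫ r) fun i => X ((Equiv.ofBijective _ hr).symm i) where
  emb i := F.emb ((Equiv.ofBijective _ hr).symm i)
  strictMono i := F.strictMono ((Equiv.ofBijective _ hr).symm i)
  mem_range i t := by
    refine (F.mem_range ((Equiv.ofBijective _ hr).symm i) t).trans ?_
    rw [Equiv.eq_symm_apply]
    rfl
  lt_iff i := F.lt_iff ((Equiv.ofBijective _ hr).symm i)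

theorem permTens_of_eq {k : ℕ} {X Y : Fin k → V} (u : Fin k → Fin k) (hu)
    (h : ∀ i, u i = i) (ψ : ∀ s i, u i = s → (X s ⟶ Y i)) :
    (permTens X u hu).hom ≫ (tensMap fun i => ψ (u i) i rfl) = tensMap fun i => ψ i i (h i) := by
  obtain rfl : u = id := funext h
  exact (congrArg (· ≫ _) (permTens_id _ hu)).trans (Category.id_comp _)

namespace NOperad

variable (A : NOperad P V)

theorem act_id (T : NOrd P) (h : quasibijection P (𝟙 T)) : A.act (𝟙 T) h = 𝟙 _ :=
  A.str.mul_id T trivial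

theorem act_congr {T S : NOrd P} {f g : T ⟶ S} (h : f = g) (hf : quasibijection P f)
    (hg : quasibijection P g) : A.act f hf = A.act g hg := by
  subst h
  rfl

instance {T S : NOrd P} {f : T ⟶ S} {X : Fin S.card → NOrd P} : Subsingleton (Fibers f X) :=
  ⟨by
    rintro ⟨F, _⟩ ⟨G, _⟩
    obtain rfl := F.ext_emb G
    rfl⟩

/-- Multiplication followed by the action of a quasibijection of the source. -/
theorem mul_act {T' T S : NOrd P} (p : T' ⟶ T) (hp : quasibijection P p) (f : T ⟶ S)
    {X X' : Fin S.card → NOrd P} (F : Fibers f X) (F' : Fibers (p ≫ f) X') :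
    A.mul f F ≫ A.act p hp = A.obj S ◁ (tensMap fun i => A.act
      (F'.res F p id (fun _ => rfl) i)
      (F'.res_quasibijection F p id _ i hp Function.injective_id)) ≫ A.mul (p ≫ f) F' := by
  have e := A.str.assoc p f trivial trivial trivial (Fibers.ofQuasibijection p hp) F F'
    fun _ => trivial
  have e1 : A.mul f F ≫ insertUnits A.str.unit (A.obj T) T.card =
      insertUnits A.str.unit _ T.card ≫ A.mul f F ▷ _ := by
    have := insertUnits_naturality A.str.unit (𝟙 _) (A.mul f F) T.card
    rw [tensMap_id, Category.comp_id] at this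
    exact this.symm.trans (congrArg (CategoryStruct.comp _) (tensorHom_id _ _))
  have e2 : insertUnits A.str.unit (A.obj S ⊗ tens fun i => A.obj (X i)) T.card ≫ (α_ _ _ _).hom =
      A.obj S ◁ insertUnits A.str.unit (tens fun i => A.obj (X i)) T.card := by
    simp [insertUnits]
  refine (Category.assoc _ _ _).symm.trans ((congrArg (· ≫ _) e1).trans ?_)
  refine (Category.assoc _ _ _).trans ((congrArg (CategoryStruct.comp _) e.symm).trans ?_)
  refine (Category.assoc _ _ _).symm.trans ((congrArg (· ≫ _) e2).trans ?_)
  refine (whiskerLeft_comp_assoc _ _ _ _).symm.trans (congrArg (fun x => _ ◁ x ≫ _) ?_)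
  refine (Category.assoc _ _ _).symm.trans
    ((congrArg (· ≫ _) (insertUnits_shuffle F.toFinFibers _ _)).trans ?_)
  refine (tensMap_tensMap _ _).trans (congrArg tensMap (funext fun i => ?_))
  exact congrArg (fun G => insertUnits A.str.unit (A.obj (X i)) (X i).card ≫ A.mul _ G)
    (Subsingleton.elim _ _)

theorem insertUnit_mul {T : NOrd P} (f : T ⟶ pt P) (F : Fibers f fun _ => T) :
    insertUnit A.str.unit (A.obj T) ≫ A.mul f F = 𝟙 _ := by
  obtain rfl : f = toPt T :=
    NOrd.Hom.ext (funext fun _ => Subsingleton.elim (α := Fin 1) _ _)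
  obtain rfl : F = Fibers.ofToPt T := Subsingleton.elim _ _
  exact A.str.mul_toPt T trivial

/-- Multiplication preceded by the action of a quasibijection of the target. -/
theorem act_mul {T S R : NOrd P} (f : T ⟶ S) (r : S ⟶ R) (hr : quasibijection P r)
    {X : Fin S.card → NOrd P} (F : Fibers f X) :
    A.act r hr ▷ (tens fun s => A.obj (X s)) ≫ A.mul f F =
      A.obj R ◁ (permTens (fun s => A.obj (X s)) (Equiv.ofBijective _ hr).symm
        (Equiv.bijective _)).hom ≫ A.mul (f ≫ r) (F.compQuasibijection r hr) := by
  have e := A.str.assoc f r trivial trivial trivial F (Fibers.ofQuasibijection r hr)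
    (F.compQuasibijection r hr) fun _ => trivial
  have e2 : insertUnits A.str.unit (A.obj R) R.card ▷ (tens fun s => A.obj (X s)) ≫
      (α_ _ _ _).hom = A.obj R ◁ ((λ_ (tens fun s => A.obj (X s))).inv ≫
        ((onesIso R.card).hom ≫ tensMap fun _ => A.str.unit) ▷ (tens fun s => A.obj (X s))) := by
    simp [insertUnits]
  refine (congrArg (· ≫ _) (comp_whiskerRight _ _ _)).trans ?_
  refine (Category.assoc _ _ _).trans ((congrArg (CategoryStruct.comp _) e.symm).trans ?_)
  refine (Category.assoc _ _ _).symm.trans ((congrArg (· ≫ _) e2).trans ?_)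
  refine (whiskerLeft_comp_assoc _ _ _ _).symm.trans (congrArg (fun x => _ ◁ x ≫ _) ?_)
  refine (Category.assoc _ _ _).trans ?_
  refine (congrArg (CategoryStruct.comp _) (Category.assoc _ _ _).symm).trans ?_
  refine (Category.assoc _ _ _).symm.trans ((congrArg (· ≫ _) (insertUnit_shuffle
    (FinFibers.ofBijective hr) (fun s => A.obj (X s)) (Equiv.bijective _) A.str.unit)).trans ?_)
  refine (Category.assoc _ _ _).trans ?_
  refine (congrArg (CategoryStruct.comp _) ?_).trans (Category.comp_id _)
  refine (tensMap_tensMap _ _).trans ((congrArg tensMap (funext fun i => ?_)).trans (tensMap_id _))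
  exact A.insertUnit_mul _ _

/-- The multiplications of an `n`-operad are equivariant with respect to quasibijections. -/
theorem mul_equivariance {T' S' T S : NOrd P} (f' : T' ⟶ S') (f : T ⟶ S)
    (p : T' ⟶ T) (r : S' ⟶ S) (hp : quasibijection P p) (hr : quasibijection P r)
    (comm : p ≫ f = f' ≫ r) {X' : Fin S'.card → NOrd P} {X : Fin S.card → NOrd P}
    (F' : Fibers f' X') (F : Fibers f X) :
    A.mul f F ≫ A.act p hp =
      (A.act r hr ⊗ₘ
        ((permTens (fun i => A.obj (X i)) r.toFun hr).hom ≫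
          tensMap (fun j => A.act
            (F'.res F p r.toFun (fun t => congrFun (congrArg Hom.toFun comm) t) j)
            (F'.res_quasibijection F p r.toFun _ j hp hr.1)))) ≫
        A.mul f' F' := by
  let e := Equiv.ofBijective r.toFun hr
  let H : Fibers (f' ≫ r) fun i => X' (e.symm i) := F'.compQuasibijection r hr
  have key : ∀ (c : T' ⟶ S) (hc : c = p ≫ f) {Y : Fin S.card → NOrd P} (C : Fibers c Y),
      A.mul f F ≫ A.act p hp = A.obj S ◁ (tensMap fun i => A.act
        (C.res F p id (fun t => (congrFun (congrArg Hom.toFun hc) t).symm) i)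
        (C.res_quasibijection F p id _ i hp Function.injective_id)) ≫ A.mul c C := by
    rintro c rfl Y C
    exact A.mul_act p hp f F C
  rw [key (f' ≫ r) comm.symm H, MonoidalCategory.tensorHom_def', Category.assoc, act_mul,
    ← whiskerLeft_comp_assoc]
  refine congrArg (fun x => _ ◁ x ≫ _) ?_
  rw [Category.assoc, permTens_naturality]
  have hu : ∀ i, r.toFun (e.symm i) = i := e.apply_symm_apply
  have hR : ∀ s i, r.toFun (e.symm i) = s → ∃ g : X' (e.symm i) ⟶ X s, quasibijection P g ∧
      ∀ a, F.emb s (g.toFun a) = p.toFun (F'.emb (e.symm i) a) := by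
    rintro s i rfl
    exact ⟨F'.res F p r.toFun (fun t => congrFun (congrArg Hom.toFun comm) t) (e.symm i),
      F'.res_quasibijection F p r.toFun _ _ hp hr.1,
      F'.toFinFibers.emb_res F.toFinFibers p.toFun r.toFun
        (fun t => congrFun (congrArg Hom.toFun comm) t) (e.symm i)⟩
  choose R hR hRe using hR
  have hψ : ∀ s i h (g : X' (e.symm i) ⟶ X s) (hg : quasibijection P g),
      (∀ a, F.emb s (g.toFun a) = p.toFun (F'.emb (e.symm i) a)) →
      A.act g hg = A.act (R s i h) (hR s i h) := fun s i h g hg hga =>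
    A.act_congr (NOrd.Hom.ext (funext fun a => (F.strictMono s).injective
      ((hga a).trans (hRe s i h a).symm))) _ _
  refine (congrArg tensMap (funext fun i => hψ i i (hu i)
    (H.res F p id (fun t => congrFun (congrArg Hom.toFun comm) t) i)
    (H.res_quasibijection F p id _ i hp Function.injective_id)
    (H.toFinFibers.emb_res F.toFinFibers p.toFun id
      (fun t => congrFun (congrArg Hom.toFun comm) t) i))).trans ?_
  refine (permTens_of_eq (fun i => r.toFun (e.symm i)) (hr.comp e.symm.bijective) hu
    fun s i h => A.act (R s i h) (hR s i h)).symm.trans ?_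
  refine (congrArg (· ≫ _) (permTens_comp (fun i => A.obj (X i)) r.toFun hr e.symm
    e.symm.bijective _).symm).trans ((Category.assoc _ _ _).trans ?_)
  refine congrArg (CategoryStruct.comp _) (congrArg (CategoryStruct.comp _)
    (congrArg tensMap (funext fun i => ?_)))
  exact (hψ _ i rfl _ (F'.res_quasibijection F p r.toFun _ _ hp hr.1) fun a =>
    F'.toFinFibers.emb_res F.toFinFibers p.toFun r.toFun
      (fun t => congrFun (congrArg Hom.toFun comm) t) (e.symm i) a).symm

end NOperad

end

section

open NOrd

theorem isIso_tensMap {V : Type u} [Category.{v} V] [MonoidalCategory V] {k : ℕ} {X Y : Fin k → V}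
    {f : ∀ i, X i ⟶ Y i} (h : ∀ i, IsIso (f i)) : IsIso (tensMap f) :=
  ⟨tensMap fun i => inv (f i), by
    rw [← tensMap_comp, ← tensMap_id]
    exact congrArg tensMap (funext fun i => IsIso.hom_inv_id _), by
    rw [← tensMap_comp, ← tensMap_id]
    exact congrArg tensMap (funext fun i => IsIso.inv_hom_id _)⟩

namespace NOperad

variable {P : Type} [LinearOrder P] {V : Type u} [Category.{v} V] [MonoidalCategory V]
  [SymmetricCategory V]

theorem act_comp (A : NOperad P V) {T S R : NOrd P} (f : T ⟶ S) (g : S ⟶ R)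
    (hf : quasibijection P f) (hg : quasibijection P g) (hfg : quasibijection P (f ≫ g)) :
    A.act (f ≫ g) hfg = A.act g hg ≫ A.act f hf := by
  have e := A.mul_act f hf g (Fibers.ofQuasibijection g hg) (Fibers.ofQuasibijection _ hfg)
  rw [act, act, Category.assoc, e]
  refine congrArg (CategoryStruct.comp _) (Eq.symm ?_)
  refine (congrArg (fun x => _ ◁ x ≫ _) ((congrArg tensMap (funext fun i => ?_)).trans
    (tensMap_id _))).trans ?_
  · exact (A.act_congr (g := 𝟙 (pt P)) (NOrd.Hom.ext
    (funext fun _ => Subsingleton.elim (α := Fin 1) _ _)) _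
      Function.bijective_id).trans (A.act_id (pt P) Function.bijective_id)
  · rw [whiskerLeft_id, Category.id_comp]

section Quasisymmetric

variable (A : NOperad P V) (hA : isQuasisymmetric P V A)

/-- The action of quasibijections on a quasisymmetric operad, with values in isomorphisms. -/
def actCore : QCat P ⥤ Core Vᵒᵖ where
  obj T := ⟨op (A.obj T.obj)⟩
  map f := ⟨((have := hA f.hom f.property; asIso (A.act f.hom f.property))).op⟩
  map_id T := by
    ext
    exact congrArg Quiver.Hom.op (A.act_id T.obj Function.bijective_id)
  map_comp f g := by
    ext
    exact congrArg Quiver.Hom.op (A.act_comp f.hom g.hom f.property g.property _)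

/-- The collection underlying a quasisymmetric operad. -/
def collection : (PiQ P)ᵒᵖ ⥤ V :=
  (FreeGroupoid.lift (actCore A hA) ⋙ Core.inclusion Vᵒᵖ).leftOp

theorem collection_map_ofHom {T S : NOrd P} (f : T ⟶ S) (hf : quasibijection P f) :
    (collection A hA).map (PiQ.ofHom f hf).op = A.act f hf :=
  congrArg (fun x : CoreHom (Core.mk (op (A.obj T))) (Core.mk (op (A.obj S))) => x.iso.hom.unop)
    (FreeGroupoid.lift_map_homMk (actCore A hA) (X := ⟨T⟩) (Y := ⟨S⟩) ⟨f, hf⟩)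

theorem collection_map_inv_ofHom {T S : NOrd P} (f : T ⟶ S) (hf : quasibijection P f) :
    (collection A hA).map (Groupoid.inv (PiQ.ofHom f hf)).op ≫ A.act f hf = 𝟙 _ := by
  refine (congrArg (CategoryStruct.comp _) (collection_map_ofHom A hA f hf).symm).trans ?_
  refine ((collection A hA).map_comp _ _).symm.trans ?_
  exact (congrArg (fun x => (collection A hA).map (Quiver.Hom.op x)) (Groupoid.comp_inv _)).trans
    ((collection A hA).map_id _)

/-- A quasisymmetric `n`-operad regarded as a `Q_n`-operad. -/
def toQOperad : QOperad P V where
  coll := collection A hA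
  str :=
    { unit := A.str.unit
      mul := fun {_ _} f _ {_} F => A.mul f F
      assoc := fun {_ _ _} f g _ _ _ {_ _ _} F G H _ =>
        A.str.assoc f g trivial trivial trivial F G H fun _ => trivial
      mul_id := fun T _ => A.str.mul_id T trivial
      mul_toPt := fun T _ => A.str.mul_toPt T trivial }
  equivariance₁ := by
    intro T' S' T S f' f hf' hf p r hp hr comm X' X F' F
    refine (congrArg (_ ≫ ·) (collection_map_ofHom A hA p hp)).trans ?_
    refine (A.mul_equivariance f' f p r hp hr comm F' F).trans ?_
    refine congrArg (· ≫ _) (congrArg₂ (· ⊗ₘ ·) (collection_map_ofHom A hA r hr).symm ?_)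
    exact congrArg (_ ≫ ·) (congrArg tensMap
      (funext fun j => (collection_map_ofHom A hA
        (F'.res F p r.toFun (fun t => congrFun (congrArg Hom.toFun comm) t) j)
        (F'.res_quasibijection F p r.toFun _ j hp hr.1)).symm))
  equivariance₂ := by
    intro T T' T'' S s' s h' h hs' hs hh' hh comm X X' X'' F F' F''
    have key : ∀ {U : NOrd P} (t : T ⟶ U) (ht : quasibijection P t) (g : U ⟶ S)
        {Y : Fin S.card → NOrd P} (G : Fibers g Y) (c : t ≫ g = s ≫ h),
        (A.obj S ◁ tensMap (fun i => (collection A hA).map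
          (Groupoid.inv (PiQ.ofHom
            (F.res G t id (fun x => congrFun (congrArg Hom.toFun c) x) i)
            (F.res_quasibijection G t id _ i ht Function.injective_id))).op)) ≫
          A.mul g G ≫ (collection A hA).map (PiQ.ofHom t ht).op =
        A.mul (s ≫ h) F := by
      generalize s ≫ h = a at *
      rintro U t ht g Y G rfl
      refine (congrArg (fun x => _ ≫ _ ≫ x) (collection_map_ofHom A hA t ht)).trans ?_
      refine (congrArg (CategoryStruct.comp _) (A.mul_act t ht g G F)).trans ?_
      refine (whiskerLeft_comp_assoc _ _ _ _).symm.trans ?_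
      refine (congrArg (fun x => _ ◁ x ≫ _) ((tensMap_tensMap _ _).trans
        ((congrArg tensMap (funext fun i => collection_map_inv_ofHom A hA _ _)).trans
        (tensMap_id _)))).trans ?_
      exact (congrArg (· ≫ _) (whiskerLeft_id _ _)).trans (Category.id_comp _)
    exact (key s' hs' h' F' comm.symm).trans (key s hs h F'' rfl).symm

end Quasisymmetric

section OrderPreserving

variable {A B : NOperad P V} (ψ : ∀ T, A.obj T ⟶ B.obj T)

/-- Compatibility of a family of morphisms with multiplications is invariant under
quasibijections. -/
theorem mul_comp_iff
    (hψ : ∀ {T S : NOrd P} (f : T ⟶ S) (hf : quasibijection P f),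
      A.act f hf ≫ ψ T = ψ S ≫ B.act f hf)
    (hA : isQuasisymmetric P V A) (hB : isQuasisymmetric P V B)
    {T' S' T S : NOrd P} (f' : T' ⟶ S') (f : T ⟶ S)
    (p : T' ⟶ T) (r : S' ⟶ S) (hp : quasibijection P p) (hr : quasibijection P r)
    (comm : p ≫ f = f' ≫ r) {X' : Fin S'.card → NOrd P} {X : Fin S.card → NOrd P}
    (F' : Fibers f' X') (F : Fibers f X) :
    A.mul f F ≫ ψ T = (ψ S ⊗ₘ tensMap fun i => ψ (X i)) ≫ B.mul f F ↔
      A.mul f' F' ≫ ψ T' = (ψ S' ⊗ₘ tensMap fun i => ψ (X' i)) ≫ B.mul f' F' := by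
  have eA := A.mul_equivariance f' f p r hp hr comm F' F
  have eB := B.mul_equivariance f' f p r hp hr comm F' F
  have hα : ∀ j, IsIso (A.act
      (F'.res F p r.toFun (fun t => congrFun (congrArg Hom.toFun comm) t) j)
      (F'.res_quasibijection F p r.toFun _ j hp hr.1)) := fun j => hA _ _
  have e : (A.act r hr ⊗ₘ
        ((permTens (fun i => A.obj (X i)) r.toFun hr).hom ≫
          tensMap (fun j => A.act
            (F'.res F p r.toFun (fun t => congrFun (congrArg Hom.toFun comm) t) j)
            (F'.res_quasibijection F p r.toFun _ j hp hr.1)))) ≫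
        (ψ S' ⊗ₘ tensMap fun i => ψ (X' i)) =
      (ψ S ⊗ₘ tensMap fun i => ψ (X i)) ≫ (B.act r hr ⊗ₘ
        ((permTens (fun i => B.obj (X i)) r.toFun hr).hom ≫
          tensMap (fun j => B.act
            (F'.res F p r.toFun (fun t => congrFun (congrArg Hom.toFun comm) t) j)
            (F'.res_quasibijection F p r.toFun _ j hp hr.1)))) := by
    rw [tensorHom_comp_tensorHom, tensorHom_comp_tensorHom, hψ, Category.assoc, tensMap_tensMap]
    refine congrArg (_ ⊗ₘ ·) (Eq.trans ?_
      ((reassoc_of% (permTens_naturality (fun i => ψ (X i)) r.toFun hr)) _).symm)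
    refine congrArg (CategoryStruct.comp _) (Eq.trans ?_ (tensMap_tensMap _ _).symm)
    exact congrArg tensMap (funext fun j => hψ _ _)
  have := hA r hr
  have := hB p hp
  have := isIso_tensMap hα
  rw [← cancel_mono (B.act p hp), Category.assoc, ← hψ p hp, reassoc_of% eA, Category.assoc, eB,
    ← reassoc_of% e, cancel_epi]

/-- A family of morphisms of quasisymmetric operads which is compatible with quasibijections and
multiplications for order preserving maps is compatible with all multiplications. -/
theorem mul_comp_of_orderPreserving [ThreeLevels P]
    (hψ : ∀ {T S : NOrd P} (f : T ⟶ S) (hf : quasibijection P f),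
      A.act f hf ≫ ψ T = ψ S ≫ B.act f hf)
    (hA : isQuasisymmetric P V A) (hB : isQuasisymmetric P V B)
    (hm : ∀ {T S : NOrd P} (f : T ⟶ S) (_ : orderPreserving P f) {X : Fin S.card → NOrd P}
      (F : Fibers f X), A.mul f F ≫ ψ T = (ψ S ⊗ₘ tensMap fun i => ψ (X i)) ≫ B.mul f F)
    {T S : NOrd P} (f : T ⟶ S) {X : Fin S.card → NOrd P} (F : Fibers f X) :
    A.mul f F ≫ ψ T = (ψ S ⊗ₘ tensMap fun i => ψ (X i)) ≫ B.mul f F := by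
  obtain ⟨p, hp, h⟩ := T.exists_lowerBound
  obtain ⟨X', ⟨F'⟩⟩ := Fibers.exists_fibers (ofSingle T p h ≫ f)
  rw [mul_comp_iff ψ hψ hA hB (ofSingle T p h ≫ f) f (ofSingle T p h) (𝟙 S) Function.bijective_id
    Function.bijective_id (Category.comp_id _).symm F' F]
  rw [← mul_comp_iff ψ hψ hA hB (ofSingle T p h ≫ f)
    (singleMono ThreeLevels.top _ (SymmetricOperad.sorted_monotone F.toFinFibers))
    (singleHom hp (SymmetricOperad.sorting F.toFinFibers)) (toTop S) (Equiv.bijective _)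
    (quasibijection_toTop S)
    (NOrd.Hom.ext (funext fun t => SymmetricOperad.sorted_sorting F.toFinFibers t)) F'
    ((SymmetricOperad.sortedFibers F.toFinFibers).single ThreeLevels.top
      (SymmetricOperad.sorted_monotone F.toFinFibers))]
  exact hm (singleMono ThreeLevels.top _ (SymmetricOperad.sorted_monotone F.toFinFibers))
    (SymmetricOperad.sorted_monotone F.toFinFibers) _

end OrderPreserving

/-- A morphism of `n`-operads with invertible components is an isomorphism. -/
def isoOfComponents {A B : NOperad P V} (φ : Hom A B) (e : ∀ T, B.obj T ⟶ A.obj T)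
    (h : ∀ T, φ.app T ≫ e T = 𝟙 _) (h' : ∀ T, e T ≫ φ.app T = 𝟙 _) : A ≅ B where
  hom := φ
  inv :=
    { app := e
      unit_app := by
        rw [← φ.unit_app, Category.assoc, h]
        exact Category.comp_id _
      mul_app := by
        intro T S f X F
        have ht : (e S ⊗ₘ tensMap fun i => e (X i)) ≫
            (φ.app S ⊗ₘ tensMap fun i => φ.app (X i)) = 𝟙 _ := by
          rw [tensorHom_comp_tensorHom, tensMap_tensMap, h',
            congrArg tensMap (funext fun i => h' (X i)), tensMap_id, id_tensorHom_id]
        have e1 := congrArg (fun x => (e S ⊗ₘ tensMap fun i => e (X i)) ≫ x ≫ e T)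
          (φ.mul_app f F)
        rw [Category.assoc, h, Category.comp_id, ← Category.assoc, ← Category.assoc, ht,
          Category.id_comp] at e1
        exact e1.symm }
  hom_inv_id := NOperad.Hom.ext (funext h)
  inv_hom_id := NOperad.Hom.ext (funext h')

end NOperad

open ThreeLevels

variable {P : Type} [LinearOrder P] [ThreeLevels P] {V : Type u} [Category.{v} V]
  [MonoidalCategory V] [SymmetricCategory V]

instance : (symmetricToQuasisymmetric P V).EssSurj where
  mem_essImage := by
    rintro ⟨A, hA⟩
    obtain ⟨B, ⟨ι⟩⟩ := Functor.EssSurj.mem_essImage (F := symmetricToQOperad P V)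
      (A.toQOperad hA)
    let φ : QOperad.Hom (B.toQOperad P) (A.toQOperad hA) := ι.hom
    let φ' : QOperad.Hom (A.toQOperad hA) (B.toQOperad P) := ι.inv
    have hact : ∀ {T S : NOrd P} (f : T ⟶ S) (hf : quasibijection P f),
        (B.toNOperad P).act f hf ≫ φ.hom.app (op (PiQ.ofObj T)) =
          φ.hom.app (op (PiQ.ofObj S)) ≫ A.act f hf := by
      intro T S f hf
      have e := φ.hom.naturality (PiQ.ofHom f hf).op
      refine (congrArg (· ≫ _) ((B.toNOperad_act P f hf).trans
        (B.map_totalOrderPi_ofHom f hf).symm)).trans (e.trans ?_)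
      exact congrArg (CategoryStruct.comp _) (A.collection_map_ofHom hA f hf)
    have hmul := fun T S => NOperad.mul_comp_of_orderPreserving (A := B.toNOperad P)
      (T := T) (S := S) (fun T => φ.hom.app (op (PiQ.ofObj T))) hact
        (B.isQuasisymmetric_toNOperad P) hA
      (fun {T S} f hf {X} F => (congrArg (· ≫ _) (B.mulAll_eq_mul hf F.toFinFibers)).trans
        (φ.mul_hom f hf F))
    refine ⟨B, ⟨ObjectProperty.isoMk _ (NOperad.isoOfComponents
      ⟨fun T => φ.hom.app (op (PiQ.ofObj T)), φ.unit_hom, fun {_ _} f {_} F => hmul _ _ f F⟩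
      (fun T => φ'.hom.app (op (PiQ.ofObj T))) (fun T => ?_) fun T => ?_)⟩⟩
    · exact congrArg (fun x : QOperad.Hom (B.toQOperad P) (B.toQOperad P) =>
        x.hom.app (op (PiQ.ofObj T))) ι.hom_inv_id
    · exact congrArg (fun x : QOperad.Hom (A.toQOperad hA) (A.toQOperad hA) =>
        x.hom.app (op (PiQ.ofObj T))) ι.inv_hom_id

theorem symmetricToQuasisymmetric_isEquivalence :
    (symmetricToQuasisymmetric P V).IsEquivalence where

theorem nonempty_threeLevels (n : ℕ∞) (hn : 3 ≤ n) : Nonempty (ThreeLevels (Level n)) := by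
  match n, hn with
  | ⊤, _ =>
    let i : ThreeLevels ℕᵒᵈ :=
      ⟨OrderDual.toDual 2, OrderDual.toDual 1, OrderDual.toDual 0, by decide, by decide,
        fun p => OrderDual.ofDual_le_ofDual.1 (Nat.zero_le _)⟩
    exact ⟨i⟩
  | (n : ℕ), hn =>
    have hn : 3 ≤ n := by exact_mod_cast hn
    let i : ThreeLevels (Fin n) :=
      ⟨⟨0, by omega⟩, ⟨1, by omega⟩, ⟨n - 1, by omega⟩, Fin.mk_lt_mk.2 (by omega),
        Fin.mk_lt_mk.2 (by omega), fun p => Fin.le_def.2 (Nat.le_sub_one_of_lt p.isLt)⟩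
    exact ⟨i⟩

end

end HigherOperad

end

theorem mainTheorem5 (n : ℕ∞) (hn : 3 ≤ n) :
    (HigherOperad.totalOrderPi (HigherOperad.Level n)).IsEquivalence ∧
    ∀ (V : Type u) [Category.{v} V] [MonoidalCategory V] [SymmetricCategory V],
      Nonempty (HigherOperad.QOperad (HigherOperad.Level n) V ≌ HigherOperad.SymmetricOperad V) ∧
      Nonempty (HigherOperad.QuasisymmetricOperad (HigherOperad.Level n) V ≌
        HigherOperad.SymmetricOperad V) ∧
      Nonempty (HigherOperad.QOperad (HigherOperad.Level n) V ≌
        HigherOperad.QuasisymmetricOperad (HigherOperad.Level n) V) := by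
  obtain ⟨_⟩ := HigherOperad.nonempty_threeLevels n hn
  refine ⟨HigherOperad.totalOrderPi_isEquivalence _, fun V _ _ _ => ?_⟩
  have h₁ := HigherOperad.symmetricToQOperad_isEquivalence (P := HigherOperad.Level n) (V := V)
  have h₂ := HigherOperad.symmetricToQuasisymmetric_isEquivalence
    (P := HigherOperad.Level n) (V := V)
  let e₁ := (HigherOperad.symmetricToQOperad (HigherOperad.Level n) V).asEquivalence
  let e₂ := (HigherOperad.symmetricToQuasisymmetric (HigherOperad.Level n) V).asEquivalence
  exact ⟨⟨e₁.symm⟩, ⟨e₂.symm⟩, ⟨e₁.symm.trans e₂⟩⟩
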